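/- Let $T>0$, $\varphi_0>0$, $\lambda>0$, $c_0\ge 0$, and let $\varphi_1\in\mathbb R$ be such that $m\le \varphi_0+\varphi_1c_0e^{-\lambda u}\le M$ for all $u\ge 0$, with some constants $m,M>0$. Let $K:\mathbb R\to[0,\infty)$ be a $C^\infty$ probability density which is bounded together with $K'$ and $K''$ and such that $K$ and $K'$ are Lipschitz. Let $\rho_0\in L^2(\mathbb R)\cap C_b(\mathbb R)$ be a probability density with finite second moment. Put $$b(x,y)=-\varphi_1\lambda c_0\,\frac{e^{-\lambda x}y}{\varphi_0+\varphi_1c_0e^{-\lambda x}}.$$ Let $\Delta$ be a cemetery state isolated from $\mathbb R$, let functions on $\mathbb R$ (in particular $K*\nu$ and $K'*\nu$) be extended by $0$ at $\Delta$, and write $(f*\nu)(x)=\int_{\mathbb R}f(x-y)\,\nu(dy)$. A (weak) solution consists of a filtered probability space $(\Omega,\mathcal F,(\mathcal F_t)_{t\in[0,T]},\mathbb P)$ carrying an $(\mathcal F_t)$-Brownian motion $W$, an $\mathcal F_0$-measurable $X_0$ with law $\rho_0(x)\,dx$, a random variable $Z\sim\mathrm{Exp}(1)$ independent of $(X_0,W)$,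 an adapted $\mathbb R\cup\{\Delta\}$-valued process $(X_t)_{t\in[0,T]}$ and an $(\mathcal F_t)$-stopping time $\tau$ with values in $[0,T]\cup\{\infty\}$ such that, with $\nu_t(A)=\mathbb P(X_t\in A,\ t<\tau)$ for Borel $A\subseteq\mathbb R$, almost surely: $X$ is continuous on $[0,\tau)\cap[0,T]$; the time integrals below exist; $$X_t=X_0+\int_0^t b\Big(\int_0^sK*\nu_r(X_s)\,dr,\ \int_0^sK'*\nu_r(X_s)\,dr\Big)ds+\sqrt2\,W_t\quad\text{for } t\in[0,\tau)\cap[0,T];$$ $$X_t=\Delta\quad\text{for } t\in[0,T],\ t\ge\tau;$$ $$\tau=\inf\Big\{t\in[0,T]:\int_0^t\lambda c_0\exp\Big(-\lambda\int_0^sK*\nu_r(X_s)\,dr\Big)ds\ge Z\Big\},\qquad \inf\emptyset=\infty.$$ A strong solution for given inputs $(W,X_0,Z)$ is a solution with those inputs relative to the filtration generated by $X_0$, $Z$, $(W_s)_{s\le t}$ and the $\mathbb P$-null events. Then: (i) on every probability space carrying inputs $(W,X_0,Z)$ as above there is a strong solution $X$; (ii) pathwise uniqueness holds: any two solutions on the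 same probability space with the same inputs $(W,X_0,Z)$ (possibly relative to different filtrations) satisfy, almost surely, $\tau=\tau'$ and $X_t=X'_t$ for all $t\in[0,T]$; (iii) a weak solution exists; (iv) it is unique in law: any two solutions, possibly on different probability spaces, have processes $X$, $X'$ with the same law on the space of paths $[0,T]\to\mathbb R\cup\{\Delta\}$ with the $\sigma$-algebra generated by the coordinates. -/

import Mathlib

open MeasureTheory ProbabilityTheory

namespace KilledMcKeanVlasov

noncomputable section

/-- The state space `ℝ ∪ {Δ}`, with the cemetery `Δ` an isolated point (disjoint union topology
and σ-algebra). -/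
abbrev State : Type := ℝ ⊕ Unit

/-- The cemetery state `Δ`. -/
def cemetery : State := Sum.inr ()

/-- The embedding `ℝ → ℝ ∪ {Δ}`. -/
def alive (x : ℝ) : State := Sum.inl x

/-- A function on `ℝ` extended to `ℝ ∪ {Δ}` by the value `0` at `Δ`. -/
def extendZero (f : ℝ → ℝ) : State → ℝ := Sum.elim f (fun _ => 0)

/-- The time interval `[0, T]`. -/
abbrev TimeInterval (T : ℝ) : Type := Set.Icc (0 : ℝ) T

/-- Lebesgue measure on `[0, T]`; `∫ s in Set.Iic t, f s ∂timeMeasure T` is `∫₀ᵗ f(s) ds`. -/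
def timeMeasure (T : ℝ) : Measure (TimeInterval T) := Measure.comap Subtype.val volume

/-- A smooth mollifier: a smooth probability density, bounded together with its first two
derivatives, and Lipschitz together with its first derivative. -/
structure IsSmoothMollifier (K : ℝ → ℝ) : Prop where
  nonneg : ∀ y, 0 ≤ K y
  smooth : ContDiff ℝ ((⊤ : ℕ∞) : WithTop ℕ∞) K
  bounded : ∃ M, ∀ y, |K y| ≤ M
  bounded_deriv : ∃ M, ∀ y, |deriv K y| ≤ M
  bounded_deriv2 : ∃ M, ∀ y, |deriv (deriv K) y| ≤ M
  lipschitz : ∃ L, ∀ y y', |K y' - K y| ≤ L * |y' - y|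
  lipschitz_deriv : ∃ L, ∀ y y', |deriv K y' - deriv K y| ≤ L * |y' - y|
  integrable : Integrable K
  integral_eq_one : ∫ y, K y = 1

/-- The measure `ρ₀(x) dx` on `ℝ`. -/
def initialLaw (ρ₀ : ℝ → ℝ) : Measure ℝ := volume.withDensity (fun x => ENNReal.ofReal (ρ₀ x))

/-- `ρ₀` is a probability density in `L²(ℝ) ∩ C_b(ℝ)` with finite second moment. -/
structure IsInitialDensity (ρ₀ : ℝ → ℝ) : Prop where
  nonneg : ∀ x, 0 ≤ ρ₀ x
  continuous : Continuous ρ₀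
  bounded : ∃ C, ∀ x, ρ₀ x ≤ C
  memLp : MemLp ρ₀ 2
  isProbabilityMeasure : IsProbabilityMeasure (initialLaw ρ₀)
  second_moment : Integrable (fun x : ℝ => x ^ 2) (initialLaw ρ₀)

/-- The parameters `φ₀, φ₁, λ, c₀` and the kernel `K`. -/
structure Model where
  φ₀ : ℝ
  φ₁ : ℝ
  lam : ℝ
  c₀ : ℝ
  K : ℝ → ℝ

/-- The advection coefficient
`b(x, y) = - φ₁ λ c₀ e^{-λ x} y / (φ₀ + φ₁ c₀ e^{-λ x})`. -/
def Model.b (𝔐 : Model) (x y : ℝ) : ℝ :=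
  -𝔐.φ₁ * 𝔐.lam * 𝔐.c₀ *
    (Real.exp (-𝔐.lam * x) * y / (𝔐.φ₀ + 𝔐.φ₁ * 𝔐.c₀ * Real.exp (-𝔐.lam * x)))

/-- Standing assumptions on the parameters and the kernel. -/
structure Model.Admissible (𝔐 : Model) : Prop where
  φ₀_pos : 0 < 𝔐.φ₀
  lam_pos : 0 < 𝔐.lam
  c₀_nonneg : 0 ≤ 𝔐.c₀
  nondegenerate : ∃ m M : ℝ, 0 < m ∧ 0 < M ∧ ∀ u : ℝ, 0 ≤ u →
    m ≤ 𝔐.φ₀ + 𝔐.φ₁ * 𝔐.c₀ * Real.exp (-𝔐.lam * u) ∧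
      𝔐.φ₀ + 𝔐.φ₁ * 𝔐.c₀ * Real.exp (-𝔐.lam * u) ≤ M
  mollifier : IsSmoothMollifier 𝔐.K

/-- The function `x ↦ (f * ν)(x) = ∫ f(x - y) ν(dy)`, extended by `0` at `Δ`. -/
def conv (f : ℝ → ℝ) (ν : Measure ℝ) : State → ℝ := extendZero (fun x => ∫ y, f (x - y) ∂ν)

/-- `∫₀ˢ (f * ν_r)(z) dr`. -/
def timeConv {T : ℝ} (f : ℝ → ℝ) (ν : TimeInterval T → Measure ℝ) (s : TimeInterval T)
    (z : State) : ℝ :=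
  ∫ r in Set.Iic s, conv f (ν r) z ∂timeMeasure T

/-- The drift `b(∫₀ˢ (K * ν_r)(z) dr, ∫₀ˢ (∇K * ν_r)(z) dr)`. -/
def Model.drift (𝔐 : Model) {T : ℝ} (ν : TimeInterval T → Measure ℝ) (s : TimeInterval T)
    (z : State) : ℝ :=
  𝔐.b (timeConv 𝔐.K ν s z) (timeConv (deriv 𝔐.K) ν s z)

/-- The killing rate `λ c₀ exp(-λ ∫₀ˢ (K * ν_r)(z) dr)`. -/
def Model.rate (𝔐 : Model) {T : ℝ} (ν : TimeInterval T → Measure ℝ) (s : TimeInterval T)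
    (z : State) : ℝ :=
  𝔐.lam * 𝔐.c₀ * Real.exp (-𝔐.lam * timeConv 𝔐.K ν s z)

section Probability

variable {T : ℝ} {Ω : Type*} {mΩ : MeasurableSpace Ω}

/-- The sub-probability law of the surviving process,
`ν_t(A) = P(X_t ∈ A, t < τ)` for Borel sets `A ⊆ ℝ`. -/
def survivingLaw (P : Measure Ω) (X : TimeInterval T → Ω → State)
    (τ : Ω → WithTop (TimeInterval T)) (t : TimeInterval T) : Measure ℝ :=
  ((P.restrict {ω | (t : WithTop (TimeInterval T)) < τ ω}).map (X t)).comap alive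

/-- `W` is a standard Brownian motion on `[0, T]` relative to the filtration `𝓕`. -/
structure IsBrownianMotion (P : Measure Ω) (𝓕 : Filtration (TimeInterval T) mΩ)
    (W : TimeInterval T → Ω → ℝ) : Prop where
  adapted : ∀ t, Measurable[𝓕 t] (W t)
  start : ∀ t : TimeInterval T, (t : ℝ) = 0 → ∀ᵐ ω ∂P, W t ω = 0
  increment_law : ∀ s t : TimeInterval T, s ≤ t →
    HasLaw (fun ω => W t ω - W s ω) (gaussianReal 0 (Real.toNNReal ((t : ℝ) - s))) P
  increment_indep : ∀ s t : TimeInterval T, s ≤ t →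
    Indep (MeasurableSpace.comap (fun ω => W t ω - W s ω) inferInstance) (𝓕 s) P
  continuous_paths : ∀ᵐ ω ∂P, Continuous (fun t => W t ω)

/-- The random inputs: an `𝓕`-Brownian motion `W`, an `𝓕₀`-measurable initial value `X₀` with law
`ρ₀(x) dx`, and an `Exp(1)` variable `Z` independent of `(X₀, W)`. -/
structure IsInput (ρ₀ : ℝ → ℝ) (P : Measure Ω) (𝓕 : Filtration (TimeInterval T) mΩ)
    (W : TimeInterval T → Ω → ℝ) (X₀ Z : Ω → ℝ) : Prop where
  brownian : IsBrownianMotion P 𝓕 W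
  initial_measurable : ∀ t : TimeInterval T, (t : ℝ) = 0 → Measurable[𝓕 t] X₀
  initial_law : HasLaw X₀ (initialLaw ρ₀) P
  clock_measurable : Measurable Z
  clock_law : HasLaw Z (expMeasure 1) P
  clock_indep : IndepFun Z (fun ω => (X₀ ω, fun t => W t ω)) P

/-- `(X, τ)` is a solution, on the filtered probability space `(Ω, 𝓕, P)` with inputs
`(W, X₀, Z)`, of the killed McKean–Vlasov equation on `[0, T]`. The killing time takes the value
`⊤` if killing does not occur in `[0, T]`. -/
structure IsSolution (𝔐 : Model) (ρ₀ : ℝ → ℝ) (P : Measure Ω)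
    (𝓕 : Filtration (TimeInterval T) mΩ) (W : TimeInterval T → Ω → ℝ) (X₀ Z : Ω → ℝ)
    (X : TimeInterval T → Ω → State) (τ : Ω → WithTop (TimeInterval T)) : Prop where
  input : IsInput ρ₀ P 𝓕 W X₀ Z
  adapted : ∀ t, Measurable[𝓕 t] (X t)
  stopping : IsStoppingTime 𝓕 τ
  /-- paths are continuous on `[0, τ)` -/
  continuous_paths : ∀ᵐ ω ∂P,
    ContinuousOn (fun t => X t ω) {t | (t : WithTop (TimeInterval T)) < τ ω}
  /-- the time integrals below exist -/
  integrable : ∀ᵐ ω ∂P,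
    Integrable (fun s => 𝔐.drift (survivingLaw P X τ) s (X s ω)) (timeMeasure T) ∧
      Integrable (fun s => 𝔐.rate (survivingLaw P X τ) s (X s ω)) (timeMeasure T)
  /-- before `τ` the process moves in `ℝ` according to the equation -/
  equation : ∀ᵐ ω ∂P, ∀ t : TimeInterval T, (t : WithTop (TimeInterval T)) < τ ω →
    X t ω = alive (X₀ ω
      + (∫ s in Set.Iic t, 𝔐.drift (survivingLaw P X τ) s (X s ω) ∂timeMeasure T)
      + √2 * W t ω)
  /-- from `τ` on the process sits in the cemetery -/
  killed : ∀ᵐ ω ∂P, ∀ t : TimeInterval T, τ ω ≤ (t : WithTop (TimeInterval T)) →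
    X t ω = cemetery
  /-- `τ = inf {t : ∫₀ᵗ rate ds ≥ Z}`, with `inf ∅ = ⊤` -/
  killing_time : ∀ᵐ ω ∂P, IsGLB
    ((fun t : TimeInterval T => (t : WithTop (TimeInterval T))) ''
      {t | Z ω ≤
        ∫ s in Set.Iic t, 𝔐.rate (survivingLaw P X τ) s (X s ω) ∂timeMeasure T}) (τ ω)

/-- The σ-algebra generated by `X₀`, `Z`, `(W_s)_{s ≤ t}` and the `P`-null events. -/
abbrev inputSigmaAlgebra (P : Measure Ω) (W : TimeInterval T → Ω → ℝ) (X₀ Z : Ω → ℝ)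
    (t : TimeInterval T) : MeasurableSpace Ω :=
  MeasurableSpace.comap X₀ inferInstance ⊔ MeasurableSpace.comap Z inferInstance ⊔
    (⨆ s ≤ t, MeasurableSpace.comap (W s) inferInstance) ⊔
    MeasurableSpace.generateFrom {N | MeasurableSet[mΩ] N ∧ P N = 0}

/-- A strong solution: a solution relative to the augmented filtration generated by the inputs. -/
def IsStrongSolution (𝔐 : Model) (ρ₀ : ℝ → ℝ) (P : Measure Ω) (W : TimeInterval T → Ω → ℝ)
    (X₀ Z : Ω → ℝ) (X : TimeInterval T → Ω → State) (τ : Ω → WithTop (TimeInterval T)) : Prop :=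
  ∃ 𝓖 : Filtration (TimeInterval T) mΩ, (∀ t, 𝓖 t = inputSigmaAlgebra P W X₀ Z t) ∧
    IsSolution 𝔐 ρ₀ P 𝓖 W X₀ Z X τ

/-- The law of a process on the path space with values in `ℝ ∪ {Δ}` (product σ-algebra, i.e. the
σ-algebra generated by the coordinates). -/
def pathLaw (P : Measure Ω) (X : TimeInterval T → Ω → State) : Measure (TimeInterval T → State) :=
  P.map (fun ω t => X t ω)

end Probability

end

end KilledMcKeanVlasov

universe u v

open KilledMcKeanVlasov

/-!
The exponential clock is independent of `(X₀, W)`, hence of the *driving path*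
`G = X₀ + √2 W`, a random continuous path. Before the killing time a solution is therefore
`X_t = G_t + a_t(G)`, where `a_t` is the accumulated drift, and it is alive at time `t` exactly if
the accumulated killing rate `c_t(G)` is smaller than the clock. Integrating out the clock, the
surviving law enters the equation only through `∫ e^{-c_r(g)} f(x - g_r - a_r(g)) μ(dg)`, where `μ`
is the law of `G` and `f` is `K` or `K'` (`conv_survivingLaw_eq_pathField`). The killed
McKean–Vlasov equation thus becomes a deterministic fixed point problem for the pair
`V = (a, c)`, a bounded continuous function on path space times `[0, T]`. Since `K` and `K'` are
bounded and Lipschitz, it is of Volterra type: its right-hand side is the time integral over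
`[0, t]` of a quantity controlled by a supremum of `V` up to the current time. It is a contraction
for an exponentially weighted supremum norm, so it has exactly one solution
(`existsUnique_volterra_fixedPoint`, `existsUnique_isMcKeanFlow`), and this solution depends on the
inputs only through `μ`.

Every solution is almost surely the image of its driving path and its clock under the map determined
by that `V` (`IsSolution.eq_flowState`), which gives pathwise uniqueness. Conversely this image is a
strong solution (`exists_isStrongSolution`): `V` is causal, and revealing the independent clock at
time zero does not destroy the Brownian property of `W`. The law of the driving path is the same
for all inputs (`IsDrivingPath.map_eq`), so all solutions share the same `V` and the same law. For
weak existence it remains to exhibit inputs; a Brownian motion is built as the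
Lévy–Ciesielski series of independent Gaussian variables against the Schauder functions
(`exists_isInput`).
-/

namespace KilledMcKeanVlasov

noncomputable section

open Filter Topology Set
open scoped BoundedContinuousFunction

variable {T : ℝ}

/-! ### Integration over `[0, t]` -/

instance instIsFiniteMeasureTimeMeasure : IsFiniteMeasure (timeMeasure T) := by
  constructor
  rw [timeMeasure, Measure.comap_apply _ Subtype.val_injective
    (fun s hs => (MeasurableEmbedding.subtype_coe measurableSet_Icc).measurableSet_image.2 hs) _
    MeasurableSet.univ, image_univ, Subtype.range_coe]
  exact measure_Icc_lt_top

instance instNullSingletonClassTimeMeasure : NullSingletonClass (timeMeasure T) := by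
  constructor
  intro x
  rw [timeMeasure, Measure.comap_apply _ Subtype.val_injective
    (fun s hs => (MeasurableEmbedding.subtype_coe measurableSet_Icc).measurableSet_image.2 hs) _
    (measurableSet_singleton x)]
  simp

lemma integral_Iic_timeMeasure (φ : ℝ → ℝ) (t : TimeInterval T) :
    ∫ r in Iic t, φ r ∂timeMeasure T = ∫ x in (0 : ℝ)..t, φ x := by
  have he := MeasurableEmbedding.subtype_coe (measurableSet_Icc (a := (0 : ℝ)) (b := T))
  have h1 := he.setIntegral_map (μ := timeMeasure T) φ (Iic (t : ℝ))
  have h2 : Subtype.val ⁻¹' Iic (t : ℝ) = (Iic t : Set (TimeInterval T)) := rfl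
  rw [h2] at h1
  rw [← h1, timeMeasure, he.map_comap, Subtype.range_coe,
    Measure.restrict_restrict measurableSet_Iic, intervalIntegral.integral_of_le t.2.1, ← integral_Icc_eq_integral_Ioc]
  congr 2
  ext x
  simp only [mem_inter_iff, mem_Iic, mem_Icc]
  have := t.2.2
  constructor
  · rintro ⟨h, h', -⟩; exact ⟨h', h⟩
  · rintro ⟨h, h'⟩; exact ⟨h', h, h'.trans this⟩

lemma timeMeasure_real_Iic (t : TimeInterval T) : (timeMeasure T).real (Iic t) = t := by
  have := integral_Iic_timeMeasure (fun _ => (1 : ℝ)) t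
  simpa using this

lemma integral_exp_Iic_le {θ : ℝ} (hθ : 0 < θ) (t : TimeInterval T) :
    ∫ r in Iic t, Real.exp (θ * r) ∂timeMeasure T ≤ Real.exp (θ * t) / θ := by
  rw [integral_Iic_timeMeasure (fun x => Real.exp (θ * x)) t,
    intervalIntegral.integral_comp_mul_left _ hθ.ne', integral_exp]
  simp only [mul_zero, Real.exp_zero, smul_eq_mul]
  rw [div_eq_inv_mul]
  exact mul_le_mul_of_nonneg_left (by linarith) (by positivity)

lemma integrable_of_continuous {E : Type*} [NormedAddCommGroup E] {f : TimeInterval T → E}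
    (hf : Continuous f) : Integrable f (timeMeasure T) :=
  hf.integrable_of_hasCompactSupport (HasCompactSupport.of_compactSpace f)

/-- Integrating over `[0, t]` gains a factor `1 / θ` on the scale of weights `exp (θ t)`. This is
what turns Volterra operators into contractions. -/
lemma norm_integral_Iic_le_exp {E : Type*} [NormedAddCommGroup E] [NormedSpace ℝ E]
    {θ D : ℝ} (hθ : 0 < θ) (hD : 0 ≤ D) {h : TimeInterval T → E} (t : TimeInterval T)
    (hh : ∀ r ≤ t, ‖h r‖ ≤ D * Real.exp (θ * r)) :
    ‖∫ r in Iic t, h r ∂timeMeasure T‖ ≤ D * Real.exp (θ * t) / θ := by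
  have hint : Integrable (fun r : TimeInterval T => D * Real.exp (θ * r)) (timeMeasure T) :=
    integrable_of_continuous (by fun_prop)
  calc ‖∫ r in Iic t, h r ∂timeMeasure T‖
      ≤ ∫ r in Iic t, D * Real.exp (θ * r) ∂timeMeasure T := by
        refine norm_integral_le_of_norm_le hint.restrict ?_
        filter_upwards [ae_restrict_mem measurableSet_Iic] with r hr using hh r hr
    _ = D * ∫ r in Iic t, Real.exp (θ * r) ∂timeMeasure T := integral_const_mul _ _
    _ ≤ D * (Real.exp (θ * t) / θ) := mul_le_mul_of_nonneg_left (integral_exp_Iic_le hθ t) hD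
    _ = _ := by ring

lemma norm_integral_Iic_le {E : Type*} [NormedAddCommGroup E] [NormedSpace ℝ E]
    {D : ℝ} (hD : 0 ≤ D) {h : TimeInterval T → E} (t : TimeInterval T)
    (hh : ∀ r, ‖h r‖ ≤ D) : ‖∫ r in Iic t, h r ∂timeMeasure T‖ ≤ D * T := by
  calc ‖∫ r in Iic t, h r ∂timeMeasure T‖ ≤ D * (timeMeasure T).real (Iic t) :=
        norm_setIntegral_le_of_norm_le_const (measure_lt_top _ _) (fun r _ => hh r)
    _ ≤ D * T := by rw [timeMeasure_real_Iic]; exact mul_le_mul_of_nonneg_left t.2.2 hD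

/-- Gronwall's lemma, in the form that yields uniqueness for Volterra equations up to a time. -/
lemma eqOn_zero_of_le_integral {d : TimeInterval T → ℝ} {t₀ : TimeInterval T} {L : ℝ} (hL : 0 ≤ L)
    (hc : ContinuousOn d (Iic t₀))
    (hd : ∀ t ≤ t₀, |d t| ≤ L * ∫ r in Iic t, |d r| ∂timeMeasure T) :
    ∀ t ≤ t₀, d t = 0 := by
  set θ : ℝ := 2 * (L + 1) with hθ
  have hθ0 : 0 < θ := by positivity
  have hK : IsCompact (Iic t₀) := isClosed_Iic.isCompact
  have hcont : ContinuousOn (fun s : TimeInterval T => Real.exp (-θ * s) * |d s|) (Iic t₀) := by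
    refine ContinuousOn.mul (by fun_prop) hc.abs
  obtain ⟨s, hs, hmax⟩ := hK.exists_isMaxOn ⟨t₀, mem_Iic.2 le_rfl⟩ hcont
  set m := Real.exp (-θ * s) * |d s| with hm
  have hm0 : 0 ≤ m := by positivity
  have hbound : ∀ r ≤ t₀, |d r| ≤ m * Real.exp (θ * r) := by
    intro r hr
    have h1 : Real.exp (-θ * r) * |d r| ≤ m := hmax hr
    calc |d r| = (Real.exp (-θ * r) * |d r|) * Real.exp (θ * r) := by
          rw [mul_comm (Real.exp _) |d r|, mul_assoc, ← Real.exp_add]; simp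
      _ ≤ m * Real.exp (θ * r) := mul_le_mul_of_nonneg_right h1 (Real.exp_pos _).le
  have h2 : |d s| ≤ L * (m * Real.exp (θ * s) / θ) := by
    refine (hd s hs).trans (mul_le_mul_of_nonneg_left ?_ hL)
    refine (le_abs_self _).trans ?_
    refine norm_integral_Iic_le_exp (h := fun r => |d r|) hθ0 hm0 s fun r hr => ?_
    rw [Real.norm_eq_abs, abs_abs]
    exact hbound r (hr.trans hs)
  have h3 : m ≤ L * m / θ := by
    calc m ≤ Real.exp (-θ * s) * (L * (m * Real.exp (θ * s) / θ)) :=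
          mul_le_mul_of_nonneg_left h2 (Real.exp_pos _).le
      _ = L * m / θ * (Real.exp (-θ * s) * Real.exp (θ * s)) := by ring
      _ = L * m / θ := by rw [← Real.exp_add]; simp
  have h4 : m = 0 := by
    rw [le_div_iff₀ hθ0] at h3
    nlinarith
  intro t ht
  have := hbound t ht
  rw [h4, zero_mul] at this
  exact abs_nonpos_iff.1 this

lemma continuous_integral_Iic {S E : Type*} [TopologicalSpace S] [FirstCountableTopology S]
    [NormedAddCommGroup E] [NormedSpace ℝ E] {h : S → TimeInterval T → E}
    (hm : ∀ s, AEStronglyMeasurable (h s) (timeMeasure T)) (hh : ∀ r, Continuous fun s => h s r)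
    {M : ℝ} (hM : ∀ s r, ‖h s r‖ ≤ M) :
    Continuous fun z : S × TimeInterval T => ∫ r in Iic z.2, h z.1 r ∂timeMeasure T := by
  simp_rw [← integral_indicator measurableSet_Iic]
  rw [continuous_iff_continuousAt]
  intro z
  refine continuousAt_of_dominated (bound := fun _ => M) ?_ ?_ (integrable_const M) ?_
  · exact Eventually.of_forall fun y =>
      (hm y.1).indicator measurableSet_Iic
  · refine Eventually.of_forall fun y => Eventually.of_forall fun r => ?_
    exact (norm_indicator_le_norm_self _ _).trans (hM _ _)
  · have hne : ∀ᵐ r ∂timeMeasure T, r ≠ z.2 := by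
      rw [ae_iff]; simp
    filter_upwards [hne] with r hr
    rcases lt_or_gt_of_ne hr with hlt | hgt
    · have hev : ∀ᶠ y : S × TimeInterval T in 𝓝 z, r < y.2 :=
        continuous_snd.continuousAt.eventually (lt_mem_nhds hlt)
      have hc : ContinuousAt (fun y : S × TimeInterval T => h y.1 r) z :=
        ((hh r).comp continuous_fst).continuousAt
      refine hc.congr ?_
      filter_upwards [hev] with y hy
      rw [indicator_of_mem (show r ∈ Iic y.2 from hy.le)]
    · have hev : ∀ᶠ y : S × TimeInterval T in 𝓝 z, y.2 < r :=
        continuous_snd.continuousAt.eventually (gt_mem_nhds hgt)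
      refine (continuousAt_const (y := (0 : E))).congr ?_
      filter_upwards [hev] with y hy
      rw [indicator_of_notMem (show r ∉ Iic y.2 from not_le.2 hy)]

/-! ### Volterra fixed points -/

/-- The map multiplying a bounded continuous function by the weight `exp (θ t)`. -/
def expWeight (S : Type*) [TopologicalSpace S] (T θ : ℝ) : (S × TimeInterval T) →ᵇ ℝ :=
  BoundedContinuousFunction.ofNormedAddCommGroup (fun z => Real.exp (θ * (z.2 : ℝ))) (by fun_prop)
    (Real.exp (|θ| * |T|)) (by
      intro z
      rw [Real.norm_eq_abs, Real.abs_exp]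
      refine Real.exp_le_exp.2 ((le_abs_self _).trans ?_)
      rw [abs_mul]
      refine mul_le_mul_of_nonneg_left ?_ (abs_nonneg _)
      rw [abs_of_nonneg z.2.2.1]
      exact z.2.2.2.trans (le_abs_self T))

/-- A map of bounded continuous functions of Volterra type has exactly one fixed point: in the
weighted sup norm with weight `exp (-θ t)` it is a contraction once `θ` is large. -/
theorem existsUnique_volterra_fixedPoint {S E : Type*} [TopologicalSpace S] [NormedAddCommGroup E]
    [NormedSpace ℝ E] [CompleteSpace E]
    (Φ : ((S × TimeInterval T) →ᵇ E) → ((S × TimeInterval T) →ᵇ E)) {κ : ℝ} (hκ : 0 ≤ κ)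
    (hΦ : ∀ V V' : (S × TimeInterval T) →ᵇ E, ∀ θ D : ℝ, 1 ≤ θ → 0 ≤ D →
      (∀ z, ‖V z - V' z‖ ≤ D * Real.exp (θ * (z.2 : ℝ))) →
      ∀ z, ‖Φ V z - Φ V' z‖ ≤ κ * D * Real.exp (θ * (z.2 : ℝ)) / θ) :
    ∃! V, Φ V = V := by
  set θ : ℝ := 2 * κ + 1 with hθ
  have hθ1 : 1 ≤ θ := by linarith
  have hθ0 : 0 < θ := by linarith
  set e := expWeight S T θ
  set e' := expWeight S T (-θ)
  have hee : ∀ V : (S × TimeInterval T) →ᵇ E, e • (e' • V) = V := by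
    intro V; ext z
    change Real.exp (θ * (z.2 : ℝ)) • Real.exp (-θ * (z.2 : ℝ)) • V z = V z
    rw [smul_smul, ← Real.exp_add]; simp
  have hee' : ∀ V : (S × TimeInterval T) →ᵇ E, e' • (e • V) = V := by
    intro V; ext z
    change Real.exp (-θ * (z.2 : ℝ)) • Real.exp (θ * (z.2 : ℝ)) • V z = V z
    rw [smul_smul, ← Real.exp_add]; simp
  let Ψ : ((S × TimeInterval T) →ᵇ E) → ((S × TimeInterval T) →ᵇ E) := fun V => e' • Φ (e • V)
  have hΨ : ContractingWith (1 / 2) Ψ := by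
    refine ⟨by norm_num, LipschitzWith.of_dist_le_mul fun V V' => ?_⟩
    rw [BoundedContinuousFunction.dist_le (by positivity)]
    intro z
    have key := hΦ (e • V) (e • V') θ (dist V V') hθ1 dist_nonneg (fun y => by
      change ‖Real.exp (θ * (y.2 : ℝ)) • V y - Real.exp (θ * (y.2 : ℝ)) • V' y‖ ≤ _
      rw [← smul_sub, norm_smul, Real.norm_eq_abs, Real.abs_exp, mul_comm, ← dist_eq_norm]
      exact mul_le_mul_of_nonneg_right (BoundedContinuousFunction.dist_coe_le_dist y)
        (Real.exp_pos _).le) z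
    change dist (Real.exp (-θ * (z.2 : ℝ)) • Φ (e • V) z) (Real.exp (-θ * (z.2 : ℝ)) • Φ (e • V') z)
      ≤ _
    rw [dist_eq_norm, ← smul_sub, norm_smul, Real.norm_eq_abs, Real.abs_exp]
    calc Real.exp (-θ * (z.2 : ℝ)) * ‖Φ (e • V) z - Φ (e • V') z‖
        ≤ Real.exp (-θ * (z.2 : ℝ)) * (κ * dist V V' * Real.exp (θ * (z.2 : ℝ)) / θ) :=
          mul_le_mul_of_nonneg_left key (Real.exp_pos _).le
      _ = κ / θ * dist V V' * (Real.exp (-θ * (z.2 : ℝ)) * Real.exp (θ * (z.2 : ℝ))) := by ring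
      _ = κ / θ * dist V V' := by rw [← Real.exp_add]; simp
      _ ≤ ((1 / 2 : NNReal) : ℝ) * dist V V' := by
          refine mul_le_mul_of_nonneg_right ?_ dist_nonneg
          rw [div_le_iff₀ hθ0]
          simp only [NNReal.coe_div, NNReal.coe_one, NNReal.coe_ofNat]
          linarith
  refine ⟨e • ContractingWith.fixedPoint Ψ hΨ, ?_, ?_⟩
  · have h : e' • Φ (e • ContractingWith.fixedPoint Ψ hΨ) = ContractingWith.fixedPoint Ψ hΨ :=
      hΨ.fixedPoint_isFixedPt
    change Φ (e • ContractingWith.fixedPoint Ψ hΨ) = e • ContractingWith.fixedPoint Ψ hΨ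
    conv_rhs => rw [← h]
    rw [hee]
  · intro V hV
    have h : Function.IsFixedPt Ψ (e' • V) := by
      change e' • Φ (e • (e' • V)) = e' • V
      rw [hee]; congr 1
    rw [← hΨ.fixedPoint_unique h, hee]

/-- `existsUnique_volterra_fixedPoint` for an operator given by a pointwise formula. -/
theorem existsUnique_volterra_solution {S E : Type*} [TopologicalSpace S] [NormedAddCommGroup E]
    [NormedSpace ℝ E] [CompleteSpace E]
    (φ : ((S × TimeInterval T) →ᵇ E) → S × TimeInterval T → E) {κ M : ℝ} (hκ : 0 ≤ κ)
    (hc : ∀ V, Continuous (φ V)) (hM : ∀ V z, ‖φ V z‖ ≤ M)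
    (hφ : ∀ V V' : (S × TimeInterval T) →ᵇ E, ∀ θ D : ℝ, 1 ≤ θ → 0 ≤ D →
      (∀ z, ‖V z - V' z‖ ≤ D * Real.exp (θ * (z.2 : ℝ))) →
      ∀ z, ‖φ V z - φ V' z‖ ≤ κ * D * Real.exp (θ * (z.2 : ℝ)) / θ) :
    ∃! V : (S × TimeInterval T) →ᵇ E, ∀ z, V z = φ V z := by
  obtain ⟨V, hV, hu⟩ := existsUnique_volterra_fixedPoint
    (fun V => BoundedContinuousFunction.ofNormedAddCommGroup (φ V) (hc V) M (hM V)) hκ hφ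
  refine ⟨V, fun z => ?_, fun V' hV' => hu V' ?_⟩
  · exact (DFunLike.congr_fun hV z).symm
  · ext1 z
    exact (hV' z).symm

/-! ### The coefficients along a field -/

lemma abs_exp_neg_sub_exp_neg_le {a b : ℝ} (ha : 0 ≤ a) (hb : 0 ≤ b) :
    |Real.exp (-a) - Real.exp (-b)| ≤ |a - b| := by
  wlog hab : a ≤ b generalizing a b
  · rw [abs_sub_comm, abs_sub_comm a]
    exact this hb ha (le_of_not_ge hab)
  have h1 : Real.exp (-b) ≤ Real.exp (-a) := Real.exp_le_exp.2 (by linarith)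
  rw [abs_of_nonneg (by linarith), abs_of_nonpos (by linarith)]
  have h2 : Real.exp (-b) = Real.exp (-a) * Real.exp (-(b - a)) := by
    rw [← Real.exp_add]; ring_nf
  have h3 : -(b - a) + 1 ≤ Real.exp (-(b - a)) := Real.add_one_le_exp _
  have h4 : Real.exp (-a) ≤ 1 := Real.exp_le_one_iff.2 (by linarith)
  have h5 := Real.exp_pos (-a)
  rw [h2]
  nlinarith

lemma Model.Admissible.exists_b_bound {𝔐 : Model} (h𝔐 : 𝔐.Admissible) {N : ℝ} (hN : 0 ≤ N) :
    ∃ C, 0 ≤ C ∧ (∀ x y, 0 ≤ x → |y| ≤ N → |𝔐.b x y| ≤ C) ∧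
      ∀ x x' y y', 0 ≤ x → 0 ≤ x' → |y| ≤ N → |y'| ≤ N →
        |𝔐.b x y - 𝔐.b x' y'| ≤ C * (|x - x'| + |y - y'|) := by
  obtain ⟨m, M, hm, -, hmM⟩ := h𝔐.nondegenerate
  have hφ := h𝔐.φ₀_pos
  have hl := h𝔐.lam_pos
  set c := |-𝔐.φ₁ * 𝔐.lam * 𝔐.c₀| with hc
  have hc0 : 0 ≤ c := abs_nonneg _
  set e : ℝ → ℝ := fun x => Real.exp (-𝔐.lam * x) with he
  set D : ℝ → ℝ := fun x => 𝔐.φ₀ + 𝔐.φ₁ * 𝔐.c₀ * e x with hD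
  have hb : ∀ x y, 𝔐.b x y = -𝔐.φ₁ * 𝔐.lam * 𝔐.c₀ * (e x / D x * y) := by
    intro x y; simp only [Model.b, he, hD]; ring
  have hDm : ∀ x, 0 ≤ x → m ≤ D x := fun x hx => (hmM x hx).1
  have he1 : ∀ x, 0 ≤ x → e x ≤ 1 := fun x hx => Real.exp_le_one_iff.2 (by nlinarith)
  have he0 : ∀ x, 0 < e x := fun x => Real.exp_pos _
  have hq : ∀ x, 0 ≤ x → |e x / D x| ≤ 1 / m := by
    intro x hx
    rw [abs_of_nonneg (div_nonneg (he0 x).le (hm.le.trans (hDm x hx)))]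
    exact div_le_div₀ zero_le_one (he1 x hx) hm (hDm x hx)
  have hql : ∀ x x', 0 ≤ x → 0 ≤ x' →
      |e x / D x - e x' / D x'| ≤ 𝔐.φ₀ * 𝔐.lam / m ^ 2 * |x - x'| := by
    intro x x' hx hx'
    have h1 : 0 < D x := hm.trans_le (hDm x hx)
    have h2 : 0 < D x' := hm.trans_le (hDm x' hx')
    have h3 : e x / D x - e x' / D x' = 𝔐.φ₀ * (e x - e x') / (D x * D x') := by
      rw [div_sub_div _ _ h1.ne' h2.ne']; simp only [hD]; ring
    have h4 : |e x - e x'| ≤ 𝔐.lam * |x - x'| := by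
      have := abs_exp_neg_sub_exp_neg_le (mul_nonneg hl.le hx) (mul_nonneg hl.le hx')
      rw [← mul_sub, abs_mul, abs_of_pos hl] at this
      simpa only [he, neg_mul] using this
    rw [h3, abs_div, abs_mul, abs_of_pos hφ, abs_of_pos (mul_pos h1 h2)]
    calc 𝔐.φ₀ * |e x - e x'| / (D x * D x') ≤ 𝔐.φ₀ * (𝔐.lam * |x - x'|) / m ^ 2 := by
          refine div_le_div₀ (by positivity) (by gcongr) (by positivity) ?_
          rw [sq]; exact mul_le_mul (hDm x hx) (hDm x' hx') hm.le h1.le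
      _ = _ := by ring
  refine ⟨c * (1 / m + N * (𝔐.φ₀ * 𝔐.lam / m ^ 2) + N / m), by positivity, ?_, ?_⟩
  · intro x y hx hy
    rw [hb, abs_mul, ← hc, abs_mul]
    refine mul_le_mul_of_nonneg_left ?_ hc0
    have h1 : |e x / D x| * |y| ≤ 1 / m * N :=
      mul_le_mul (hq x hx) hy (abs_nonneg _) (by positivity)
    have h2 : 0 ≤ N * (𝔐.φ₀ * 𝔐.lam / m ^ 2) := by positivity
    have h3 : 0 < 1 / m := by positivity
    have h4 : 1 / m * N = N / m := by ring
    linarith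
  · intro x x' y y' hx hx' hy hy'
    rw [hb, hb, ← mul_sub, abs_mul, ← hc, mul_assoc c]
    refine mul_le_mul_of_nonneg_left ?_ hc0
    have h1 : e x / D x * y - e x' / D x' * y'
        = e x / D x * (y - y') + (e x / D x - e x' / D x') * y' := by ring
    have h2 : |e x / D x * (y - y')| ≤ 1 / m * |y - y'| := by
      rw [abs_mul]; exact mul_le_mul_of_nonneg_right (hq x hx) (abs_nonneg _)
    have h3 : |(e x / D x - e x' / D x') * y'| ≤ 𝔐.φ₀ * 𝔐.lam / m ^ 2 * |x - x'| * N := by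
      rw [abs_mul]; exact mul_le_mul (hql x x' hx hx') hy' (abs_nonneg _) (by positivity)
    rw [h1]
    refine (abs_add_le _ _).trans ((add_le_add h2 h3).trans ?_)
    have p1 : 0 ≤ 1 / m * |x - x'| := by positivity
    have p2 : 0 ≤ N * (𝔐.φ₀ * 𝔐.lam / m ^ 2) * |y - y'| := by positivity
    have p3 : 0 ≤ N / m * (|x - x'| + |y - y'|) := by positivity
    nlinarith

/-- A time-dependent function on `ℝ`, bounded by `M`, `L`-Lipschitz in space and measurable in
time. The convolutions `K * ν_r` and `K' * ν_r` are of this kind. -/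
structure IsField (p : TimeInterval T → ℝ → ℝ) (M L : ℝ) : Prop where
  measurable : ∀ x, Measurable fun r => p r x
  bound : ∀ r x, |p r x| ≤ M
  lipschitz : ∀ r x x', |p r x - p r x'| ≤ L * |x - x'|

/-- `∫₀ˢ p_r(x) dr`. -/
def timeIntegral (p : TimeInterval T → ℝ → ℝ) (s : TimeInterval T) (x : ℝ) : ℝ :=
  ∫ r in Iic s, p r x ∂timeMeasure T

section Field

variable {p p' q q' : TimeInterval T → ℝ → ℝ} {M L : ℝ}

lemma IsField.bound_nonneg (hp : IsField p M L) (s : TimeInterval T) : 0 ≤ M :=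
  (abs_nonneg _).trans (hp.bound s 0)

lemma IsField.integrable (hp : IsField p M L) (x : ℝ) :
    Integrable (fun r => p r x) (timeMeasure T) :=
  Integrable.of_bound (hp.measurable x).aestronglyMeasurable M
    (Eventually.of_forall fun r => hp.bound r x)

lemma IsField.abs_timeIntegral_le (hp : IsField p M L) (s : TimeInterval T) (x : ℝ) :
    |timeIntegral p s x| ≤ M * T :=
  norm_integral_Iic_le (h := fun r => p r x) (hp.bound_nonneg s) s fun r => hp.bound r x

lemma IsField.timeIntegral_lipschitz (hp : IsField p M L) (s : TimeInterval T) (x x' : ℝ) :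
    |timeIntegral p s x - timeIntegral p s x'| ≤ L * T * |x - x'| := by
  rw [timeIntegral, timeIntegral, ← integral_sub (hp.integrable x).restrict
    (hp.integrable x').restrict, mul_right_comm]
  exact norm_integral_Iic_le (h := fun r => p r x - p r x')
    ((abs_nonneg _).trans (hp.lipschitz s x x')) s fun r => hp.lipschitz r x x'

lemma timeIntegral_nonneg (hp : ∀ r x, 0 ≤ p r x) (s : TimeInterval T) (x : ℝ) :
    0 ≤ timeIntegral p s x :=
  integral_nonneg fun r => hp r x

lemma IsField.continuous_timeIntegral (hp : IsField p M L) :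
    Continuous fun z : TimeInterval T × ℝ => timeIntegral p z.1 z.2 := by
  have h := continuous_integral_Iic (T := T) (h := fun x r => p r x)
    (fun x => (hp.measurable x).aestronglyMeasurable)
    (fun r => by
      have : LipschitzWith (Real.toNNReal L) (p r) := LipschitzWith.of_dist_le_mul fun x x' => by
        rw [Real.dist_eq, Real.dist_eq]
        exact (hp.lipschitz r x x').trans
          (mul_le_mul_of_nonneg_right (Real.le_coe_toNNReal L) (abs_nonneg _))
      exact this.continuous)
    (fun x r => hp.bound r x)
  exact h.comp (continuous_snd.prodMk continuous_fst)

lemma IsField.abs_timeIntegral_sub_le {M' L' : ℝ} (hp : IsField p M L) (hp' : IsField p' M' L')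
    {θ D : ℝ}
    (hθ : 0 < θ) (hD : 0 ≤ D) (h : ∀ r x, |p r x - p' r x| ≤ D * Real.exp (θ * r))
    (s : TimeInterval T) (x : ℝ) :
    |timeIntegral p s x - timeIntegral p' s x| ≤ D * Real.exp (θ * s) / θ := by
  rw [timeIntegral, timeIntegral, ← integral_sub (hp.integrable x).restrict
    (hp'.integrable x).restrict]
  exact norm_integral_Iic_le_exp (h := fun r => p r x - p' r x) hθ hD s fun r _ => h r x

/-- The drift and the killing rate at time `s` and position `x`, for the fields `p` (in place of
`K * ν_r`) and `q` (in place of `K' * ν_r`). -/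
def coef (𝔐 : Model) (p q : TimeInterval T → ℝ → ℝ) (s : TimeInterval T) (x : ℝ) : ℝ × ℝ :=
  (𝔐.b (timeIntegral p s x) (timeIntegral q s x),
    𝔐.lam * 𝔐.c₀ * Real.exp (-𝔐.lam * timeIntegral p s x))

lemma coef_snd_nonneg {𝔐 : Model} (h𝔐 : 𝔐.Admissible) (s : TimeInterval T) (x : ℝ) :
    0 ≤ (coef 𝔐 p q s x).2 :=
  mul_nonneg (mul_nonneg h𝔐.lam_pos.le h𝔐.c₀_nonneg) (Real.exp_pos _).le

lemma Model.Admissible.exists_coef_bound {𝔐 : Model} (h𝔐 : 𝔐.Admissible) (hT : 0 ≤ T) {M : ℝ}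
    (hM : 0 ≤ M) (L : ℝ) :
    ∃ C, 0 ≤ C ∧ ∀ p q : TimeInterval T → ℝ → ℝ, IsField p M L → IsField q M L →
      (∀ r x, 0 ≤ p r x) →
      (∀ s x, ‖coef 𝔐 p q s x‖ ≤ C) ∧
      ∀ p' q' : TimeInterval T → ℝ → ℝ, IsField p' M L → IsField q' M L → (∀ r x, 0 ≤ p' r x) →
        ∀ s x x', ‖coef 𝔐 p q s x - coef 𝔐 p' q' s x'‖ ≤
          C * (|timeIntegral p s x - timeIntegral p' s x'|
            + |timeIntegral q s x - timeIntegral q' s x'|) := by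
  obtain ⟨C, hC, hb, hbl⟩ := h𝔐.exists_b_bound (mul_nonneg hM hT)
  have hl := h𝔐.lam_pos
  have hc := h𝔐.c₀_nonneg
  refine ⟨C + 𝔐.lam * 𝔐.c₀ + 𝔐.lam * 𝔐.c₀ * 𝔐.lam, by positivity, ?_⟩
  intro p q hp hq hp0
  have hlc : 0 ≤ 𝔐.lam * 𝔐.c₀ := by positivity
  have hlcl : 0 ≤ 𝔐.lam * 𝔐.c₀ * 𝔐.lam := by positivity
  constructor
  · intro s x
    have hu := timeIntegral_nonneg hp0 s x
    rw [Prod.norm_def]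
    refine max_le ?_ ?_
    · have := hb _ _ hu (hq.abs_timeIntegral_le s x)
      rw [Real.norm_eq_abs]
      exact this.trans (by linarith)
    · rw [Real.norm_eq_abs, abs_of_nonneg (coef_snd_nonneg h𝔐 s x)]
      have h1 : Real.exp (-𝔐.lam * timeIntegral p s x) ≤ 1 :=
        Real.exp_le_one_iff.2 (by nlinarith)
      have := mul_le_mul_of_nonneg_left h1 hlc
      simp only [coef]
      linarith
  · intro p' q' hp' hq' hp0' s x x'
    have hu := timeIntegral_nonneg hp0 s x
    have hu' := timeIntegral_nonneg hp0' s x'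
    have h0 : 0 ≤ |timeIntegral p s x - timeIntegral p' s x'| := abs_nonneg _
    have h0' : 0 ≤ |timeIntegral q s x - timeIntegral q' s x'| := abs_nonneg _
    rw [Prod.norm_def]
    refine max_le ?_ ?_
    · rw [Prod.fst_sub, Real.norm_eq_abs]
      refine (hbl _ _ _ _ hu hu' (hq.abs_timeIntegral_le s x)
        (hq'.abs_timeIntegral_le s x')).trans ?_
      refine mul_le_mul_of_nonneg_right (by linarith) (by linarith)
    · rw [Prod.snd_sub, Real.norm_eq_abs]
      simp only [coef]
      rw [← mul_sub, abs_mul, abs_of_nonneg hlc]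
      have := abs_exp_neg_sub_exp_neg_le (mul_nonneg hl.le hu) (mul_nonneg hl.le hu')
      rw [← mul_sub, abs_mul, abs_of_pos hl] at this
      simp only [neg_mul]
      calc 𝔐.lam * 𝔐.c₀ * _
          ≤ 𝔐.lam * 𝔐.c₀ * (𝔐.lam * |timeIntegral p s x - timeIntegral p' s x'|) :=
            mul_le_mul_of_nonneg_left this hlc
        _ = 𝔐.lam * 𝔐.c₀ * 𝔐.lam * |timeIntegral p s x - timeIntegral p' s x'| := by ring
        _ ≤ _ := mul_le_mul (by linarith) (by linarith) h0 (by positivity)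

lemma continuous_coef {𝔐 : Model} (h𝔐 : 𝔐.Admissible) (hp : IsField p M L) (hq : IsField q M L)
    (hp0 : ∀ r x, 0 ≤ p r x) :
    Continuous fun z : TimeInterval T × ℝ => coef 𝔐 p q z.1 z.2 := by
  have h1 := hp.continuous_timeIntegral
  have h2 := hq.continuous_timeIntegral
  refine Continuous.prodMk ?_ (by fun_prop)
  simp only [Model.b]
  refine continuous_const.mul (Continuous.div (by fun_prop) (by fun_prop) fun z => ?_)
  obtain ⟨m, M, hm, -, hmM⟩ := h𝔐.nondegenerate
  exact (hm.trans_le (hmM _ (timeIntegral_nonneg hp0 z.1 z.2)).1).ne'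

end Field

/-! ### The flow of a random ordinary differential equation -/

/-- Continuous real paths on `[0, T]`. -/
abbrev Path (T : ℝ) : Type := C(TimeInterval T, ℝ)

instance instMeasurableSpacePath : MeasurableSpace (Path T) := borel _

instance instBorelSpacePath : BorelSpace (Path T) := ⟨rfl⟩

/-- `V` solves `V(g, t) = ∫₀ᵗ k(s, g(s) + V₁(g, s)) ds`: the path `t ↦ g(t) + V₁(g, t)` solves the
ordinary differential equation with velocity `k₁` and additive noise `g`, and `V₂` integrates `k₂`
along it. -/
def IsFlow (k : TimeInterval T → ℝ → ℝ × ℝ) (V : (Path T × TimeInterval T) →ᵇ ℝ × ℝ) : Prop :=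
  ∀ z, V z = ∫ s in Iic z.2, k s (z.1 s + (V (z.1, s)).1) ∂timeMeasure T

lemma continuous_flow_integrand {k : TimeInterval T → ℝ → ℝ × ℝ}
    (hk : Continuous fun z : TimeInterval T × ℝ => k z.1 z.2)
    (V : (Path T × TimeInterval T) →ᵇ ℝ × ℝ) :
    Continuous fun z : Path T × TimeInterval T => k z.2 (z.1 z.2 + (V z).1) := by
  have h : Continuous fun z : Path T × TimeInterval T => (z.2, z.1 z.2 + (V z).1) := by
    fun_prop
  exact hk.comp h

lemma continuous_flow_integral {k : TimeInterval T → ℝ → ℝ × ℝ}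
    (hk : Continuous fun z : TimeInterval T × ℝ => k z.1 z.2) {B : ℝ} (hB : ∀ s x, ‖k s x‖ ≤ B)
    (V : (Path T × TimeInterval T) →ᵇ ℝ × ℝ) :
    Continuous fun z : Path T × TimeInterval T =>
      ∫ s in Iic z.2, k s (z.1 s + (V (z.1, s)).1) ∂timeMeasure T := by
  have hc := continuous_flow_integrand hk V
  refine continuous_integral_Iic (h := fun g s => k s (g s + (V (g, s)).1))
    (fun g => ?_) (fun r => ?_) (M := B) (fun g s => hB _ _)
  · have : Continuous fun s : TimeInterval T => (g, s) := by fun_prop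
    exact (hc.comp this).aestronglyMeasurable
  · have : Continuous fun g : Path T => (g, r) := by fun_prop
    exact hc.comp this

lemma integrable_flow_integrand {k : TimeInterval T → ℝ → ℝ × ℝ}
    (hk : Continuous fun z : TimeInterval T × ℝ => k z.1 z.2)
    (V : (Path T × TimeInterval T) →ᵇ ℝ × ℝ) (g : Path T) :
    Integrable (fun s => k s (g s + (V (g, s)).1)) (timeMeasure T) := by
  have : Continuous fun s : TimeInterval T => (g, s) := by fun_prop
  exact integrable_of_continuous ((continuous_flow_integrand hk V).comp this)

theorem existsUnique_isFlow (hT : 0 ≤ T) {k : TimeInterval T → ℝ → ℝ × ℝ}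
    (hk : Continuous fun z : TimeInterval T × ℝ => k z.1 z.2) {B : ℝ} (hB : ∀ s x, ‖k s x‖ ≤ B)
    {Λ : ℝ} (hΛ : 0 ≤ Λ) (hl : ∀ s x x', ‖k s x - k s x'‖ ≤ Λ * |x - x'|) :
    ∃! V : (Path T × TimeInterval T) →ᵇ ℝ × ℝ, IsFlow k V := by
  have hB0 : 0 ≤ B := (norm_nonneg _).trans (hB ⟨0, le_rfl, hT⟩ 0)
  refine existsUnique_volterra_solution
    (fun V (z : Path T × TimeInterval T) =>
      ∫ s in Iic z.2, k s (z.1 s + (V (z.1, s)).1) ∂timeMeasure T) hΛ (M := B * T)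
    (fun V => continuous_flow_integral hk hB V)
    (fun V z => norm_integral_Iic_le hB0 z.2 fun s => hB _ _) ?_
  intro V V' θ D hθ hD h z
  rw [← integral_sub (integrable_flow_integrand hk V z.1).restrict
    (integrable_flow_integrand hk V' z.1).restrict]
  refine norm_integral_Iic_le_exp (by linarith) (by positivity) z.2 fun r _ => ?_
  refine (hl _ _ _).trans ?_
  rw [mul_assoc, add_sub_add_left_eq_sub]
  exact mul_le_mul_of_nonneg_left ((norm_fst_le _).trans (h (z.1, r))) hΛ

/-- A path satisfying the equation up to time `t₀` follows the flow up to time `t₀`. -/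
lemma IsFlow.eq_of_eqOn {k : TimeInterval T → ℝ → ℝ × ℝ}
    {V : (Path T × TimeInterval T) →ᵇ ℝ × ℝ} (hV : IsFlow k V)
    (hk : Continuous fun z : TimeInterval T × ℝ => k z.1 z.2)
    {Λ : ℝ} (hΛ : 0 ≤ Λ) (hl : ∀ s x x', ‖k s x - k s x'‖ ≤ Λ * |x - x'|)
    (g : Path T) {y : TimeInterval T → ℝ} {t₀ : TimeInterval T} (hy : ContinuousOn y (Iic t₀))
    (h : ∀ t ≤ t₀, y t = g t + ∫ s in Iic t, (k s (y s)).1 ∂timeMeasure T) :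
    ∀ t ≤ t₀, y t = g t + (V (g, t)).1 := by
  have hVc : Continuous fun s : TimeInterval T => (V (g, s)).1 := by fun_prop
  have hd : ContinuousOn (fun t => y t - (g t + (V (g, t)).1)) (Iic t₀) :=
    hy.sub (by fun_prop)
  suffices H : ∀ t ≤ t₀, y t - (g t + (V (g, t)).1) = 0 from fun t ht => sub_eq_zero.1 (H t ht)
  refine eqOn_zero_of_le_integral hΛ hd fun t ht => ?_
  have hint := integrable_flow_integrand hk V g
  have hyi : IntegrableOn (fun s => (k s (y s)).1) (Iic t) (timeMeasure T) := by
    refine ContinuousOn.integrableOn_compact isClosed_Iic.isCompact ?_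
    have hyt : ContinuousOn y (Iic t) := hy.mono (Iic_subset_Iic.2 ht)
    exact continuous_fst.comp_continuousOn (hk.comp_continuousOn (continuousOn_id.prodMk hyt))
  have hdi : IntegrableOn (fun s => Λ * |y s - (g s + (V (g, s)).1)|) (Iic t) (timeMeasure T) :=
    (ContinuousOn.integrableOn_compact isClosed_Iic.isCompact
      (hd.mono (Iic_subset_Iic.2 ht)).abs).const_mul Λ
  have h1 : (V (g, t)).1 = ∫ s in Iic t, (k s (g s + (V (g, s)).1)).1 ∂timeMeasure T := by
    rw [hV (g, t)]
    exact fst_integral hint.restrict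
  rw [h t ht]
  nth_rewrite 1 [h1]
  rw [add_sub_add_left_eq_sub, ← integral_sub hyi hint.fst.restrict, ← integral_const_mul,
    ← Real.norm_eq_abs]
  refine norm_integral_le_of_norm_le hdi (Eventually.of_forall fun s => ?_)
  rw [← Prod.fst_sub]
  exact (norm_fst_le _).trans (hl _ _ _)

/-- The flow is causal: up to time `t₀` it only depends on the noise up to time `t₀`. -/
lemma IsFlow.causal {k : TimeInterval T → ℝ → ℝ × ℝ}
    {V : (Path T × TimeInterval T) →ᵇ ℝ × ℝ} (hV : IsFlow k V)
    (hk : Continuous fun z : TimeInterval T × ℝ => k z.1 z.2)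
    {Λ : ℝ} (hΛ : 0 ≤ Λ) (hl : ∀ s x x', ‖k s x - k s x'‖ ≤ Λ * |x - x'|)
    {g g' : Path T} {t₀ : TimeInterval T} (h : ∀ t ≤ t₀, g t = g' t) :
    V (g, t₀) = V (g', t₀) := by
  have h1 : ∀ t ≤ t₀, g' t + (V (g', t)).1 = g t + (V (g, t)).1 := by
    refine hV.eq_of_eqOn hk hΛ hl g (y := fun t => g' t + (V (g', t)).1) ?_ fun t ht => ?_
    · exact Continuous.continuousOn (by fun_prop)
    · rw [h t ht, hV (g', t)]
      simp only
      congr 1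
      exact fst_integral (integrable_flow_integrand hk V g').restrict
  rw [hV, hV]
  refine setIntegral_congr_fun measurableSet_Iic fun s hs => ?_
  simp only
  rw [h1 s hs]

/-! ### The McKean–Vlasov fixed point on path space -/

/-- The field `∫ f(x - g(r) - V₁(g, r)) exp(- V₂(g, r)⁺) μ(dg)`. When `V` is the flow, this is the
convolution of `f` with the law of the surviving process, the clock having been integrated out. -/
def pathField (f : ℝ → ℝ) (μ : Measure (Path T)) (V : (Path T × TimeInterval T) →ᵇ ℝ × ℝ)
    (r : TimeInterval T) (x : ℝ) : ℝ :=
  ∫ g, f (x - (g r + (V (g, r)).1)) * Real.exp (-max (V (g, r)).2 0) ∂μ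

lemma exp_neg_max_le_one (a : ℝ) : Real.exp (-max a 0) ≤ 1 :=
  Real.exp_le_one_iff.2 (by have := le_max_right a 0; linarith)

lemma pathField_nonneg {f : ℝ → ℝ} {μ : Measure (Path T)} (hf : ∀ x, 0 ≤ f x)
    (V : (Path T × TimeInterval T) →ᵇ ℝ × ℝ) (r : TimeInterval T) (x : ℝ) :
    0 ≤ pathField f μ V r x :=
  integral_nonneg fun _ => mul_nonneg (hf _) (Real.exp_pos _).le

section PathField

variable {f : ℝ → ℝ} {M L : ℝ} {μ : Measure (Path T)} [IsProbabilityMeasure μ]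

lemma abs_pathField_integrand_le (hM : ∀ x, |f x| ≤ M) (x a : ℝ) :
    |f x * Real.exp (-max a 0)| ≤ M := by
  rw [abs_mul, Real.abs_exp]
  exact (mul_le_of_le_one_right (abs_nonneg _) (exp_neg_max_le_one a)).trans (hM x)

lemma continuous_pathField_integrand (hf : Continuous f) (V : (Path T × TimeInterval T) →ᵇ ℝ × ℝ)
    (x : ℝ) : Continuous fun z : Path T × TimeInterval T =>
      f (x - (z.1 z.2 + (V z).1)) * Real.exp (-max (V z).2 0) := by
  have h : Continuous fun z : Path T × TimeInterval T => x - (z.1 z.2 + (V z).1) := by fun_prop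
  exact (hf.comp h).mul (by fun_prop)

lemma integrable_pathField_integrand (hf : Continuous f) (hM : ∀ x, |f x| ≤ M)
    (V : (Path T × TimeInterval T) →ᵇ ℝ × ℝ) (r : TimeInterval T) (x : ℝ) :
    Integrable (fun g => f (x - (g r + (V (g, r)).1)) * Real.exp (-max (V (g, r)).2 0)) μ := by
  have h : Continuous fun g : Path T => (g, r) := by fun_prop
  refine Integrable.of_bound
    ((continuous_pathField_integrand hf V x).comp h).measurable.aestronglyMeasurable M
    (Eventually.of_forall fun g => ?_)
  exact abs_pathField_integrand_le hM _ _

lemma abs_integral_le_of_abs_le {α : Type*} {mα : MeasurableSpace α} {μ : Measure α}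
    [IsProbabilityMeasure μ]
    {h : α → ℝ} {D : ℝ} (hD : ∀ g, |h g| ≤ D) : |∫ g, h g ∂μ| ≤ D := by
  have := norm_integral_le_of_norm_le_const (μ := μ) (f := h) (C := D) (Eventually.of_forall hD)
  simpa using this

lemma isField_pathField (hf : Continuous f) (hM : ∀ x, |f x| ≤ M)
    (hL : ∀ x x', |f x - f x'| ≤ L * |x - x'|) (V : (Path T × TimeInterval T) →ᵇ ℝ × ℝ) :
    IsField (pathField f μ V) M L where
  measurable x := by
    refine Continuous.measurable ?_
    have hc := continuous_pathField_integrand hf V x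
    refine continuous_of_dominated (bound := fun _ => M) (fun r => ?_) (fun r => ?_)
      (integrable_const M) (Eventually.of_forall fun g => ?_)
    · exact (integrable_pathField_integrand hf hM V r x).aestronglyMeasurable
    · exact Eventually.of_forall fun g => abs_pathField_integrand_le hM _ _
    · have h : Continuous fun r : TimeInterval T => (g, r) := by fun_prop
      exact hc.comp h
  bound r x := abs_integral_le_of_abs_le fun g => abs_pathField_integrand_le hM _ _
  lipschitz r x x' := by
    rw [pathField, pathField, ← integral_sub (integrable_pathField_integrand hf hM V r x)
      (integrable_pathField_integrand hf hM V r x')]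
    refine abs_integral_le_of_abs_le fun g => ?_
    rw [← sub_mul, abs_mul, Real.abs_exp]
    refine (mul_le_of_le_one_right (abs_nonneg _) (exp_neg_max_le_one _)).trans ?_
    refine (hL _ _).trans (le_of_eq ?_)
    congr 2; ring

lemma abs_pathField_sub_le (hf : Continuous f) (hM : ∀ x, |f x| ≤ M) (hL0 : 0 ≤ L)
    (hL : ∀ x x', |f x - f x'| ≤ L * |x - x'|) {V V' : (Path T × TimeInterval T) →ᵇ ℝ × ℝ}
    {r : TimeInterval T} {D : ℝ} (hD : ∀ g, ‖V (g, r) - V' (g, r)‖ ≤ D) (x : ℝ) :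
    |pathField f μ V r x - pathField f μ V' r x| ≤ (L + M) * D := by
  have hM0 : 0 ≤ M := (abs_nonneg _).trans (hM 0)
  rw [pathField, pathField, ← integral_sub (integrable_pathField_integrand hf hM V r x)
    (integrable_pathField_integrand hf hM V' r x)]
  refine abs_integral_le_of_abs_le fun g => ?_
  have h1 : |(V (g, r)).1 - (V' (g, r)).1| ≤ D := (norm_fst_le _).trans (hD g)
  have h2 : |(V (g, r)).2 - (V' (g, r)).2| ≤ D := (norm_snd_le _).trans (hD g)
  set a := (V (g, r)).2
  set a' := (V' (g, r)).2
  set u := x - (g r + (V (g, r)).1) with hu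
  set u' := x - (g r + (V' (g, r)).1) with hu'
  have h3 : |f u - f u'| ≤ L * D := by
    refine (hL _ _).trans (mul_le_mul_of_nonneg_left ?_ hL0)
    rw [abs_sub_comm] at h1
    have h6 : u - u' = (V' (g, r)).1 - (V (g, r)).1 := by rw [hu, hu']; ring
    rwa [h6]
  have h4 : |Real.exp (-max a 0) - Real.exp (-max a' 0)| ≤ D :=
    (abs_exp_neg_sub_exp_neg_le (le_max_right _ _) (le_max_right _ _)).trans
      ((abs_max_sub_max_le_abs _ _ _).trans h2)
  have h5 : f u * Real.exp (-max a 0) - f u' * Real.exp (-max a' 0)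
      = (f u - f u') * Real.exp (-max a 0)
        + f u' * (Real.exp (-max a 0) - Real.exp (-max a' 0)) := by ring
  rw [h5, add_mul]
  refine (abs_add_le _ _).trans (add_le_add ?_ ?_)
  · rw [abs_mul, Real.abs_exp]
    exact (mul_le_of_le_one_right (abs_nonneg _) (exp_neg_max_le_one _)).trans h3
  · rw [abs_mul]
    exact mul_le_mul (hM _) h4 (abs_nonneg _) hM0

end PathField

/-- Common bounds for `K` and `K'`. -/
lemma IsSmoothMollifier.exists_bounds {K : ℝ → ℝ} (hK : IsSmoothMollifier K) :
    ∃ M L : ℝ, 0 ≤ M ∧ 0 ≤ L ∧ (∀ x, |K x| ≤ M) ∧ (∀ x, |deriv K x| ≤ M) ∧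
      (∀ x x', |K x - K x'| ≤ L * |x - x'|) ∧
      (∀ x x', |deriv K x - deriv K x'| ≤ L * |x - x'|) := by
  obtain ⟨M₁, h₁⟩ := hK.bounded
  obtain ⟨M₂, h₂⟩ := hK.bounded_deriv
  obtain ⟨L₁, h₃⟩ := hK.lipschitz
  obtain ⟨L₂, h₄⟩ := hK.lipschitz_deriv
  refine ⟨max M₁ M₂, max 0 (max L₁ L₂), ?_, le_max_left _ _, fun x => (h₁ x).trans (le_max_left _ _),
    fun x => (h₂ x).trans (le_max_right _ _), fun x x' => (h₃ x' x).trans ?_,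
    fun x x' => (h₄ x' x).trans ?_⟩
  · exact ((abs_nonneg _).trans (h₁ 0)).trans (le_max_left _ _)
  · exact mul_le_mul_of_nonneg_right ((le_max_left _ _).trans (le_max_right _ _)) (abs_nonneg _)
  · exact mul_le_mul_of_nonneg_right ((le_max_right _ _).trans (le_max_right _ _)) (abs_nonneg _)

lemma IsSmoothMollifier.continuous {K : ℝ → ℝ} (hK : IsSmoothMollifier K) : Continuous K :=
  hK.smooth.continuous

lemma IsSmoothMollifier.continuous_deriv {K : ℝ → ℝ} (hK : IsSmoothMollifier K) :
    Continuous (deriv K) :=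
  hK.smooth.continuous_deriv (by simp)

/-- `V` is a flow for the coefficients computed from its own fields, the noise having law `μ`. -/
def IsMcKeanFlow (𝔐 : Model) (μ : Measure (Path T)) (V : (Path T × TimeInterval T) →ᵇ ℝ × ℝ) :
    Prop :=
  IsFlow (coef 𝔐 (pathField 𝔐.K μ V) (pathField (deriv 𝔐.K) μ V)) V

/-- A pair of fields obeying the bounds of `K` and `K'` gives coefficients to which the theory of
flows applies. -/
lemma Model.Admissible.exists_coef_lipschitz {𝔐 : Model} (h𝔐 : 𝔐.Admissible) (hT : 0 ≤ T)
    {M L : ℝ} (hM : 0 ≤ M) (hL : 0 ≤ L) {p q : TimeInterval T → ℝ → ℝ} (hp : IsField p M L)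
    (hq : IsField q M L) (hp0 : ∀ r x, 0 ≤ p r x) :
    (Continuous fun z : TimeInterval T × ℝ => coef 𝔐 p q z.1 z.2) ∧
    (∃ B, ∀ s x, ‖coef 𝔐 p q s x‖ ≤ B) ∧
    ∃ Λ, 0 ≤ Λ ∧ ∀ s x x', ‖coef 𝔐 p q s x - coef 𝔐 p q s x'‖ ≤ Λ * |x - x'| := by
  obtain ⟨C, hC, h⟩ := h𝔐.exists_coef_bound hT hM L
  refine ⟨continuous_coef h𝔐 hp hq hp0, ⟨C, (h p q hp hq hp0).1⟩, C * (2 * (L * T)), by positivity,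
    fun s x x' => ((h p q hp hq hp0).2 p q hp hq hp0 s x x').trans ?_⟩
  rw [mul_assoc]
  refine mul_le_mul_of_nonneg_left ?_ hC
  have h1 := hp.timeIntegral_lipschitz s x x'
  have h2 := hq.timeIntegral_lipschitz s x x'
  linarith

/-- Well-posedness of the McKean–Vlasov problem on path space. -/
theorem existsUnique_isMcKeanFlow {𝔐 : Model} (h𝔐 : 𝔐.Admissible) (hT : 0 ≤ T)
    (μ : Measure (Path T)) [IsProbabilityMeasure μ] : ∃! V, IsMcKeanFlow 𝔐 μ V := by
  have hK := h𝔐.mollifier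
  obtain ⟨M, L, hM, hL, hKM, hKM', hKL, hKL'⟩ := hK.exists_bounds
  obtain ⟨C, hC, h⟩ := h𝔐.exists_coef_bound hT hM L
  have hp : ∀ V : (Path T × TimeInterval T) →ᵇ ℝ × ℝ, IsField (pathField 𝔐.K μ V) M L :=
    fun V => isField_pathField hK.continuous hKM hKL V
  have hq : ∀ V : (Path T × TimeInterval T) →ᵇ ℝ × ℝ, IsField (pathField (deriv 𝔐.K) μ V) M L :=
    fun V => isField_pathField hK.continuous_deriv hKM' hKL' V
  have hp0 : ∀ (V : (Path T × TimeInterval T) →ᵇ ℝ × ℝ) r x, 0 ≤ pathField 𝔐.K μ V r x :=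
    fun V => pathField_nonneg hK.nonneg V
  refine existsUnique_volterra_solution
    (fun V (z : Path T × TimeInterval T) => ∫ s in Iic z.2,
    coef 𝔐 (pathField 𝔐.K μ V) (pathField (deriv 𝔐.K) μ V) s (z.1 s + (V (z.1, s)).1)
      ∂timeMeasure T) (κ := C * (2 * (L + M + L * T))) (M := C * T) (by positivity)
    (fun V => continuous_flow_integral (continuous_coef h𝔐 (hp V) (hq V) (hp0 V))
      (h _ _ (hp V) (hq V) (hp0 V)).1 V)
    (fun V z => norm_integral_Iic_le hC z.2 fun s => (h _ _ (hp V) (hq V) (hp0 V)).1 _ _) ?_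
  intro V V' θ D hθ hD hVV z
  have hθ0 : 0 < θ := by linarith
  rw [← integral_sub
    (integrable_flow_integrand (continuous_coef h𝔐 (hp V) (hq V) (hp0 V)) V z.1).restrict
    (integrable_flow_integrand (continuous_coef h𝔐 (hp V') (hq V') (hp0 V')) V' z.1).restrict]
  refine norm_integral_Iic_le_exp hθ0 (by positivity) z.2 fun s _ => ?_
  refine ((h _ _ (hp V) (hq V) (hp0 V)).2 _ _ (hp V') (hq V') (hp0 V') _ _ _).trans ?_
  rw [mul_assoc, mul_assoc]
  refine mul_le_mul_of_nonneg_left ?_ hC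
  set x := z.1 s + (V (z.1, s)).1 with hx
  set x' := z.1 s + (V' (z.1, s)).1 with hx'
  have hxx : |x - x'| ≤ D * Real.exp (θ * s) := by
    rw [hx, hx', add_sub_add_left_eq_sub]
    exact (norm_fst_le _).trans (hVV (z.1, s))
  have hE : 0 ≤ D * Real.exp (θ * s) := by positivity
  -- each time integral changes through the field and through the position
  have key : ∀ p p' : TimeInterval T → ℝ → ℝ, IsField p M L → IsField p' M L →
      (∀ r y, |p r y - p' r y| ≤ (L + M) * (D * Real.exp (θ * r))) →
      |timeIntegral p s x - timeIntegral p' s x'| ≤ (L + M + L * T) * (D * Real.exp (θ * s)) := by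
    intro p p' hp hp' hpp
    have h1 := hp.abs_timeIntegral_sub_le hp' (D := (L + M) * D) hθ0 (by positivity)
      (fun r y => (hpp r y).trans (le_of_eq (by ring))) s x
    have h2 := hp'.timeIntegral_lipschitz s x x'
    have h3 : (L + M) * D * Real.exp (θ * s) / θ ≤ (L + M) * (D * Real.exp (θ * s)) := by
      rw [mul_assoc]
      exact div_le_self (by positivity) hθ
    have h4 : L * T * |x - x'| ≤ L * T * (D * Real.exp (θ * s)) :=
      mul_le_mul_of_nonneg_left hxx (by positivity)
    have h5 := abs_sub_le (timeIntegral p s x) (timeIntegral p' s x) (timeIntegral p' s x')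
    linarith
  have k1 := key _ _ (hp V) (hp V') fun r y =>
    abs_pathField_sub_le hK.continuous hKM hL hKL (fun g => hVV (g, r)) y
  have k2 := key _ _ (hq V) (hq V') fun r y =>
    abs_pathField_sub_le hK.continuous_deriv hKM' hL hKL' (fun g => hVV (g, r)) y
  linarith

/-! ### Measurability on path space -/

lemma measurable_path_eval (t : TimeInterval T) : Measurable fun g : Path T => g t :=
  Continuous.measurable (by fun_prop)

/-- The Borel σ-algebra of the path space is generated by the coordinates. -/
lemma measurableSpace_path_eq :
    (instMeasurableSpacePath : MeasurableSpace (Path T)) =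
      MeasurableSpace.comap (fun (g : Path T) (t : TimeInterval T) => g t) MeasurableSpace.pi := by
  refine le_antisymm ?_ (Measurable.comap_le (measurable_pi_lambda _ measurable_path_eval))
  set m := MeasurableSpace.comap (fun (g : Path T) (t : TimeInterval T) => g t) MeasurableSpace.pi
    with hm
  have heval : ∀ t : TimeInterval T, Measurable[m] fun g : Path T => g t := fun t =>
    (measurable_pi_apply t).comp (comap_measurable _)
  have hball : ∀ (f : Path T) (r : ℝ), 0 ≤ r → MeasurableSet[m] (Metric.closedBall f r) := by
    intro f r hr
    obtain ⟨D, hDc, hD⟩ := TopologicalSpace.exists_countable_dense (TimeInterval T)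
    have h : Metric.closedBall f r =
        ⋂ t ∈ D, (fun g : Path T => g t) ⁻¹' Metric.closedBall (f t) r := by
      ext g
      simp only [Metric.mem_closedBall, mem_iInter, mem_preimage]
      rw [ContinuousMap.dist_le hr]
      refine ⟨fun h t _ => h t, fun h t => ?_⟩
      have hcl : IsClosed {t : TimeInterval T | dist (g t) (f t) ≤ r} :=
        isClosed_le (by fun_prop) continuous_const
      have := hcl.closure_subset_iff.2 h
      exact this (hD t)
    rw [h]
    exact MeasurableSet.biInter hDc fun t _ => heval t measurableSet_closedBall
  refine MeasurableSpace.generateFrom_le fun U hU => ?_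
  obtain ⟨D, hDc, hD⟩ := TopologicalSpace.exists_countable_dense (Path T)
  have hUeq : U = ⋃ f ∈ D, ⋃ n ∈ {n : ℕ | Metric.closedBall f (1 / ((n : ℝ) + 1)) ⊆ U},
      Metric.closedBall f (1 / ((n : ℝ) + 1)) := by
    refine Subset.antisymm (fun g hg => ?_) (iUnion₂_subset fun f _ => iUnion₂_subset fun n hn => hn)
    obtain ⟨ε, hε, hεU⟩ := Metric.isOpen_iff.1 (show IsOpen U from hU) g hg
    obtain ⟨n, hn⟩ := exists_nat_one_div_lt (half_pos hε)
    obtain ⟨f, hfD, hf⟩ := Metric.mem_closure_iff.1 (hD g) (1 / ((n : ℝ) + 1)) Nat.one_div_pos_of_nat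
    refine mem_iUnion₂.2 ⟨f, hfD, mem_iUnion₂.2 ⟨n, fun h hh => hεU ?_, hf.le⟩⟩
    rw [Metric.mem_closedBall] at hh
    rw [Metric.mem_ball]
    have := dist_triangle h f g
    rw [dist_comm f g] at this
    linarith
  rw [hUeq]
  refine MeasurableSet.biUnion hDc fun f _ => MeasurableSet.biUnion (Set.to_countable _) fun n _ => ?_
  exact hball f _ (by positivity)

lemma measurable_path_iff {Ω : Type*} {m : MeasurableSpace Ω} {G : Ω → Path T} :
    Measurable G ↔ ∀ t, Measurable fun ω => G ω t := by
  rw [measurableSpace_path_eq, measurable_comap_iff, measurable_pi_iff]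
  rfl

/-- The path stopped at time `t₀`. -/
def stopPath (t₀ : TimeInterval T) (g : Path T) : Path T :=
  g.comp ⟨fun t => min t t₀, by fun_prop⟩

lemma stopPath_apply (t₀ : TimeInterval T) (g : Path T) (t : TimeInterval T) :
    stopPath t₀ g t = g (min t t₀) := rfl

/-! ### Laws of processes with independent increments -/

section Increments

/-- A path sampled at the times of `F`, and `0` elsewhere. -/
def sample (F : Finset (TimeInterval T)) (y : TimeInterval T → ℝ) : TimeInterval T → ℝ :=
  (F : Set (TimeInterval T)).indicator y

lemma measurable_sample (F : Finset (TimeInterval T)) : Measurable (sample F) :=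
  measurable_pi_lambda _ fun t => by
    by_cases h : t ∈ (F : Set (TimeInterval T))
    · simp only [sample, indicator_of_mem h]; fun_prop
    · simp only [sample, indicator_of_notMem h]; fun_prop

variable {Ω Ω' : Type*} {mΩ : MeasurableSpace Ω} {mΩ' : MeasurableSpace Ω'} {P : Measure Ω}
  {P' : Measure Ω'} [IsProbabilityMeasure P] [IsProbabilityMeasure P']

/-- Adding a later time `a` to the sample amounts to adding an independent increment. -/
lemma map_sample_insert [DecidableEq (TimeInterval T)] {H : TimeInterval T → Ω → ℝ}
    (hm : ∀ t, Measurable (H t)) {F : Finset (TimeInterval T)}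
    {s a : TimeInterval T} (hs : s ∈ F) (hF : ∀ t ∈ F, t ≤ s)
    (hind : IndepFun (fun ω (r : Iic s) => H r ω) (fun ω => H a ω - H s ω) P) :
    P.map (fun ω => sample (insert a F) (H · ω)) =
      ((P.map fun ω => sample F (H · ω)).prod (P.map fun ω => H a ω - H s ω)).map
        (fun y t => if t = a then y.1 s + y.2 else y.1 t) := by
  have hφ : Measurable fun (y : (TimeInterval T → ℝ) × ℝ) (t : TimeInterval T) =>
      if t = a then y.1 s + y.2 else y.1 t := measurable_pi_lambda _ fun t => by
    by_cases h : t = a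
    · simp only [h, if_true]; fun_prop
    · simp only [h, if_false]; fun_prop
  let ψ : (Iic s → ℝ) → TimeInterval T → ℝ :=
    fun y t => if h : t ∈ F then y ⟨t, hF t h⟩ else 0
  have hψ : Measurable ψ := measurable_pi_lambda _ fun t => by
    by_cases h : t ∈ F
    · simp only [ψ, h, dif_pos]; fun_prop
    · simp only [ψ, h, dif_neg, not_false_eq_true]; fun_prop
  have hsm : Measurable fun ω => sample F (H · ω) :=
    (measurable_sample F).comp (measurable_pi_lambda _ hm)
  have hi : IndepFun (fun ω => sample F (H · ω)) (fun ω => H a ω - H s ω) P := by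
    have := hind.comp hψ measurable_id
    have e' : ψ ∘ (fun ω (r : Iic s) => H r ω) = fun ω => sample F (H · ω) := by
      funext ω t
      by_cases h : t ∈ F <;> simp [ψ, sample, h]
    rwa [e', Function.id_comp] at this
  have hd : Measurable fun ω => H a ω - H s ω := (hm a).sub (hm s)
  have e : (fun ω => sample (insert a F) (H · ω))
      = (fun (y : (TimeInterval T → ℝ) × ℝ) t => if t = a then y.1 s + y.2 else y.1 t) ∘
        fun ω => (sample F (H · ω), H a ω - H s ω) := by
    funext ω t
    by_cases hta : t = a
    · simp [sample, hta, hs]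
    · by_cases h : t ∈ F <;> simp [sample, hta, h]
  rw [e, ← Measure.map_map hφ (hsm.prodMk hd),
    (indepFun_iff_map_prod_eq_prod_map_map hsm.aemeasurable hd.aemeasurable).1 hi]

/-- The law of a process with independent increments is determined by its initial law and the
laws of its increments. -/
theorem map_eq_of_increments {H : TimeInterval T → Ω → ℝ} {H' : TimeInterval T → Ω' → ℝ}
    {z : TimeInterval T} (hz : ∀ t, z ≤ t) (hm : ∀ t, Measurable (H t))
    (hm' : ∀ t, Measurable (H' t)) (h0 : P.map (H z) = P'.map (H' z))
    (hinc : ∀ s t, s ≤ t → P.map (fun ω => H t ω - H s ω) = P'.map (fun ω => H' t ω - H' s ω))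
    (hind : ∀ s t, s ≤ t → IndepFun (fun ω (r : Iic s) => H r ω) (fun ω => H t ω - H s ω) P)
    (hind' : ∀ s t, s ≤ t → IndepFun (fun ω (r : Iic s) => H' r ω) (fun ω => H' t ω - H' s ω) P') :
    P.map (fun ω t => H t ω) = P'.map (fun ω t => H' t ω) := by
  classical
  have step : ∀ F : Finset (TimeInterval T), P.map (fun ω => sample (insert z F) (H · ω))
      = P'.map (fun ω => sample (insert z F) (H' · ω)) := by
    intro F
    induction F using Finset.induction_on_max with
    | empty =>
      have hφ : Measurable fun x : ℝ => fun t : TimeInterval T => if t = z then x else 0 :=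
        measurable_pi_lambda _ fun t => by by_cases h : t = z <;> simp [h, measurable_id']
      have e1 : (fun ω => sample (insert z ∅) (H · ω))
          = (fun x : ℝ => fun t : TimeInterval T => if t = z then x else 0) ∘ H z := by
        funext ω t; by_cases h : t = z <;> simp [sample, h]
      have e2 : (fun ω => sample (insert z ∅) (H' · ω))
          = (fun x : ℝ => fun t : TimeInterval T => if t = z then x else 0) ∘ H' z := by
        funext ω t; by_cases h : t = z <;> simp [sample, h]
      rw [e1, e2, ← Measure.map_map hφ (hm z), ← Measure.map_map hφ (hm' z), h0]
    | insert a F hF ih =>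
      by_cases haz : a = z
      · have hins : insert z (insert a F) = insert z F := by rw [haz, Finset.insert_idem]
        rw [hins, ih]
      · set s := (insert z F).max' (Finset.insert_nonempty z F) with hs
        have hsF : s ∈ insert z F := Finset.max'_mem _ _
        have hle : ∀ t ∈ insert z F, t ≤ s := fun t ht => Finset.le_max' _ t ht
        have hsa : s ≤ a := by
          rcases Finset.mem_insert.1 hsF with h | h
          · rw [h]; exact hz a
          · exact (hF s h).le
        rw [Finset.insert_comm, map_sample_insert hm hsF hle (hind s a hsa),
          map_sample_insert hm' hsF hle (hind' s a hsa), ih, hinc s a hsa]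
  have hpm : Measurable fun ω t => H t ω := measurable_pi_lambda _ hm
  have hpm' : Measurable fun ω t => H' t ω := measurable_pi_lambda _ hm'
  have hproj := isProjectiveLimit_map (P := P) (X := H) hpm.aemeasurable
  have hproj' := isProjectiveLimit_map (P := P') (X := H') hpm'.aemeasurable
  have hfin : (fun F : Finset (TimeInterval T) => P.map (fun ω => F.restrict (H · ω)))
      = fun F : Finset (TimeInterval T) => P'.map (fun ω => F.restrict (H' · ω)) := by
    funext F
    have e1 : (fun ω => F.restrict (H · ω))
        = F.restrict ∘ fun ω => sample (insert z F) (H · ω) := by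
      funext ω t; simp [sample]
    have e2 : (fun ω => F.restrict (H' · ω))
        = F.restrict ∘ fun ω => sample (insert z F) (H' · ω) := by
      funext ω t; simp [sample]
    have m1 : Measurable fun ω => sample (insert z F) (H · ω) := (measurable_sample _).comp hpm
    have m2 : Measurable fun ω => sample (insert z F) (H' · ω) := (measurable_sample _).comp hpm'
    rw [e1, e2, ← Measure.map_map (Finset.measurable_restrict F) m1,
      ← Measure.map_map (Finset.measurable_restrict F) m2, step F]
  rw [← hfin] at hproj'
  have hprob : ∀ F : Finset (TimeInterval T),
      IsFiniteMeasure (P.map (fun ω => F.restrict (H · ω))) := fun F => inferInstance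
  exact hproj.unique hproj'

end Increments

/-! ### The driving path -/

section Inputs

variable {Ω : Type*} {mΩ : MeasurableSpace Ω} {P : Measure Ω} {ρ₀ : ℝ → ℝ}
  {𝓕 : Filtration (TimeInterval T) mΩ} {W : TimeInterval T → Ω → ℝ} {X₀ Z : Ω → ℝ}

/-- `G` is a version of the driving path `X₀ + √2 W` with continuous paths everywhere. -/
structure IsDrivingPath (P : Measure Ω) (W : TimeInterval T → Ω → ℝ) (X₀ : Ω → ℝ)
    (G : Ω → Path T) : Prop where
  measurable : Measurable G
  ae_eq : ∀ᵐ ω ∂P, ∀ t, G ω t = X₀ ω + √2 * W t ω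

lemma IsInput.measurable_W (hin : IsInput ρ₀ P 𝓕 W X₀ Z) (t : TimeInterval T) :
    Measurable (W t) :=
  (hin.brownian.adapted t).mono (𝓕.le t) le_rfl

lemma IsInput.measurable_X₀ (hT : 0 ≤ T) (hin : IsInput ρ₀ P 𝓕 W X₀ Z) : Measurable X₀ :=
  (hin.initial_measurable ⟨0, le_rfl, hT⟩ rfl).mono (𝓕.le _) le_rfl

/-- The driving path can be chosen adapted to the augmented filtration of the inputs. -/
lemma IsInput.exists_isDrivingPath (hT : 0 ≤ T) (hin : IsInput ρ₀ P 𝓕 W X₀ Z) :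
    ∃ G : Ω → Path T, IsDrivingPath P W X₀ G ∧
      ∀ t, Measurable[inputSigmaAlgebra P W X₀ Z t] fun ω => G ω t := by
  classical
  set N := toMeasurable P {ω | ¬ Continuous fun t => W t ω} with hN
  have hNm : MeasurableSet N := measurableSet_toMeasurable _ _
  have hN0 : P N = 0 := by rw [hN, measure_toMeasurable]; exact hin.brownian.continuous_paths
  have hNc : ∀ ω, ω ∉ N → Continuous fun t => W t ω := fun ω h => by
    by_contra hc
    exact h (subset_toMeasurable _ _ hc)
  let G : Ω → Path T := fun ω =>
    if h : ω ∈ N then 0 else ⟨fun t => X₀ ω + √2 * W t ω, by have := hNc ω h; fun_prop⟩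
  have hG : ∀ t, (fun ω => G ω t) = N.piecewise (fun _ => 0) fun ω => X₀ ω + √2 * W t ω := by
    intro t
    funext ω
    by_cases h : ω ∈ N <;> simp [G, h]
  have hX₀ := hin.measurable_X₀ hT
  refine ⟨G, ⟨measurable_path_iff.2 fun t => ?_, ?_⟩, fun t => ?_⟩
  · rw [hG]
    exact Measurable.piecewise hNm measurable_const (hX₀.add ((hin.measurable_W t).const_mul _))
  · have : ∀ᵐ ω ∂P, ω ∉ N := measure_eq_zero_iff_ae_notMem.1 hN0
    filter_upwards [this] with ω hω t
    simp [G, hω]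
  · rw [hG]
    have h1 : MeasurableSpace.comap X₀ inferInstance ≤ inputSigmaAlgebra P W X₀ Z t :=
      le_sup_of_le_left (le_sup_of_le_left le_sup_left)
    have h2 : MeasurableSpace.comap (W t) inferInstance ≤ inputSigmaAlgebra P W X₀ Z t :=
      le_sup_of_le_left (le_sup_of_le_right
        (le_iSup₂_of_le (f := fun s (_ : s ≤ t) => MeasurableSpace.comap (W s) inferInstance)
          t le_rfl le_rfl))
    have h3 : MeasurableSet[inputSigmaAlgebra P W X₀ Z t] N := by
      have : MeasurableSpace.generateFrom {N | MeasurableSet[mΩ] N ∧ P N = 0}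
        ≤ inputSigmaAlgebra P W X₀ Z t := le_sup_right
      exact this _ (MeasurableSpace.measurableSet_generateFrom ⟨hNm, hN0⟩)
    have m1 : Measurable[inputSigmaAlgebra P W X₀ Z t] X₀ := measurable_iff_comap_le.2 h1
    have m2 : Measurable[inputSigmaAlgebra P W X₀ Z t] (W t) := measurable_iff_comap_le.2 h2
    exact Measurable.piecewise h3 measurable_const (m1.add (m2.const_mul _))

lemma IsInput.indepFun_increment (hT : 0 ≤ T) (hin : IsInput ρ₀ P 𝓕 W X₀ Z) {s t : TimeInterval T}
    (hst : s ≤ t) :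
    IndepFun (fun ω (r : Iic s) => X₀ ω + √2 * W r ω)
      (fun ω => X₀ ω + √2 * W t ω - (X₀ ω + √2 * W s ω)) P := by
  rw [IndepFun_iff_Indep]
  refine indep_of_indep_of_le (hin.brownian.increment_indep s t hst).symm ?_ ?_
  · refine measurable_iff_comap_le.1 (@measurable_pi_lambda _ _ _ (𝓕 s) _ _ fun r => ?_)
    have h0 : Measurable[𝓕 s] X₀ :=
      (hin.initial_measurable ⟨0, le_rfl, hT⟩ rfl).mono (𝓕.mono s.2.1) le_rfl
    have h1 : Measurable[𝓕 s] (W r) := (hin.brownian.adapted r).mono (𝓕.mono r.2) le_rfl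
    exact h0.add (h1.const_mul (√2))
  · have e : (fun ω => X₀ ω + √2 * W t ω - (X₀ ω + √2 * W s ω))
        = (fun x => √2 * x) ∘ fun ω => W t ω - W s ω := by funext ω; simp; ring
    rw [e, ← MeasurableSpace.comap_comp]
    exact MeasurableSpace.comap_mono (Measurable.comap_le (by fun_prop : Measurable fun x => √2 * x))

variable {G : Ω → Path T}

lemma IsDrivingPath.indepFun (hin : IsInput ρ₀ P 𝓕 W X₀ Z) (hG : IsDrivingPath P W X₀ G) :
    IndepFun G Z P := by
  have h : IndepFun (fun ω (t : TimeInterval T) => G ω t) Z P := by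
    have hφ : Measurable fun y : ℝ × (TimeInterval T → ℝ) => fun t => y.1 + √2 * y.2 t :=
      measurable_pi_lambda _ fun t => by fun_prop
    refine (hin.clock_indep.symm.comp hφ measurable_id).congr ?_ (ae_eq_refl _)
    filter_upwards [hG.ae_eq] with ω hω
    funext t
    exact (hω t).symm
  rw [IndepFun_iff_Indep] at h ⊢
  rwa [measurableSpace_path_eq, MeasurableSpace.comap_comp]

/-- The law of the driving path is the same for all inputs. -/
lemma IsDrivingPath.map_eq [IsProbabilityMeasure P] (hT : 0 ≤ T) {Ω' : Type*}
    {mΩ' : MeasurableSpace Ω'} {P' : Measure Ω'} [IsProbabilityMeasure P'] {𝓕' : Filtration (TimeInterval T) mΩ'}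
    {W' : TimeInterval T → Ω' → ℝ} {X₀' Z' : Ω' → ℝ} {G' : Ω' → Path T}
    (hin : IsInput ρ₀ P 𝓕 W X₀ Z) (hG : IsDrivingPath P W X₀ G)
    (hin' : IsInput ρ₀ P' 𝓕' W' X₀' Z') (hG' : IsDrivingPath P' W' X₀' G') :
    P.map G = P'.map G' := by
  have key : P.map (fun ω t => X₀ ω + √2 * W t ω) = P'.map (fun ω t => X₀' ω + √2 * W' t ω) := by
    refine map_eq_of_increments (H := fun t ω => X₀ ω + √2 * W t ω)
      (H' := fun t ω => X₀' ω + √2 * W' t ω) (z := ⟨0, le_rfl, hT⟩) (fun t => t.2.1)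
      (fun t => (hin.measurable_X₀ hT).add ((hin.measurable_W t).const_mul _))
      (fun t => (hin'.measurable_X₀ hT).add ((hin'.measurable_W t).const_mul _)) ?_ ?_ ?_ ?_
    · have h1 : (fun ω => X₀ ω + √2 * W ⟨0, le_rfl, hT⟩ ω) =ᵐ[P] X₀ := by
        filter_upwards [hin.brownian.start ⟨0, le_rfl, hT⟩ rfl] with ω hω
        simp [hω]
      have h2 : (fun ω => X₀' ω + √2 * W' ⟨0, le_rfl, hT⟩ ω) =ᵐ[P'] X₀' := by
        filter_upwards [hin'.brownian.start ⟨0, le_rfl, hT⟩ rfl] with ω hω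
        simp [hω]
      rw [Measure.map_congr h1, Measure.map_congr h2, hin.initial_law.map_eq,
        hin'.initial_law.map_eq]
    · intro s t hst
      have e1 : (fun ω => X₀ ω + √2 * W t ω - (X₀ ω + √2 * W s ω))
          = (fun x => √2 * x) ∘ fun ω => W t ω - W s ω := by funext ω; simp; ring
      have e2 : (fun ω => X₀' ω + √2 * W' t ω - (X₀' ω + √2 * W' s ω))
          = (fun x => √2 * x) ∘ fun ω => W' t ω - W' s ω := by funext ω; simp; ring
      have hφ : Measurable fun x : ℝ => √2 * x := by fun_prop
      have d1 : Measurable fun ω => W t ω - W s ω := (hin.measurable_W t).sub (hin.measurable_W s)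
      have d2 : Measurable fun ω => W' t ω - W' s ω :=
        (hin'.measurable_W t).sub (hin'.measurable_W s)
      rw [e1, e2, ← Measure.map_map hφ d1, ← Measure.map_map hφ d2,
        (hin.brownian.increment_law s t hst).map_eq, (hin'.brownian.increment_law s t hst).map_eq]
    · exact fun s t hst => hin.indepFun_increment hT hst
    · exact fun s t hst => hin'.indepFun_increment hT hst
  have e1 : P.map (fun ω t => G ω t) = P.map (fun ω t => X₀ ω + √2 * W t ω) :=
    Measure.map_congr (by filter_upwards [hG.ae_eq] with ω hω using funext hω)
  have e2 : P'.map (fun ω t => G' ω t) = P'.map (fun ω t => X₀' ω + √2 * W' t ω) :=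
    Measure.map_congr (by filter_upwards [hG'.ae_eq] with ω hω using funext hω)
  have hι : Measurable fun (g : Path T) (t : TimeInterval T) => g t :=
    measurable_pi_lambda _ measurable_path_eval
  have hmap : (P.map G).map (fun (g : Path T) (t : TimeInterval T) => g t)
      = (P'.map G').map (fun (g : Path T) (t : TimeInterval T) => g t) := by
    rw [Measure.map_map hι hG.measurable, Measure.map_map hι hG'.measurable]
    exact e1.trans (key.trans e2.symm)
  ext S hS
  rw [measurableSpace_path_eq] at hS
  obtain ⟨A, hA, rfl⟩ := hS
  rw [← Measure.map_apply hι hA, hmap, Measure.map_apply hι hA]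

end Inputs

/-! ### Integrating out the clock -/

lemma expMeasure_one_real_Ioi {a : ℝ} (ha : 0 ≤ a) :
    (expMeasure 1).real (Ioi a) = Real.exp (-a) := by
  have := isProbabilityMeasure_expMeasure one_pos
  have h1 : (expMeasure 1).real (Iic a) = 1 - Real.exp (-a) := by
    rw [← cdf_eq_real, cdf_expMeasure_eq one_pos, if_pos ha, one_mul]
  rw [← compl_Iic, probReal_compl_eq_one_sub measurableSet_Iic, h1]
  ring

section Clock

variable {Ω : Type*} {mΩ : MeasurableSpace Ω} {P : Measure Ω} [IsProbabilityMeasure P]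

/-- An independent `Exp(1)` clock exceeds the level `a` with conditional probability `exp (-a)`. -/
lemma setIntegral_lt_clock {α : Type*} {mα : MeasurableSpace α} {G : Ω → α} {Z : Ω → ℝ}
    (hG : Measurable G) (hZ : Measurable Z) (hlaw : HasLaw Z (expMeasure 1) P)
    (hi : IndepFun G Z P) {h a : α → ℝ} (hh : Measurable h) {M : ℝ} (hM : ∀ g, |h g| ≤ M)
    (ha : Measurable a) (ha0 : ∀ g, 0 ≤ a g) :
    ∫ ω in {ω | a (G ω) < Z ω}, h (G ω) ∂P = ∫ g, h g * Real.exp (-a g) ∂(P.map G) := by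
  have := isProbabilityMeasure_expMeasure one_pos
  have hPG : IsProbabilityMeasure (P.map G) := Measure.isProbabilityMeasure_map hG.aemeasurable
  set S : Set (α × ℝ) := {y | a y.1 < y.2} with hS
  have hSm : MeasurableSet S := measurableSet_lt (ha.comp measurable_fst) measurable_snd
  set F : α × ℝ → ℝ := S.indicator fun y => h y.1 with hF
  have hFm : Measurable F := (hh.comp measurable_fst).indicator hSm
  have hjoint : P.map (fun ω => (G ω, Z ω)) = (P.map G).prod (expMeasure 1) := by
    rw [(indepFun_iff_map_prod_eq_prod_map_map hG.aemeasurable hZ.aemeasurable).1 hi, hlaw.map_eq]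
  have hFi : Integrable F ((P.map G).prod (expMeasure 1)) :=
    Integrable.of_bound hFm.aestronglyMeasurable M (Eventually.of_forall fun y =>
      (norm_indicator_le_norm_self _ _).trans (hM _))
  have hSω : MeasurableSet {ω | a (G ω) < Z ω} := measurableSet_lt (ha.comp hG) hZ
  calc ∫ ω in {ω | a (G ω) < Z ω}, h (G ω) ∂P
      = ∫ ω, F (G ω, Z ω) ∂P := by
        rw [← integral_indicator hSω]; rfl
    _ = ∫ y, F y ∂(P.map fun ω => (G ω, Z ω)) :=
        (integral_map (hG.prodMk hZ).aemeasurable hFm.aestronglyMeasurable).symm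
    _ = ∫ g, ∫ z, F (g, z) ∂(expMeasure 1) ∂(P.map G) := by rw [hjoint, integral_prod _ hFi]
    _ = _ := by
        refine integral_congr_ae (Eventually.of_forall fun g => ?_)
        have e : (fun z => F (g, z)) = (Ioi (a g)).indicator fun _ => h g := rfl
        simp only [e]
        rw [integral_indicator measurableSet_Ioi, setIntegral_const,
          expMeasure_one_real_Ioi (ha0 g), smul_eq_mul, mul_comm]

end Clock

/-! ### The surviving law as a field -/

/-- The position of a living particle, and `0` at the cemetery. -/
def position : State → ℝ := extendZero id

lemma position_alive (x : ℝ) : position (alive x) = x := rfl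

lemma continuous_position : Continuous position :=
  Continuous.sumElim continuous_id continuous_const

lemma measurable_position : Measurable position :=
  Measurable.sumElim measurable_id measurable_const

lemma measurableEmbedding_alive : MeasurableEmbedding alive where
  injective := Sum.inl_injective
  measurable := measurable_inl
  measurableSet_image' _ hs := hs.inl_image

lemma measurable_of_continuousWithinAt_Ici {φ : TimeInterval T → ℝ}
    (hφ : ∀ r, ContinuousWithinAt φ (Ici r) r) : Measurable φ := by
  -- approximation from the right along the grid of mesh `1 / (n + 1)`
  let ρ : ℕ → TimeInterval T → TimeInterval T := fun n r =>
    ⟨min T ((⌊(r : ℝ) * (n + 1)⌋ + 1) / (n + 1)), le_min (r.2.1.trans r.2.2) (by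
        have : (0 : ℝ) ≤ ⌊(r : ℝ) * (n + 1)⌋ := by
          exact_mod_cast Int.floor_nonneg.2 (mul_nonneg r.2.1 (by positivity))
        positivity), min_le_left _ _⟩
  have hρ : ∀ n (r : TimeInterval T), (r : ℝ) ≤ ρ n r := fun n r => by
    refine le_min r.2.2 ?_
    rw [le_div_iff₀ (by positivity)]
    exact (Int.lt_floor_add_one _).le
  have hρ' : ∀ n (r : TimeInterval T), (ρ n r : ℝ) ≤ r + 1 / ((n : ℝ) + 1) := fun n r => by
    refine (min_le_right _ _).trans ?_
    have h1 : (0 : ℝ) < (n : ℝ) + 1 := by positivity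
    rw [add_div]
    have : (⌊(r : ℝ) * (n + 1)⌋ : ℝ) / (n + 1) ≤ r := by
      rw [div_le_iff₀ h1]; exact Int.floor_le _
    linarith
  have hlim : ∀ r, Tendsto (fun n => φ (ρ n r)) atTop (𝓝 (φ r)) := fun r => by
    refine (hφ r).tendsto.comp (tendsto_nhdsWithin_iff.2
      ⟨tendsto_subtype_rng.2 ?_, Eventually.of_forall fun n => hρ n r⟩)
    refine tendsto_of_tendsto_of_tendsto_of_le_of_le tendsto_const_nhds ?_
      (fun n => hρ n r) (fun n => hρ' n r)
    simpa using tendsto_one_div_add_atTop_nhds_zero_nat.const_add (r : ℝ)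
  refine measurable_of_tendsto_metrizable (fun n => ?_) (tendsto_pi_nhds.2 hlim)
  -- `ρ n` factors through the countable type of integers
  by_cases hT : 0 ≤ T
  · let σ : ℤ → TimeInterval T := fun k => ⟨min T (max 0 (((k : ℝ) + 1) / (n + 1))),
      le_min hT (le_max_left _ _), min_le_left _ _⟩
    have hfac : (fun r => φ (ρ n r)) = (fun k : ℤ => φ (σ k)) ∘
        fun r : TimeInterval T => ⌊(r : ℝ) * (n + 1)⌋ := by
      funext r
      simp only [Function.comp]
      congr 1
      refine Subtype.ext ?_
      have : (0 : ℝ) ≤ ⌊(r : ℝ) * (n + 1)⌋ := by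
        exact_mod_cast Int.floor_nonneg.2 (mul_nonneg r.2.1 (by positivity))
      simp only [ρ, σ]
      rw [max_eq_right (by positivity)]
    rw [hfac]
    exact (measurable_from_top (f := fun k : ℤ => φ (σ k))).comp
      (Int.measurable_floor.comp (by fun_prop))
  · have : IsEmpty (TimeInterval T) := ⟨fun r => hT (r.2.1.trans r.2.2)⟩
    exact measurable_of_empty _

lemma isOpen_setOf_coe_lt (τ : WithTop (TimeInterval T)) :
    IsOpen {t : TimeInterval T | (t : WithTop (TimeInterval T)) < τ} := by
  induction τ using WithTop.recTopCoe with
  | top => simp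
  | coe a =>
    simp only [WithTop.coe_lt_coe]
    exact isOpen_Iio

section SurvivingLaw

variable {Ω : Type*} {mΩ : MeasurableSpace Ω} {P : Measure Ω}
  {X : TimeInterval T → Ω → State} {τ : Ω → WithTop (TimeInterval T)}

lemma conv_survivingLaw {r : TimeInterval T} (hX : Measurable (X r))
    (hτ : MeasurableSet {ω | (r : WithTop (TimeInterval T)) < τ ω})
    (halive : ∀ᵐ ω ∂P, (r : WithTop (TimeInterval T)) < τ ω → X r ω ∈ range alive)
    {f : ℝ → ℝ} (hf : Measurable f) (x : ℝ) :
    conv f (survivingLaw P X τ r) (alive x) =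
      ∫ ω in {ω | (r : WithTop (TimeInterval T)) < τ ω}, f (x - position (X r ω)) ∂P := by
  change ∫ y, f (x - y) ∂(survivingLaw P X τ r) = _
  set Q := (P.restrict {ω | (r : WithTop (TimeInterval T)) < τ ω}).map (X r) with hQ
  have hF : Measurable fun z : State => f (x - position z) :=
    hf.comp (measurable_const.sub measurable_position)
  have hrange : Q.restrict (range alive) = Q := by
    refine Measure.restrict_eq_self_of_ae_mem ?_
    rw [hQ]
    refine (ae_map_iff (p := fun z => z ∈ range alive) hX.aemeasurable
      measurableEmbedding_alive.measurableSet_range).2 ?_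
    rw [ae_restrict_iff' hτ]
    exact halive
  calc ∫ y, f (x - y) ∂(survivingLaw P X τ r)
      = ∫ y, (fun z : State => f (x - position z)) (alive y) ∂(Q.comap alive) := rfl
    _ = ∫ z, f (x - position z) ∂((Q.comap alive).map alive) :=
        (measurableEmbedding_alive.integral_map (fun z : State => f (x - position z))).symm
    _ = ∫ z, f (x - position z) ∂Q := by rw [measurableEmbedding_alive.map_comap, hrange]
    _ = _ := integral_map hX.aemeasurable hF.aestronglyMeasurable

variable [IsProbabilityMeasure P]

/-- The convolutions with the surviving laws form a field. Measurability in time comes from the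
right-continuity of `r ↦ f(x - X_r) 1_{r < τ}`. -/
lemma isField_conv_survivingLaw (hX : ∀ r, Measurable (X r))
    (hτ : ∀ r : TimeInterval T, MeasurableSet {ω | (r : WithTop (TimeInterval T)) < τ ω})
    (halive : ∀ᵐ ω ∂P, ∀ r : TimeInterval T, (r : WithTop (TimeInterval T)) < τ ω →
      X r ω ∈ range alive)
    (hcont : ∀ᵐ ω ∂P, ContinuousOn (fun t => X t ω) {t | (t : WithTop (TimeInterval T)) < τ ω})
    {f : ℝ → ℝ} (hf : Continuous f) {M L : ℝ} (hM : ∀ x, |f x| ≤ M)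
    (hL : ∀ x x', |f x - f x'| ≤ L * |x - x'|) :
    IsField (fun r x => conv f (survivingLaw P X τ r) (alive x)) M L := by
  have hconv : ∀ (r : TimeInterval T) x, conv f (survivingLaw P X τ r) (alive x) =
      ∫ ω, {ω | (r : WithTop (TimeInterval T)) < τ ω}.indicator
        (fun ω => f (x - position (X r ω))) ω ∂P := fun r x => by
    rw [conv_survivingLaw (hX r) (hτ r) (halive.mono fun ω h => h r) hf.measurable,
      integral_indicator (hτ r)]
  have hmeas : ∀ (r : TimeInterval T) x, AEStronglyMeasurable
      ({ω | (r : WithTop (TimeInterval T)) < τ ω}.indicator (fun ω => f (x - position (X r ω)))) P := fun r x =>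
    ((hf.measurable.comp (measurable_const.sub
      (measurable_position.comp (hX r)))).indicator (hτ r)).aestronglyMeasurable
  have hbd : ∀ (r : TimeInterval T) x ω, ‖{ω | (r : WithTop (TimeInterval T)) < τ ω}.indicator
      (fun ω => f (x - position (X r ω))) ω‖ ≤ M := fun r x ω =>
    (norm_indicator_le_norm_self _ _).trans (hM _)
  have hint : ∀ (r : TimeInterval T) x, Integrable
      ({ω | (r : WithTop (TimeInterval T)) < τ ω}.indicator (fun ω => f (x - position (X r ω)))) P := fun r x =>
    Integrable.of_bound (hmeas r x) M (Eventually.of_forall (hbd r x))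
  refine ⟨fun x => ?_, fun r x => ?_, fun r x x' => ?_⟩
  · refine measurable_of_continuousWithinAt_Ici fun r₀ => ?_
    simp_rw [hconv]
    refine continuousWithinAt_of_dominated (bound := fun _ => M)
      (Eventually.of_forall fun r => hmeas r x)
      (Eventually.of_forall fun r => Eventually.of_forall (hbd r x)) (integrable_const M) ?_
    filter_upwards [hcont] with ω hω
    by_cases h : (r₀ : WithTop (TimeInterval T)) < τ ω
    · have hopen := isOpen_setOf_coe_lt (τ ω)
      have hXc : ContinuousAt (fun t => X t ω) r₀ := hω.continuousAt (hopen.mem_nhds h)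
      have hc : ContinuousAt (fun t => f (x - position (X t ω))) r₀ :=
        hf.continuousAt.comp (continuousAt_const.sub (continuous_position.continuousAt.comp hXc))
      refine (hc.congr ?_).continuousWithinAt
      filter_upwards [hopen.mem_nhds h] with t ht
      exact (indicator_of_mem (s := {ω | (t : WithTop (TimeInterval T)) < τ ω}) ht
        (fun ω => f (x - position (X t ω)))).symm
    · have hz : ∀ t ∈ Ici r₀, {ω | (t : WithTop (TimeInterval T)) < τ ω}.indicator
          (fun ω => f (x - position (X t ω))) ω = 0 := fun t ht =>
        indicator_of_notMem (s := {ω | (t : WithTop (TimeInterval T)) < τ ω})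
          (fun h' => h ((WithTop.coe_le_coe.2 ht).trans_lt h')) _
      exact continuousWithinAt_const.congr hz (hz r₀ (mem_Ici.2 le_rfl))
  · rw [hconv]
    exact abs_integral_le_of_abs_le (hbd r x)
  · rw [hconv, hconv, ← integral_sub (hint r x) (hint r x')]
    refine abs_integral_le_of_abs_le fun ω => ?_
    by_cases h : (r : WithTop (TimeInterval T)) < τ ω
    · simp only [indicator, mem_ofPred_eq, h, if_true]
      refine (hL _ _).trans (le_of_eq ?_)
      congr 2; ring
    · simp only [indicator, mem_ofPred_eq, h, if_false, sub_self, abs_zero]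
      exact (abs_nonneg _).trans (hL x x')

end SurvivingLaw

/-! ### Solutions follow the McKean–Vlasov flow -/

/-- First passage of a continuous nondecreasing process over the level `z`. -/
lemma coe_lt_iff_of_isGLB {c : TimeInterval T → ℝ} (hc : Continuous c) (hmono : Monotone c) {z : ℝ}
    {τ : WithTop (TimeInterval T)}
    (h : IsGLB ((fun t : TimeInterval T => (t : WithTop (TimeInterval T))) '' {t | z ≤ c t}) τ)
    (t : TimeInterval T) : (t : WithTop (TimeInterval T)) < τ ↔ c t < z := by
  constructor
  · intro ht
    by_contra hz
    exact absurd (h.1 ⟨t, not_lt.1 hz, rfl⟩) (not_le.2 ht)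
  · intro ht
    rcases eq_empty_or_nonempty {t | z ≤ c t} with he | hne
    · rw [he, image_empty] at h
      exact (WithTop.coe_lt_top t).trans_le (h.2 (by simp))
    · obtain ⟨b, hb, hmin⟩ := (isClosed_le continuous_const hc).isCompact.exists_isLeast hne
      have htb : t < b := by
        by_contra hbt
        exact absurd (lt_of_le_of_lt (hmono (not_lt.1 hbt)) ht) (not_lt.2 hb)
      refine (WithTop.coe_lt_coe.2 htb).trans_le (h.2 ?_)
      rintro _ ⟨s, hs, rfl⟩
      exact WithTop.coe_le_coe.2 (hmin hs)

lemma monotone_integral_Iic {k : TimeInterval T → ℝ} (hk : Integrable k (timeMeasure T))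
    (hk0 : ∀ s, 0 ≤ k s) : Monotone fun t => ∫ s in Iic t, k s ∂timeMeasure T := fun _ _ hst =>
  setIntegral_mono_set hk.integrableOn (Eventually.of_forall hk0)
    (Iic_subset_Iic.2 hst).eventuallyLE

/-- The state at time `t` for the driving path `g` and the clock `z`: the position given by the
flow `V` until the integrated rate `V₂` reaches `z`. -/
def flowState (V : (Path T × TimeInterval T) →ᵇ ℝ × ℝ) (g : Path T) (z : ℝ) (t : TimeInterval T) :
    State :=
  open Classical in if (V (g, t)).2 < z then alive (g t + (V (g, t)).1) else cemetery

section Flow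

variable {𝔐 : Model} {p q : TimeInterval T → ℝ → ℝ} {V : (Path T × TimeInterval T) →ᵇ ℝ × ℝ}

lemma IsFlow.fst_eq {k : TimeInterval T → ℝ → ℝ × ℝ} (hV : IsFlow k V)
    (hk : Continuous fun z : TimeInterval T × ℝ => k z.1 z.2) (g : Path T) (t : TimeInterval T) :
    (V (g, t)).1 = ∫ s in Iic t, (k s (g s + (V (g, s)).1)).1 ∂timeMeasure T := by
  rw [hV (g, t)]
  exact fst_integral (integrable_flow_integrand hk V g).restrict

lemma IsFlow.snd_eq {k : TimeInterval T → ℝ → ℝ × ℝ} (hV : IsFlow k V)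
    (hk : Continuous fun z : TimeInterval T × ℝ => k z.1 z.2) (g : Path T) (t : TimeInterval T) :
    (V (g, t)).2 = ∫ s in Iic t, (k s (g s + (V (g, s)).1)).2 ∂timeMeasure T := by
  rw [hV (g, t)]
  exact snd_integral (integrable_flow_integrand hk V g).restrict

lemma IsFlow.snd_nonneg (h𝔐 : 𝔐.Admissible) (hV : IsFlow (coef 𝔐 p q) V)
    (hk : Continuous fun z : TimeInterval T × ℝ => coef 𝔐 p q z.1 z.2) (g : Path T)
    (t : TimeInterval T) : 0 ≤ (V (g, t)).2 := by
  rw [hV.snd_eq hk]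
  exact integral_nonneg fun s => coef_snd_nonneg h𝔐 _ _

lemma IsFlow.snd_monotone (h𝔐 : 𝔐.Admissible) (hV : IsFlow (coef 𝔐 p q) V)
    (hk : Continuous fun z : TimeInterval T × ℝ => coef 𝔐 p q z.1 z.2) (g : Path T) :
    Monotone fun t => (V (g, t)).2 := by
  simp_rw [hV.snd_eq hk]
  exact monotone_integral_Iic (integrable_flow_integrand hk V g).snd
    fun s => coef_snd_nonneg h𝔐 _ _

end Flow

section Solution

variable {Ω : Type*} {mΩ : MeasurableSpace Ω} {P : Measure Ω}
  {ρ₀ : ℝ → ℝ} {𝔐 : Model} {𝓕 : Filtration (TimeInterval T) mΩ} {W : TimeInterval T → Ω → ℝ}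
  {X₀ Z : Ω → ℝ} {X : TimeInterval T → Ω → State} {τ : Ω → WithTop (TimeInterval T)}
  {G : Ω → Path T}

lemma rate_nonneg (h𝔐 : 𝔐.Admissible) (ν : TimeInterval T → Measure ℝ) (s : TimeInterval T)
    (z : State) : 0 ≤ 𝔐.rate ν s z :=
  mul_nonneg (mul_nonneg h𝔐.lam_pos.le h𝔐.c₀_nonneg) (Real.exp_pos _).le

lemma rate_le (h𝔐 : 𝔐.Admissible) (ν : TimeInterval T → Measure ℝ) (s : TimeInterval T)
    (z : State) : 𝔐.rate ν s z ≤ 𝔐.lam * 𝔐.c₀ := by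
  refine mul_le_of_le_one_right (mul_nonneg h𝔐.lam_pos.le h𝔐.c₀_nonneg)
    (Real.exp_le_one_iff.2 ?_)
  have h : 0 ≤ timeConv 𝔐.K ν s z := by
    refine integral_nonneg fun r => ?_
    cases z with
    | inl x => exact integral_nonneg fun y => h𝔐.mollifier.nonneg _
    | inr _ => exact le_rfl
  have := h𝔐.lam_pos
  nlinarith

lemma IsSolution.measurableSet_lt (hsol : IsSolution 𝔐 ρ₀ P 𝓕 W X₀ Z X τ) (r : TimeInterval T) :
    MeasurableSet {ω | (r : WithTop (TimeInterval T)) < τ ω} := by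
  have h := (𝓕.le r _ (hsol.stopping r)).compl
  have e : {ω | (r : WithTop (TimeInterval T)) < τ ω}
      = {ω | τ ω ≤ (r : WithTop (TimeInterval T))}ᶜ := by
    ext ω; simp
  rwa [e]

/-- A solution follows the flow of the coefficients computed from its own surviving laws, and it
is killed when the integrated rate along this flow reaches the clock. -/
lemma IsSolution.follows_flow (h𝔐 : 𝔐.Admissible)
    (hsol : IsSolution 𝔐 ρ₀ P 𝓕 W X₀ Z X τ) (hG : IsDrivingPath P W X₀ G)
    {p q : TimeInterval T → ℝ → ℝ}
    (hp : p = fun r x => conv 𝔐.K (survivingLaw P X τ r) (alive x))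
    (hq : q = fun r x => conv (deriv 𝔐.K) (survivingLaw P X τ r) (alive x))
    (hk : Continuous fun z : TimeInterval T × ℝ => coef 𝔐 p q z.1 z.2) {Λ : ℝ} (hΛ : 0 ≤ Λ)
    (hl : ∀ s x x', ‖coef 𝔐 p q s x - coef 𝔐 p q s x'‖ ≤ Λ * |x - x'|)
    {V : (Path T × TimeInterval T) →ᵇ ℝ × ℝ} (hV : IsFlow (coef 𝔐 p q) V) :
    ∀ᵐ ω ∂P, ∀ t : TimeInterval T,
      ((t : WithTop (TimeInterval T)) < τ ω ↔ (V (G ω, t)).2 < Z ω) ∧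
        X t ω = flowState V (G ω) (Z ω) t := by
  have hcoef : ∀ s x, coef 𝔐 p q s x = (𝔐.drift (survivingLaw P X τ) s (alive x),
      𝔐.rate (survivingLaw P X τ) s (alive x)) := fun s x => by subst hp hq; rfl
  filter_upwards [hsol.continuous_paths, hsol.equation, hsol.killed, hsol.killing_time, hG.ae_eq,
    hsol.integrable] with ω hcont heq hkill htime hGω hint
  have halive : ∀ s : TimeInterval T, (s : WithTop (TimeInterval T)) < τ ω →
      X s ω = alive (position (X s ω)) := fun s hs => by rw [heq s hs, position_alive]
  have hpos : ∀ t : TimeInterval T, (t : WithTop (TimeInterval T)) < τ ω →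
      X t ω = alive (G ω t + (V (G ω, t)).1) := by
    intro t ht
    have hlt : ∀ s ≤ t, (s : WithTop (TimeInterval T)) < τ ω := fun s hs =>
      (WithTop.coe_le_coe.2 hs).trans_lt ht
    rw [halive t ht]
    congr 1
    refine hV.eq_of_eqOn hk hΛ hl (G ω) (y := fun s => position (X s ω)) (t₀ := t) ?_ ?_ t le_rfl
    · exact continuous_position.comp_continuousOn (hcont.mono hlt)
    · intro s hs
      rw [heq s (hlt s hs), position_alive, hGω s]
      have : ∫ r in Iic s, 𝔐.drift (survivingLaw P X τ) r (X r ω) ∂timeMeasure T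
          = ∫ r in Iic s, (coef 𝔐 p q r (position (X r ω))).1 ∂timeMeasure T := by
        refine setIntegral_congr_fun measurableSet_Iic fun r hr => ?_
        simp only [hcoef]
        rw [← halive r (hlt r (le_trans hr hs))]
      rw [this]
      ring
  set c : TimeInterval T → ℝ := fun t =>
    ∫ s in Iic t, 𝔐.rate (survivingLaw P X τ) s (X s ω) ∂timeMeasure T with hc
  have hcc : Continuous c := by
    have := continuous_integral_Iic (T := T) (S := Unit)
      (h := fun _ s => 𝔐.rate (survivingLaw P X τ) s (X s ω))
      (fun _ => hint.2.aestronglyMeasurable) (fun _ => continuous_const) (M := 𝔐.lam * 𝔐.c₀)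
      (fun _ s => by
        rw [Real.norm_eq_abs, abs_of_nonneg (rate_nonneg h𝔐 _ _ _)]; exact rate_le h𝔐 _ _ _)
    exact this.comp (continuous_const.prodMk continuous_id : Continuous fun t => ((), t))
  have hcm : Monotone c := monotone_integral_Iic hint.2 fun s => rate_nonneg h𝔐 _ _ _
  have hfirst := coe_lt_iff_of_isGLB hcc hcm htime
  -- up to the killing time the integrated rate is the one along the flow
  have hAc : ∀ t : TimeInterval T, (∀ s < t, (s : WithTop (TimeInterval T)) < τ ω) →
      (V (G ω, t)).2 = c t := by
    intro t ht
    rw [hV.snd_eq hk, hc]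
    refine setIntegral_congr_ae measurableSet_Iic ?_
    have hne : ∀ᵐ s ∂timeMeasure T, s ≠ t := by rw [ae_iff]; simp
    filter_upwards [hne] with s hs hst
    rw [hcoef, hpos s (ht s (lt_of_le_of_ne hst hs))]
  have hiff : ∀ t : TimeInterval T,
      (t : WithTop (TimeInterval T)) < τ ω ↔ (V (G ω, t)).2 < Z ω := by
    intro t
    constructor
    · intro ht
      rw [hAc t fun s hs => (WithTop.coe_lt_coe.2 hs).trans ht]
      exact (hfirst t).1 ht
    · intro ht
      by_contra hn
      obtain ⟨a, ha⟩ := WithTop.ne_top_iff_exists.1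
        (ne_top_of_le_ne_top (WithTop.coe_ne_top) (not_lt.1 hn))
      have hat : a ≤ t := WithTop.coe_le_coe.1 (by rw [ha]; exact not_lt.1 hn)
      have h1 : Z ω ≤ c a := not_lt.1 fun h => by
        have := (hfirst a).2 h
        rw [ha] at this
        exact lt_irrefl _ this
      have h2 : (V (G ω, a)).2 = c a := hAc a fun s hs => by
        rw [← ha]; exact WithTop.coe_lt_coe.2 hs
      have h3 : (V (G ω, a)).2 ≤ (V (G ω, t)).2 := hV.snd_monotone h𝔐 hk (G ω) hat
      linarith
  intro t
  refine ⟨hiff t, ?_⟩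
  by_cases ht : (t : WithTop (TimeInterval T)) < τ ω
  · rw [flowState, if_pos ((hiff t).1 ht), hpos t ht]
  · rw [flowState, if_neg (fun h => ht ((hiff t).2 h)), hkill t (not_lt.1 ht)]

variable [IsProbabilityMeasure P]

/-- For a process given by a flow, the convolutions with the surviving laws are the path fields. -/
lemma conv_survivingLaw_eq_pathField (hZ : Measurable Z) (hlaw : HasLaw Z (expMeasure 1) P)
    (hG : Measurable G) (hi : IndepFun G Z P) {V : (Path T × TimeInterval T) →ᵇ ℝ × ℝ}
    (hV0 : ∀ z, 0 ≤ (V z).2) {r : TimeInterval T} (hX : Measurable (X r))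
    (hτ : MeasurableSet {ω | (r : WithTop (TimeInterval T)) < τ ω})
    (hflow : ∀ᵐ ω ∂P, ((r : WithTop (TimeInterval T)) < τ ω ↔ (V (G ω, r)).2 < Z ω) ∧
        X r ω = flowState V (G ω) (Z ω) r)
    {f : ℝ → ℝ} (hf : Continuous f) {M : ℝ} (hM : ∀ x, |f x| ≤ M) (x : ℝ) :
    conv f (survivingLaw P X τ r) (alive x) = pathField f (P.map G) V r x := by
  have hr : Continuous fun g : Path T => (g, r) := by fun_prop
  have hVr : Measurable fun g : Path T => V (g, r) := (V.continuous.comp hr).measurable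
  have halive : ∀ᵐ ω ∂P, (r : WithTop (TimeInterval T)) < τ ω → X r ω ∈ range alive := by
    filter_upwards [hflow] with ω hω h
    rw [hω.2, flowState, if_pos (hω.1.1 h)]
    exact mem_range_self _
  rw [conv_survivingLaw hX hτ halive hf.measurable]
  have hset : {ω | (r : WithTop (TimeInterval T)) < τ ω} =ᵐ[P] {ω | (V (G ω, r)).2 < Z ω} := by
    filter_upwards [hflow] with ω hω
    exact propext hω.1
  rw [setIntegral_congr_set hset]
  have hm : MeasurableSet {ω | (V (G ω, r)).2 < Z ω} :=
    _root_.measurableSet_lt (measurable_snd.comp (hVr.comp hG)) hZ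
  have hcongr : ∫ ω in {ω | (V (G ω, r)).2 < Z ω}, f (x - position (X r ω)) ∂P
      = ∫ ω in {ω | (V (G ω, r)).2 < Z ω}, f (x - (G ω r + (V (G ω, r)).1)) ∂P := by
    refine setIntegral_congr_ae hm ?_
    filter_upwards [hflow] with ω hω h
    rw [hω.2, flowState, if_pos h, position_alive]
  rw [hcongr, setIntegral_lt_clock (h := fun g => f (x - (g r + (V (g, r)).1)))
    (a := fun g => (V (g, r)).2) hG hZ hlaw hi ?_ (M := M) (fun g => hM _)
    (measurable_snd.comp hVr) (fun g => hV0 _)]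
  · rw [pathField]
    refine integral_congr_ae (Eventually.of_forall fun g => ?_)
    simp only
    rw [max_eq_left (hV0 _)]
  · exact hf.measurable.comp (measurable_const.sub
      ((measurable_path_eval r).add (measurable_fst.comp hVr)))

/-- Every solution is the image of its driving path and clock under the McKean–Vlasov flow. -/
theorem IsSolution.eq_flowState (hT : 0 ≤ T) (h𝔐 : 𝔐.Admissible)
    (hsol : IsSolution 𝔐 ρ₀ P 𝓕 W X₀ Z X τ) (hG : IsDrivingPath P W X₀ G)
    {V : (Path T × TimeInterval T) →ᵇ ℝ × ℝ} (hV : IsMcKeanFlow 𝔐 (P.map G) V) :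
    ∀ᵐ ω ∂P, ∀ t : TimeInterval T,
      ((t : WithTop (TimeInterval T)) < τ ω ↔ (V (G ω, t)).2 < Z ω) ∧
        X t ω = flowState V (G ω) (Z ω) t := by
  have hPG : IsProbabilityMeasure (P.map G) :=
    Measure.isProbabilityMeasure_map hG.measurable.aemeasurable
  have hK := h𝔐.mollifier
  obtain ⟨M, L, hM, hL, hKM, hKM', hKL, hKL'⟩ := hK.exists_bounds
  have hX : ∀ r, Measurable (X r) := fun r => (hsol.adapted r).mono (𝓕.le r) le_rfl
  have halive : ∀ᵐ ω ∂P, ∀ r : TimeInterval T, (r : WithTop (TimeInterval T)) < τ ω →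
      X r ω ∈ range alive := by
    filter_upwards [hsol.equation] with ω hω r hr
    rw [hω r hr]; exact mem_range_self _
  have hp := isField_conv_survivingLaw hX hsol.measurableSet_lt halive hsol.continuous_paths
    hK.continuous hKM hKL
  have hq := isField_conv_survivingLaw hX hsol.measurableSet_lt halive hsol.continuous_paths
    hK.continuous_deriv hKM' hKL'
  obtain ⟨hk, ⟨B, hB⟩, Λ, hΛ, hl⟩ := h𝔐.exists_coef_lipschitz hT hM hL hp hq
    (fun r x => integral_nonneg fun y => hK.nonneg _)
  obtain ⟨V', hV', -⟩ := existsUnique_isFlow hT hk hB hΛ hl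
  have hflow := hsol.follows_flow h𝔐 hG rfl rfl hk hΛ hl hV'
  have hfield : ∀ f : ℝ → ℝ, Continuous f → (∀ x, |f x| ≤ M) →
      (fun r x => conv f (survivingLaw P X τ r) (alive x)) = pathField f (P.map G) V' := by
    intro f hf hfM
    funext r x
    exact conv_survivingLaw_eq_pathField hsol.input.clock_measurable hsol.input.clock_law
      hG.measurable (hG.indepFun hsol.input) (fun z => hV'.snd_nonneg h𝔐 hk z.1 z.2) (hX r)
      (hsol.measurableSet_lt r) (hflow.mono fun ω h => h r) hf hfM x
  have hMK : IsMcKeanFlow 𝔐 (P.map G) V' := by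
    rw [IsMcKeanFlow, ← hfield _ hK.continuous hKM, ← hfield _ hK.continuous_deriv hKM']
    exact hV'
  rw [(existsUnique_isMcKeanFlow h𝔐 hT (P.map G)).unique hV hMK]
  exact hflow

end Solution

/-! ### Independence of σ-algebras -/

section Indep

variable {Ω : Type*} {m mΩ : MeasurableSpace Ω} {P : Measure Ω}

lemma indep_sup_null {d h : MeasurableSpace Ω} (hi : Indep d h P) :
    Indep d (h ⊔ MeasurableSpace.generateFrom {N | MeasurableSet[mΩ] N ∧ P N = 0}) P := by
  have hle : h ⊔ MeasurableSpace.generateFrom {N | MeasurableSet[mΩ] N ∧ P N = 0}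
      ≤ eventuallyMeasurableSpace h (ae P) := by
    refine sup_le le_eventuallyMeasurableSpace (MeasurableSpace.generateFrom_le fun N hN => ?_)
    exact ⟨∅, MeasurableSet.empty, ae_eq_empty.2 hN.2⟩
  rw [Indep_iff] at hi ⊢
  intro u s hu hs
  obtain ⟨s', hs', hss'⟩ := hle s hs
  rw [measure_congr ((ae_eq_refl u).inter hss'), measure_congr hss', hi u s' hu hs']

lemma indep_sup_right [IsProbabilityMeasure P] {d h z : MeasurableSpace Ω} (hd : d ≤ mΩ)
    (hh : h ≤ mΩ) (hz : z ≤ mΩ) (h₁ : Indep d h P) (h₂ : Indep (d ⊔ h) z P) : Indep d (h ⊔ z) P := by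
  set p : Set (Set Ω) := {u | ∃ s t, MeasurableSet[h] s ∧ MeasurableSet[z] t ∧ u = s ∩ t} with hp
  have hgen : h ⊔ z = MeasurableSpace.generateFrom p := by
    refine le_antisymm (sup_le (fun s hs => ?_) (fun t ht => ?_))
      (MeasurableSpace.generateFrom_le ?_)
    · exact MeasurableSpace.measurableSet_generateFrom
        ⟨s, univ, hs, MeasurableSet.univ, (inter_univ s).symm⟩
    · exact MeasurableSpace.measurableSet_generateFrom
        ⟨univ, t, MeasurableSet.univ, ht, (univ_inter t).symm⟩
    · rintro _ ⟨s, t, hs, ht, rfl⟩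
      have h1 : MeasurableSet[h ⊔ z] s := (le_sup_left : h ≤ h ⊔ z) s hs
      have h2 : MeasurableSet[h ⊔ z] t := (le_sup_right : z ≤ h ⊔ z) t ht
      exact h1.inter h2
  have hpi : IsPiSystem p := by
    rintro _ ⟨s, t, hs, ht, rfl⟩ _ ⟨s', t', hs', ht', rfl⟩ -
    exact ⟨s ∩ s', t ∩ t', hs.inter hs', ht.inter ht', inter_inter_inter_comm _ _ _ _⟩
  refine IndepSets.indep hd (sup_le hh hz) (@MeasurableSpace.isPiSystem_measurableSet Ω d) hpi
    (@MeasurableSpace.generateFrom_measurableSet Ω d).symm hgen ?_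
  rw [IndepSets_iff]
  rintro u _ hu ⟨s, t, hs, ht, rfl⟩
  have hu' : MeasurableSet[d] u := hu
  rw [Indep_iff] at h₁ h₂
  have hu1 : MeasurableSet[d ⊔ h] u := (le_sup_left : d ≤ d ⊔ h) u hu'
  have hs1 : MeasurableSet[d ⊔ h] s := (le_sup_right : h ≤ d ⊔ h) s hs
  rw [← inter_assoc, h₂ _ t (hu1.inter hs1) ht, h₁ u s hu' hs, h₂ s t hs1 ht, mul_assoc]

end Indep

/-! ### Construction of the strong solution -/

lemma exists_isGLB_passage {c : TimeInterval T → ℝ} (hc : Continuous c) (z : ℝ) :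
    ∃ τ : WithTop (TimeInterval T),
      IsGLB ((fun t : TimeInterval T => (t : WithTop (TimeInterval T))) '' {t | z ≤ c t}) τ := by
  rcases eq_empty_or_nonempty {t | z ≤ c t} with he | hne
  · exact ⟨⊤, by rw [he, image_empty]; exact isGLB_empty⟩
  · obtain ⟨b, hb⟩ := (isClosed_le continuous_const hc).isCompact.exists_isLeast hne
    refine ⟨b, IsLeast.isGLB ⟨mem_image_of_mem _ hb.1, ?_⟩⟩
    rintro _ ⟨s, hs, rfl⟩
    exact WithTop.coe_le_coe.2 (hb.2 hs)

section Existence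

variable {Ω : Type*} {mΩ : MeasurableSpace Ω} {P : Measure Ω}
  {ρ₀ : ℝ → ℝ} {𝔐 : Model} {𝓕 : Filtration (TimeInterval T) mΩ} {W : TimeInterval T → Ω → ℝ}
  {X₀ Z : Ω → ℝ} {G : Ω → Path T}

/-- The augmented filtration generated by the inputs. -/
def inputFiltration (hT : 0 ≤ T) (hin : IsInput ρ₀ P 𝓕 W X₀ Z) :
    Filtration (TimeInterval T) mΩ where
  seq := inputSigmaAlgebra P W X₀ Z
  mono' s t hst := by
    refine sup_le_sup_right (sup_le_sup_left ?_ _) _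
    exact iSup₂_le fun r hr => le_iSup₂_of_le (f := fun s (_ : s ≤ t) =>
      MeasurableSpace.comap (W s) inferInstance) r (hr.trans hst) le_rfl
  le' t := by
    refine sup_le (sup_le (sup_le (hin.measurable_X₀ hT).comap_le hin.clock_measurable.comap_le)
      (iSup₂_le fun r _ => (hin.measurable_W r).comap_le)) ?_
    exact MeasurableSpace.generateFrom_le fun N hN => hN.1

variable [IsProbabilityMeasure P]

/-- The inputs remain inputs for the augmented filtration they generate. In particular revealing
the independent clock at time `0` does not destroy the Brownian property of `W`. -/
lemma isInput_inputFiltration (hT : 0 ≤ T) (hin : IsInput ρ₀ P 𝓕 W X₀ Z) :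
    IsInput ρ₀ P (inputFiltration hT hin) W X₀ Z where
  brownian :=
    { adapted := fun t => measurable_iff_comap_le.2 <| le_sup_of_le_left (le_sup_of_le_right
        (le_iSup₂_of_le (f := fun s (_ : s ≤ t) => MeasurableSpace.comap (W s) inferInstance)
          t le_rfl le_rfl))
      start := hin.brownian.start
      increment_law := hin.brownian.increment_law
      continuous_paths := hin.brownian.continuous_paths
      increment_indep := fun s t hst => by
        set d := MeasurableSpace.comap (fun ω => W t ω - W s ω) inferInstance with hd
        set h := MeasurableSpace.comap X₀ inferInstance ⊔
          ⨆ r ≤ s, MeasurableSpace.comap (W r) inferInstance with hh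
        set j := MeasurableSpace.comap (fun ω => (X₀ ω, fun t => W t ω)) inferInstance with hj
        have mW : Measurable[j] fun ω => (X₀ ω, fun t => W t ω) := comap_measurable _
        have hX₀j : MeasurableSpace.comap X₀ inferInstance ≤ j :=
          measurable_iff_comap_le.1 (measurable_fst.comp mW)
        have hWj : ∀ r, Measurable[j] (W r) := fun r =>
          (measurable_pi_apply r).comp (measurable_snd.comp mW)
        have hhF : h ≤ 𝓕 s := by
          refine sup_le (measurable_iff_comap_le.1 ?_) (iSup₂_le fun r hr => ?_)
          · exact (hin.initial_measurable ⟨0, le_rfl, hT⟩ rfl).mono (𝓕.mono s.2.1) le_rfl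
          · exact measurable_iff_comap_le.1 ((hin.brownian.adapted r).mono (𝓕.mono hr) le_rfl)
        have hdm : d ≤ mΩ := Measurable.comap_le ((hin.measurable_W t).sub (hin.measurable_W s))
        have h1 : Indep d h P :=
          indep_of_indep_of_le_right (hin.brownian.increment_indep s t hst) hhF
        have hdj : d ≤ j := measurable_iff_comap_le.1 ((hWj t).sub (hWj s))
        have hhj : h ≤ j := sup_le hX₀j (iSup₂_le fun r _ => measurable_iff_comap_le.1 (hWj r))
        have h2 : Indep (d ⊔ h) (MeasurableSpace.comap Z inferInstance) P := by
          have := hin.clock_indep.symm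
          rw [IndepFun_iff_Indep] at this
          exact indep_of_indep_of_le_left this (sup_le hdj hhj)
        have h3 := indep_sup_null (indep_sup_right hdm (hhF.trans (𝓕.le s))
          hin.clock_measurable.comap_le h1 h2)
        have e : inputSigmaAlgebra P W X₀ Z s = h ⊔ MeasurableSpace.comap Z inferInstance ⊔
            MeasurableSpace.generateFrom {N | MeasurableSet[mΩ] N ∧ P N = 0} := by
          rw [inputSigmaAlgebra, hh, sup_right_comm (MeasurableSpace.comap X₀ inferInstance)]
        change Indep d (inputSigmaAlgebra P W X₀ Z s) P
        rw [e]
        exact h3 }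
  initial_measurable t _ := measurable_iff_comap_le.2 <|
    le_sup_of_le_left (le_sup_of_le_left le_sup_left)
  initial_law := hin.initial_law
  clock_measurable := hin.clock_measurable
  clock_law := hin.clock_law
  clock_indep := hin.clock_indep

lemma measurable_flowState {m : MeasurableSpace Ω} {V : (Path T × TimeInterval T) →ᵇ ℝ × ℝ}
    {t : TimeInterval T} (hG : Measurable fun ω => (G ω t, V (G ω, t))) (hZ : Measurable Z) :
    Measurable fun ω => flowState V (G ω) (Z ω) t := by
  have h1 : Measurable fun ω => (V (G ω, t)).2 := measurable_snd.comp (measurable_snd.comp hG)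
  have h2 : Measurable fun ω => G ω t + (V (G ω, t)).1 :=
    (measurable_fst.comp hG).add (measurable_fst.comp (measurable_snd.comp hG))
  have h3 : MeasurableSet {ω | (V (G ω, t)).2 < Z ω} := measurableSet_lt h1 hZ
  simp only [flowState]
  exact Measurable.ite h3 (measurable_inl.comp h2) measurable_const

/-- The McKean–Vlasov flow evaluated at the inputs is a strong solution. -/
theorem exists_isStrongSolution (hT : 0 ≤ T) (h𝔐 : 𝔐.Admissible)
    (hin : IsInput ρ₀ P 𝓕 W X₀ Z) :
    ∃ (X : TimeInterval T → Ω → State) (τ : Ω → WithTop (TimeInterval T)),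
      IsStrongSolution 𝔐 ρ₀ P W X₀ Z X τ := by
  obtain ⟨G, hG, hGad⟩ := hin.exists_isDrivingPath hT
  have hPG : IsProbabilityMeasure (P.map G) :=
    Measure.isProbabilityMeasure_map hG.measurable.aemeasurable
  have hK := h𝔐.mollifier
  obtain ⟨M, L, hM, hL, hKM, hKM', hKL, hKL'⟩ := hK.exists_bounds
  obtain ⟨V, hV, -⟩ := existsUnique_isMcKeanFlow h𝔐 hT (P.map G)
  set p := pathField 𝔐.K (P.map G) V with hp
  set q := pathField (deriv 𝔐.K) (P.map G) V with hq
  obtain ⟨hk, ⟨B, hB⟩, Λ, hΛ, hl⟩ := h𝔐.exists_coef_lipschitz hT hM hL (p := p) (q := q)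
    (isField_pathField hK.continuous hKM hKL V)
    (isField_pathField hK.continuous_deriv hKM' hKL' V) (pathField_nonneg (μ := P.map G) hK.nonneg V)
  have hVf : IsFlow (coef 𝔐 p q) V := hV
  have hVt : ∀ g : Path T, Continuous fun t : TimeInterval T => V (g, t) := fun g => by fun_prop
  set 𝓖 := inputFiltration hT hin with h𝓖
  have h𝓖eq : ∀ t, 𝓖 t = inputSigmaAlgebra P W X₀ Z t := fun t => rfl
  have hZ𝓖 : ∀ t, Measurable[𝓖 t] Z := fun t => measurable_iff_comap_le.2 <|
    le_sup_of_le_left (le_sup_of_le_left le_sup_right)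
  -- by causality, the flow at time `t` only sees the driving path up to time `t`
  have hGV : ∀ t, Measurable[𝓖 t] fun ω => (G ω t, V (G ω, t)) := by
    intro t
    have h1 : Measurable[𝓖 t] fun ω => stopPath t (G ω) := by
      rw [@measurable_path_iff T Ω (𝓖 t)]
      intro s
      have : Measurable[𝓖 (min s t)] fun ω => G ω (min s t) := hGad _
      exact this.mono (𝓖.mono (min_le_right s t)) le_rfl
    have h2 : (fun ω => V (G ω, t)) = (fun g => V (g, t)) ∘ fun ω => stopPath t (G ω) := by
      funext ω
      refine hVf.causal hk hΛ hl fun s hs => ?_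
      rw [stopPath_apply, min_eq_left hs]
    have h3 : Measurable fun g : Path T => V (g, t) :=
      (V.continuous.comp (by fun_prop : Continuous fun g : Path T => (g, t))).measurable
    have h4 : Measurable[𝓖 t] fun ω => V (G ω, t) := by
      rw [h2]; exact h3.comp h1
    exact Measurable.prodMk (hGad t) h4
  choose τ hτ using fun ω => exists_isGLB_passage (c := fun t => (V (G ω, t)).2)
    (continuous_snd.comp (hVt (G ω))) (Z ω)
  have hlt : ∀ ω (t : TimeInterval T),
      (t : WithTop (TimeInterval T)) < τ ω ↔ (V (G ω, t)).2 < Z ω := fun ω =>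
    coe_lt_iff_of_isGLB (continuous_snd.comp (hVt (G ω))) (hVf.snd_monotone h𝔐 hk (G ω)) (hτ ω)
  have hstopping : IsStoppingTime 𝓖 τ := by
    intro t
    have e : {ω | τ ω ≤ (t : WithTop (TimeInterval T))} = {ω | (V (G ω, t)).2 < Z ω}ᶜ := by
      ext ω
      simp [← hlt]
    rw [e]
    have hm : MeasurableSet[𝓖 t] {ω | (V (G ω, t)).2 < Z ω} :=
      measurableSet_lt (measurable_snd.comp (measurable_snd.comp (hGV t))) (hZ𝓖 t)
    exact hm.compl
  set X : TimeInterval T → Ω → State := fun t ω => flowState V (G ω) (Z ω) t with hX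
  have hXad : ∀ t, Measurable[𝓖 t] (X t) := fun t => measurable_flowState (hGV t) (hZ𝓖 t)
  have hXalive : ∀ ω (t : TimeInterval T), (t : WithTop (TimeInterval T)) < τ ω →
      X t ω = alive (G ω t + (V (G ω, t)).1) := fun ω t ht => by
    simp only [hX, flowState, if_pos ((hlt ω t).1 ht)]
  have hXdead : ∀ ω (t : TimeInterval T), τ ω ≤ (t : WithTop (TimeInterval T)) →
      X t ω = cemetery := fun ω t ht => by
    simp only [hX, flowState, if_neg (fun h => absurd ((hlt ω t).2 h) (not_lt.2 ht))]
  have hconv : ∀ f : ℝ → ℝ, Continuous f → (∀ x, |f x| ≤ M) → ∀ r x,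
      conv f (survivingLaw P X τ r) (alive x) = pathField f (P.map G) V r x := by
    intro f hf hfM r x
    have hm : MeasurableSet {ω | (r : WithTop (TimeInterval T)) < τ ω} := by
      have := (𝓖.le r _ (hstopping r)).compl
      have e : {ω | (r : WithTop (TimeInterval T)) < τ ω}
          = {ω | τ ω ≤ (r : WithTop (TimeInterval T))}ᶜ := by ext ω; simp
      rwa [e]
    exact conv_survivingLaw_eq_pathField hin.clock_measurable hin.clock_law
      hG.measurable (hG.indepFun hin) (fun z => hVf.snd_nonneg h𝔐 hk z.1 z.2)
      ((hXad r).mono (𝓖.le r) le_rfl) hm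
      (Eventually.of_forall fun ω => ⟨hlt ω r, rfl⟩) hf hfM x
  have hcoef : ∀ s x, (𝔐.drift (survivingLaw P X τ) s (alive x),
      𝔐.rate (survivingLaw P X τ) s (alive x)) = coef 𝔐 p q s x := by
    intro s x
    have e1 : timeConv 𝔐.K (survivingLaw P X τ) s (alive x) = timeIntegral p s x := by
      refine integral_congr_ae (Eventually.of_forall fun r => ?_)
      exact hconv _ hK.continuous hKM r x
    have e2 : timeConv (deriv 𝔐.K) (survivingLaw P X τ) s (alive x) = timeIntegral q s x := by
      refine integral_congr_ae (Eventually.of_forall fun r => ?_)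
      exact hconv _ hK.continuous_deriv hKM' r x
    simp only [Model.drift, Model.rate, coef, e1, e2]
  have hdead : ∀ f s, timeConv f (survivingLaw P X τ) s cemetery = 0 := fun f s => by
    simp [timeConv, conv, cemetery, extendZero]
  have hint : ∀ ω, Integrable (fun s => (𝔐.drift (survivingLaw P X τ) s (X s ω),
      𝔐.rate (survivingLaw P X τ) s (X s ω))) (timeMeasure T) := by
    intro ω
    set S := {s : TimeInterval T | (s : WithTop (TimeInterval T)) < τ ω} with hS
    have hSm : MeasurableSet S := (isOpen_setOf_coe_lt (τ ω)).measurableSet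
    classical
    have e : (fun s => (𝔐.drift (survivingLaw P X τ) s (X s ω),
        𝔐.rate (survivingLaw P X τ) s (X s ω)))
        = S.piecewise (fun s => coef 𝔐 p q s (G ω s + (V (G ω, s)).1))
          (fun _ => (𝔐.b 0 0, 𝔐.lam * 𝔐.c₀)) := by
      funext s
      by_cases hs : s ∈ S
      · rw [piecewise_eq_of_mem _ _ _ hs, hXalive ω s hs, hcoef]
      · rw [piecewise_eq_of_notMem _ _ _ hs, hXdead ω s (not_lt.1 hs)]
        simp [Model.drift, Model.rate, hdead]
    rw [e]
    exact Integrable.piecewise hSm (integrable_flow_integrand hk V (G ω)).integrableOn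
      (integrable_const _).integrableOn
  refine ⟨X, τ, 𝓖, h𝓖eq, ?_⟩
  refine
    { input := isInput_inputFiltration hT hin
      adapted := hXad
      stopping := hstopping
      continuous_paths := Eventually.of_forall fun ω => ?_
      integrable := Eventually.of_forall fun ω => ⟨(hint ω).fst, (hint ω).snd⟩
      equation := ?_
      killed := Eventually.of_forall hXdead
      killing_time := Eventually.of_forall fun ω => ?_ }
  · have hc : Continuous fun t => alive (G ω t + (V (G ω, t)).1) :=
      continuous_inl.comp ((map_continuous (G ω)).add (continuous_fst.comp (hVt (G ω))))
    exact hc.continuousOn.congr fun t ht => hXalive ω t ht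
  · filter_upwards [hG.ae_eq] with ω hω t ht
    rw [hXalive ω t ht, hω t, hVf.fst_eq hk]
    have : ∫ s in Iic t, 𝔐.drift (survivingLaw P X τ) s (X s ω) ∂timeMeasure T
        = ∫ s in Iic t, (coef 𝔐 p q s (G ω s + (V (G ω, s)).1)).1 ∂timeMeasure T := by
      refine setIntegral_congr_fun measurableSet_Iic fun s hs => ?_
      rw [hXalive ω s ((WithTop.coe_le_coe.2 hs).trans_lt ht), ← hcoef]
    rw [this]
    congr 1
    ring
  · -- the integrated rates along `X` and along the flow agree up to time `τ`
    have hAc : ∀ t : TimeInterval T, (∀ s < t, (s : WithTop (TimeInterval T)) < τ ω) →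
        ∫ s in Iic t, 𝔐.rate (survivingLaw P X τ) s (X s ω) ∂timeMeasure T
          = (V (G ω, t)).2 := by
      intro t ht
      rw [hVf.snd_eq hk]
      refine setIntegral_congr_ae measurableSet_Iic ?_
      have hne : ∀ᵐ s ∂timeMeasure T, s ≠ t := by rw [ae_iff]; simp
      filter_upwards [hne] with s hs hst
      rw [hXalive ω s (ht s (lt_of_le_of_ne hst hs)), ← hcoef]
    have hlow : τ ω ∈ lowerBounds ((fun t : TimeInterval T => (t : WithTop (TimeInterval T))) ''
        {t | Z ω ≤
          ∫ s in Iic t, 𝔐.rate (survivingLaw P X τ) s (X s ω) ∂timeMeasure T}) := by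
      rintro _ ⟨t, ht, rfl⟩
      by_contra hn
      have hn' : (t : WithTop (TimeInterval T)) < τ ω := not_le.1 hn
      have ht' : Z ω ≤ ∫ s in Iic t, 𝔐.rate (survivingLaw P X τ) s (X s ω) ∂timeMeasure T := ht
      rw [hAc t fun s hs => (WithTop.coe_lt_coe.2 hs).trans hn'] at ht'
      exact absurd ((hlt ω t).1 hn') (not_lt.2 ht')
    refine ⟨hlow, fun σ hσ => ?_⟩
    by_cases htop : τ ω = ⊤
    · rw [htop]; exact le_top
    · obtain ⟨a, ha⟩ := WithTop.ne_top_iff_exists.1 htop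
      rw [← ha]
      refine hσ ⟨a, ?_, rfl⟩
      change Z ω ≤ ∫ s in Iic a, 𝔐.rate (survivingLaw P X τ) s (X s ω) ∂timeMeasure T
      rw [hAc a fun s hs => by rw [← ha]; exact WithTop.coe_lt_coe.2 hs]
      refine not_lt.1 fun h => ?_
      have := (hlt ω a).2 h
      rw [ha] at this
      exact lt_irrefl _ this

end Existence

/-! ### The Schauder system -/

/-- The tent function on `[0, 1]`, extended by zero. -/
def tent (x : ℝ) : ℝ := max 0 (min x (1 - x))

lemma tent_nonneg (x : ℝ) : 0 ≤ tent x := le_max_left _ _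

@[fun_prop]
lemma continuous_tent : Continuous tent := by unfold tent; fun_prop

/-- Among the integer translates of the tent at most one is nonzero at a given point. -/
lemma sum_tent_le_one (n : ℕ) (x : ℝ) : ∑ k : Fin n, tent (x - (k : ℕ)) ≤ 1 := by
  have h : ∀ k : ℕ, tent (x - k) ≤ if k = ⌊x⌋₊ then 1 else 0 := by
    intro k
    split_ifs with hk
    · exact max_le zero_le_one ((min_le_iff.2 (by
        rcases le_total (x - k) 1 with h | h
        · exact Or.inl h
        · exact Or.inr (by linarith))))
    · refine max_le le_rfl (min_le_iff.2 ?_)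
      by_contra! hcon
      refine hk (Eq.symm ((Nat.floor_eq_iff ?_).2 ⟨?_, ?_⟩))
      · linarith [(Nat.cast_nonneg k : (0 : ℝ) ≤ k), hcon.1]
      · linarith [hcon.1]
      · linarith [hcon.2]
  rw [Fin.sum_univ_eq_sum_range fun k => tent (x - (k : ℕ))]
  refine (Finset.sum_le_sum fun k _ => h k).trans ?_
  rw [Finset.sum_ite_eq']
  split_ifs <;> norm_num

/-- The covariance kernel `min s t - s t` of the Brownian bridge on `[0, 1]`, extended by zero. -/
def bridgeKernel (s t : ℝ) : ℝ :=
  min (max 0 (min 1 s)) (max 0 (min 1 t)) - max 0 (min 1 s) * max 0 (min 1 t)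

lemma bridgeKernel_of_mem {s t : ℝ} (hs : s ∈ Icc (0 : ℝ) 1) (ht : t ∈ Icc (0 : ℝ) 1) :
    bridgeKernel s t = min s t - s * t := by
  simp only [bridgeKernel, min_eq_right hs.2, min_eq_right ht.2, max_eq_right hs.1,
    max_eq_right ht.1]

/-- The tent and the clamps to `[0, 1]` in `bridgeKernel_eq`, on the four intervals cut out by
`0`, `1 / 2` and `1`. -/
lemma tent_clamp_cases (x : ℝ) :
    (tent x = 0 ∧ max 0 (min 1 x) = 0 ∧ max 0 (min 1 (2 * x)) = 0 ∧
      max 0 (min 1 (2 * x - 1)) = 0) ∨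
    (0 ≤ x ∧ x ≤ 1 / 2 ∧ tent x = x ∧ max 0 (min 1 x) = x ∧ max 0 (min 1 (2 * x)) = 2 * x ∧
      max 0 (min 1 (2 * x - 1)) = 0) ∨
    (1 / 2 ≤ x ∧ x ≤ 1 ∧ tent x = 1 - x ∧ max 0 (min 1 x) = x ∧ max 0 (min 1 (2 * x)) = 1 ∧
      max 0 (min 1 (2 * x - 1)) = 2 * x - 1) ∨
    (tent x = 0 ∧ max 0 (min 1 x) = 1 ∧ max 0 (min 1 (2 * x)) = 1 ∧
      max 0 (min 1 (2 * x - 1)) = 1) := by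
  unfold tent
  rcases le_total x 0 with h | h
  · left; grind
  rcases le_total x (1 / 2) with h1 | h1
  · right; left; grind
  rcases le_total x 1 with h2 | h2
  · right; right; left; grind
  · right; right; right; grind

/-- The self-similarity of the Brownian bridge: it is a multiple of the tent plus two independent
half-size bridges on the two halves of the interval. -/
lemma bridgeKernel_eq (s t : ℝ) : bridgeKernel s t = tent s * tent t +
    1 / 2 * (bridgeKernel (2 * s) (2 * t) + bridgeKernel (2 * s - 1) (2 * t - 1)) := by
  wlog hst : s ≤ t generalizing s t
  · have hsymm : ∀ x y, bridgeKernel x y = bridgeKernel y x := fun x y => by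
      rw [bridgeKernel, bridgeKernel, min_comm, mul_comm]
    rw [hsymm s, hsymm (2 * s), hsymm (2 * s - 1), mul_comm (tent s)]
    exact this t s (le_of_not_ge hst)
  have hmin : ∀ {x y : ℝ}, x ≤ y → bridgeKernel x y
      = max 0 (min 1 x) - max 0 (min 1 x) * max 0 (min 1 y) := fun {x y} hxy => by
    rw [bridgeKernel, min_eq_left (max_le_max le_rfl (min_le_min le_rfl hxy))]
  rw [hmin hst, hmin (by linarith : 2 * s ≤ 2 * t), hmin (by linarith : 2 * s - 1 ≤ 2 * t - 1)]
  rcases tent_clamp_cases s with ⟨a, b, c, d⟩ | ⟨-, -, a, b, c, d⟩ | ⟨-, -, a, b, c, d⟩ |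
      ⟨a, b, c, d⟩ <;>
    rcases tent_clamp_cases t with ⟨a', b', c', d'⟩ | ⟨-, -, a', b', c', d'⟩ |
      ⟨-, -, a', b', c', d'⟩ | ⟨a', b', c', d'⟩ <;>
    rw [a, b, c, d, a', b', c', d'] <;> ring

lemma abs_bridgeKernel_le (s t : ℝ) : |bridgeKernel s t| ≤ tent s := by
  have ht : 0 ≤ max 0 (min 1 t) ∧ max 0 (min 1 t) ≤ 1 :=
    ⟨le_max_left _ _, max_le zero_le_one (min_le_left _ _)⟩
  unfold bridgeKernel
  obtain ⟨h0, h1⟩ := ht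
  set c := max 0 (min 1 t)
  rw [abs_le]
  rcases tent_clamp_cases s with ⟨a, b, -, -⟩ | ⟨h, h', a, b, -, -⟩ | ⟨h, h', a, b, -, -⟩ |
      ⟨a, b, -, -⟩ <;>
    rw [a, b] <;> simp only [min_def] <;> split_ifs <;> constructor <;> nlinarith

/-- Indices of the Schauder system on `[0, 1]`: the linear function (`none`) and the tents over the
dyadic intervals `[k 2⁻ʲ, (k + 1) 2⁻ʲ]`. -/
abbrev SchauderIndex : Type := Option (Σ j : ℕ, Fin (2 ^ j))

/-- The Schauder functions: the primitives of the Haar functions. -/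
def schauder : SchauderIndex → ℝ → ℝ
  | none, x => x
  | some ⟨j, k⟩, x => (1 / √2) ^ j * tent (2 ^ j * x - (k : ℕ))

/-- The indices of the Schauder functions below level `n`. -/
def schauderLevels (n : ℕ) : Finset SchauderIndex :=
  Finset.insertNone ((Finset.range n).sigma fun _ => Finset.univ)

lemma sum_schauderLevels (n : ℕ) (f : SchauderIndex → ℝ) :
    ∑ i ∈ schauderLevels n, f i
      = f none + ∑ j ∈ Finset.range n, ∑ k : Fin (2 ^ j), f (some ⟨j, k⟩) := by
  rw [schauderLevels, Finset.sum_insertNone, Finset.sum_sigma]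

lemma bridgeKernel_eq_sum (n : ℕ) (s t : ℝ) : bridgeKernel s t =
    ∑ j ∈ Finset.range n, ∑ k : Fin (2 ^ j),
      schauder (some ⟨j, k⟩) s * schauder (some ⟨j, k⟩) t +
    (1 / 2) ^ n * ∑ k : Fin (2 ^ n), bridgeKernel (2 ^ n * s - (k : ℕ)) (2 ^ n * t - (k : ℕ)) := by
  have hdouble : ∀ (f : ℕ → ℝ) (N : ℕ),
      ∑ k ∈ Finset.range (N * 2), f k = ∑ k ∈ Finset.range N, (f (2 * k) + f (2 * k + 1)) := by
    intro f N
    induction N with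
    | zero => simp
    | succ N ih =>
      rw [Finset.sum_range_succ, ← ih, Nat.succ_mul, Finset.sum_range_succ, Finset.sum_range_succ,
        mul_comm N 2, add_assoc]
  induction n with
  | zero => simp
  | succ n ih =>
    rw [ih, Finset.sum_range_succ, add_assoc]
    congr 1
    have h1 : ∀ k : Fin (2 ^ n), schauder (some ⟨n, k⟩) s * schauder (some ⟨n, k⟩) t
        = (1 / 2) ^ n * (tent (2 ^ n * s - (k : ℕ)) * tent (2 ^ n * t - (k : ℕ))) := by
      intro k
      have : (1 / √2) ^ n * (1 / √2) ^ n = (1 / 2 : ℝ) ^ n := by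
        rw [← mul_pow, div_mul_div_comm, Real.mul_self_sqrt zero_le_two, one_mul]
      simp only [schauder]
      rw [← this]
      ring
    rw [Finset.sum_congr rfl fun k _ => h1 k, ← Finset.mul_sum,
      Fin.sum_univ_eq_sum_range fun k => bridgeKernel (2 ^ n * s - (k : ℕ)) (2 ^ n * t - (k : ℕ)),
      Fin.sum_univ_eq_sum_range fun k => tent (2 ^ n * s - (k : ℕ)) * tent (2 ^ n * t - (k : ℕ)),
      Fin.sum_univ_eq_sum_range
        fun k => bridgeKernel (2 ^ (n + 1) * s - (k : ℕ)) (2 ^ (n + 1) * t - (k : ℕ)),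
      pow_succ 2 n, hdouble, pow_succ (1 / 2 : ℝ) n, mul_assoc, ← mul_add]
    congr 1
    rw [Finset.mul_sum, ← Finset.sum_add_distrib]
    refine Finset.sum_congr rfl fun k _ => ?_
    rw [bridgeKernel_eq]
    push_cast
    congr 3 <;> congr 1 <;> ring

/-- Completeness of the Haar system, tested on indicators of intervals. -/
lemma tendsto_sum_schauder {s t : ℝ} (hs : s ∈ Icc (0 : ℝ) 1) (ht : t ∈ Icc (0 : ℝ) 1) :
    Tendsto (fun n => ∑ i ∈ schauderLevels n, schauder i s * schauder i t) atTop
      (𝓝 (min s t)) := by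
  have hlim : Tendsto (fun n : ℕ => (1 / 2 : ℝ) ^ n) atTop (𝓝 0) :=
    tendsto_pow_atTop_nhds_zero_of_lt_one (by norm_num) (by norm_num)
  refine tendsto_iff_norm_sub_tendsto_zero.2
    (squeeze_zero (fun _ => norm_nonneg _) (fun n => ?_) hlim)
  set r := ∑ k : Fin (2 ^ n), bridgeKernel (2 ^ n * s - (k : ℕ)) (2 ^ n * t - (k : ℕ)) with hr
  have h1 : ∑ i ∈ schauderLevels n, schauder i s * schauder i t - min s t
      = -((1 / 2) ^ n * r) := by
    have := bridgeKernel_eq_sum n s t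
    rw [bridgeKernel_of_mem hs ht] at this
    rw [sum_schauderLevels, hr]
    simp only [schauder] at this ⊢
    linarith
  have h2 : |r| ≤ 1 := (Finset.abs_sum_le_sum_abs _ _).trans
    ((Finset.sum_le_sum fun k _ => abs_bridgeKernel_le _ _).trans (sum_tent_le_one _ _))
  rw [h1, norm_neg, Real.norm_eq_abs, abs_mul, abs_of_nonneg (by positivity)]
  exact mul_le_of_le_one_right (by positivity) h2

/-! ### The Lévy–Ciesielski series -/

/-- The law of a family of independent standard Gaussian variables indexed by the Schauder
system. -/
def whiteNoise : Measure (SchauderIndex → ℝ) := Measure.infinitePi fun _ => gaussianReal 0 1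

instance instIsProbabilityMeasureWhiteNoise : IsProbabilityMeasure whiteNoise := by
  unfold whiteNoise; infer_instance

/-- The coefficient families `ω` with `∑ ((3 / 4) ^ j ω_{jk}) ^ 4 < ∞`. For these `|ω_{jk}|` is at
most a multiple of `(4 / 3) ^ j`; since `4 / 3 < √2`, the Schauder series then converges uniformly
by comparison with a geometric series. -/
def tameCoefficients : Set (SchauderIndex → ℝ) :=
  {ω | ∑' j : ℕ, ∑ k : Fin (2 ^ j), ENNReal.ofReal (((3 / 4) ^ j * ω (some ⟨j, k⟩)) ^ 4) < ⊤}

lemma measurableSet_tameCoefficients : MeasurableSet tameCoefficients := by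
  refine measurableSet_lt (Measurable.tsum fun j => ?_) measurable_const
  exact Finset.measurable_sum _ fun k _ => by fun_prop

/-- Finiteness of the fourth moment suffices: `2 ^ j` coefficients on level `j` contribute
`(2 * (3 / 4) ^ 4) ^ j`, a summable sequence. -/
lemma ae_mem_tameCoefficients : ∀ᵐ ω ∂whiteNoise, ω ∈ tameCoefficients := by
  have hm : ∀ j : ℕ, Measurable fun ω : SchauderIndex → ℝ =>
      ∑ k : Fin (2 ^ j), ENNReal.ofReal (((3 / 4) ^ j * ω (some ⟨j, k⟩)) ^ 4) := fun j =>
    Finset.measurable_sum _ fun k _ => by fun_prop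
  refine ae_lt_top (Measurable.tsum hm) (ne_of_lt ?_)
  rw [lintegral_tsum fun j => (hm j).aemeasurable]
  have hfin : ∫⁻ x : ℝ, ENNReal.ofReal (x ^ 4) ∂gaussianReal 0 1 < ⊤ := by
    have h4 : MemLp (id : ℝ → ℝ) 4 (gaussianReal 0 1) := memLp_id_gaussianReal' 4 (by simp)
    have := (h4.integrable_norm_pow (p := 4) (by norm_num)).lintegral_lt_top
    refine lt_of_eq_of_lt (lintegral_congr fun x => ?_) this
    congr 1
    simp only [id, Real.norm_eq_abs]
    exact (Even.pow_abs (by decide) x).symm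
  set M := ∫⁻ x : ℝ, ENNReal.ofReal (x ^ 4) ∂gaussianReal 0 1 with hM
  have hterm : ∀ j : ℕ, ∫⁻ ω, ∑ k : Fin (2 ^ j),
      ENNReal.ofReal (((3 / 4) ^ j * ω (some ⟨j, k⟩)) ^ 4) ∂whiteNoise
      = ENNReal.ofReal ((81 / 128) ^ j) * M := by
    intro j
    have hk : ∀ k : Fin (2 ^ j), ∫⁻ ω, ENNReal.ofReal (((3 / 4) ^ j * ω (some ⟨j, k⟩)) ^ 4)
        ∂whiteNoise = ENNReal.ofReal ((81 / 256) ^ j) * M := by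
      intro k
      have hp := measurePreserving_eval_infinitePi
        (fun _ : SchauderIndex => gaussianReal 0 1) (some ⟨j, k⟩)
      have e : ∀ x : ℝ, ENNReal.ofReal (((3 / 4) ^ j * x) ^ 4)
          = ENNReal.ofReal ((81 / 256) ^ j) * ENNReal.ofReal (x ^ 4) := fun x => by
        rw [← ENNReal.ofReal_mul (by positivity), mul_pow, ← pow_mul, mul_comm j 4, pow_mul]
        norm_num
      have := hp.lintegral_comp (f := fun x : ℝ => ENNReal.ofReal (((3 / 4) ^ j * x) ^ 4))
        (by fun_prop)
      rw [whiteNoise, this, hM, ← lintegral_const_mul _ (by fun_prop)]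
      exact lintegral_congr e
    rw [lintegral_finsetSum _ fun k _ => by fun_prop, Finset.sum_congr rfl fun k _ => hk k,
      Finset.sum_const, Finset.card_univ, Fintype.card_fin, nsmul_eq_mul, ← mul_assoc]
    congr 1
    have : ((2 ^ j : ℕ) : ENNReal) = ENNReal.ofReal (2 ^ j) := by
      rw [← ENNReal.ofReal_natCast]; norm_num
    rw [this, ← ENNReal.ofReal_mul (by positivity), ← mul_pow]
    norm_num
  simp_rw [hterm]
  rw [ENNReal.tsum_mul_right, ← ENNReal.ofReal_tsum_of_nonneg (fun j => by positivity)
    (summable_geometric_of_lt_one (by norm_num) (by norm_num))]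
  exact ENNReal.mul_lt_top ENNReal.ofReal_lt_top hfin

/-- The part of the Schauder series on the tents of level `j`. -/
def schauderBlock (j : ℕ) (x : ℝ) (ω : SchauderIndex → ℝ) : ℝ :=
  ∑ k : Fin (2 ^ j), schauder (some ⟨j, k⟩) x * ω (some ⟨j, k⟩)

lemma continuous_schauder (i : SchauderIndex) : Continuous (schauder i) := by
  rcases i with _ | ⟨j, k⟩
  · exact continuous_id
  · change Continuous fun x : ℝ => (1 / √2) ^ j * tent (2 ^ j * x - (k : ℕ))
    fun_prop

lemma exists_schauderBlock_bound {ω : SchauderIndex → ℝ} (hω : ω ∈ tameCoefficients) :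
    ∃ u : ℕ → ℝ, Summable u ∧ ∀ j x, ‖schauderBlock j x ω‖ ≤ u j := by
  set C := (∑' j : ℕ, ∑ k : Fin (2 ^ j),
    ENNReal.ofReal (((3 / 4) ^ j * ω (some ⟨j, k⟩)) ^ 4)).toReal with hC
  have hC0 : 0 ≤ C := ENNReal.toReal_nonneg
  have hcoef : ∀ (j : ℕ) (k : Fin (2 ^ j)), |ω (some ⟨j, k⟩)| ≤ (4 / 3) ^ j * (1 + C) := by
    intro j k
    have h1 : ENNReal.ofReal (((3 / 4) ^ j * ω (some ⟨j, k⟩)) ^ 4)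
        ≤ ∑' j : ℕ, ∑ k : Fin (2 ^ j), ENNReal.ofReal (((3 / 4) ^ j * ω (some ⟨j, k⟩)) ^ 4) :=
      (Finset.single_le_sum (f := fun k : Fin (2 ^ j) =>
        ENNReal.ofReal (((3 / 4) ^ j * ω (some ⟨j, k⟩)) ^ 4)) (fun _ _ => zero_le)
        (Finset.mem_univ k)).trans (ENNReal.le_tsum j)
    have h2 : ((3 / 4) ^ j * ω (some ⟨j, k⟩)) ^ 4 ≤ C :=
      (ENNReal.ofReal_le_iff_le_toReal hω.ne).1 h1
    set y := |(3 / 4) ^ j * ω (some ⟨j, k⟩)| with hy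
    have h3 : y ^ 4 ≤ C := by rw [hy, Even.pow_abs (by decide)]; exact h2
    have h4 : y ≤ 1 + C := by
      by_contra! hlt
      have h5 : (1 : ℝ) ≤ y := by linarith
      have h6 : y ≤ y ^ 4 := le_self_pow₀ h5 (by norm_num)
      linarith
    have h7 : |ω (some ⟨j, k⟩)| = (4 / 3) ^ j * y := by
      rw [hy, abs_mul, abs_of_nonneg (by positivity : (0 : ℝ) ≤ (3 / 4) ^ j), ← mul_assoc, ← mul_pow]
      norm_num
    rw [h7]
    gcongr
  refine ⟨fun j => (1 / √2 * (4 / 3)) ^ j * (1 + C), Summable.mul_right _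
    (summable_geometric_of_lt_one (by positivity) ?_), fun j x => ?_⟩
  · have h2 : (4 / 3 : ℝ) < √2 := Real.lt_sqrt_of_sq_lt (by norm_num)
    rw [one_div, inv_mul_lt_one₀ (by positivity)]
    exact h2
  · rw [Real.norm_eq_abs, schauderBlock]
    calc |∑ k : Fin (2 ^ j), schauder (some ⟨j, k⟩) x * ω (some ⟨j, k⟩)|
        ≤ ∑ k : Fin (2 ^ j), |schauder (some ⟨j, k⟩) x * ω (some ⟨j, k⟩)| :=
          Finset.abs_sum_le_sum_abs _ _
      _ ≤ ∑ k : Fin (2 ^ j),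
          (1 / √2) ^ j * ((4 / 3) ^ j * (1 + C)) * tent (2 ^ j * x - (k : ℕ)) := by
          refine Finset.sum_le_sum fun k _ => ?_
          rw [abs_mul, schauder, abs_mul, abs_of_nonneg (by positivity : 0 ≤ (1 / √2) ^ j),
            abs_of_nonneg (tent_nonneg _)]
          have := mul_le_mul_of_nonneg_left (hcoef j k)
            (mul_nonneg (by positivity : 0 ≤ (1 / √2) ^ j) (tent_nonneg (2 ^ j * x - (k : ℕ))))
          linarith
      _ ≤ (1 / √2) ^ j * ((4 / 3) ^ j * (1 + C)) := by
          rw [← Finset.mul_sum]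
          exact mul_le_of_le_one_right (by positivity) (sum_tent_le_one _ _)
      _ = (1 / √2 * (4 / 3)) ^ j * (1 + C) := by rw [mul_pow]; ring

/-- The Lévy–Ciesielski series, set to zero where it is not known to converge. -/
def levySeries (x : ℝ) : (SchauderIndex → ℝ) → ℝ :=
  tameCoefficients.indicator fun ω => x * ω none + ∑' j, schauderBlock j x ω

lemma continuous_levySeries (ω : SchauderIndex → ℝ) : Continuous fun x => levySeries x ω := by
  by_cases hω : ω ∈ tameCoefficients
  · obtain ⟨u, hu, hbound⟩ := exists_schauderBlock_bound hω
    simp only [levySeries, indicator_of_mem hω]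
    refine (continuous_id.mul continuous_const).add (continuous_tsum (fun j => ?_) hu hbound)
    exact continuous_finsetSum _ fun k _ => (continuous_schauder _).mul continuous_const
  · simp only [levySeries, indicator_of_notMem hω]
    exact continuous_const

lemma tendsto_levySeries {ω : SchauderIndex → ℝ} (hω : ω ∈ tameCoefficients) (x : ℝ) :
    Tendsto (fun n => ∑ i ∈ schauderLevels n, schauder i x * ω i) atTop
      (𝓝 (levySeries x ω)) := by
  obtain ⟨u, hu, hbound⟩ := exists_schauderBlock_bound hω
  have hs : Summable fun j => schauderBlock j x ω := hu.of_norm_bounded fun j => hbound j x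
  simp only [sum_schauderLevels, levySeries, indicator_of_mem hω]
  exact hs.hasSum.tendsto_sum_nat.const_add _

lemma measurable_levySeries (x : ℝ) : Measurable (levySeries x) := by
  refine measurable_of_tendsto_metrizable (f := fun n => tameCoefficients.indicator
    fun ω => ∑ i ∈ schauderLevels n, schauder i x * ω i) (fun n => ?_) ?_
  · exact Measurable.indicator (by fun_prop) measurableSet_tameCoefficients
  · rw [tendsto_pi_nhds]
    intro ω
    by_cases hω : ω ∈ tameCoefficients
    · simpa only [indicator_of_mem hω] using tendsto_levySeries hω x
    · simp only [levySeries, indicator_of_notMem hω]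
      exact tendsto_const_nhds

/-! ### Gaussian laws of the series -/

lemma map_eq_gaussianReal_of_tendsto {Ω : Type*} {mΩ : MeasurableSpace Ω} {P : Measure Ω}
    [IsProbabilityMeasure P] {X : ℕ → Ω → ℝ} {Y : Ω → ℝ} {v : ℕ → NNReal} {w : NNReal}
    (hX : ∀ n, Measurable (X n)) (hY : Measurable Y)
    (hlaw : ∀ n, P.map (X n) = gaussianReal 0 (v n))
    (hlim : ∀ᵐ ω ∂P, Tendsto (fun n => X n ω) atTop (𝓝 (Y ω)))
    (hv : Tendsto v atTop (𝓝 w)) : P.map Y = gaussianReal 0 w := by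
  have := Measure.isProbabilityMeasure_map (μ := P) hY.aemeasurable
  refine Measure.ext_of_charFun (funext fun t => ?_)
  have hint : ∀ {U : Ω → ℝ}, Measurable U →
      charFun (P.map U) t = ∫ ω, Complex.exp (t * U ω * Complex.I) ∂P := by
    intro U hU
    rw [charFun_apply_real, integral_map hU.aemeasurable (by fun_prop)]
  have h1 : Tendsto (fun n => charFun (P.map (X n)) t) atTop (𝓝 (charFun (P.map Y) t)) := by
    simp only [hint (hX _), hint hY]
    refine tendsto_integral_of_dominated_convergence (fun _ => 1) (fun n => ?_)
      (integrable_const _) (fun n => Eventually.of_forall fun ω => ?_) ?_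
    · have := hX n
      exact Measurable.aestronglyMeasurable (by fun_prop)
    · rw [← Complex.ofReal_mul, Complex.norm_exp_ofReal_mul_I]
    · filter_upwards [hlim] with ω hω
      have hc : Continuous fun x : ℝ => Complex.exp (t * x * Complex.I) := by fun_prop
      exact (hc.tendsto _).comp hω
  have h2 : Tendsto (fun n => charFun (P.map (X n)) t) atTop
      (𝓝 (charFun (gaussianReal 0 w) t)) := by
    simp only [hlaw, charFun_gaussianReal]
    have hc : Continuous fun y : NNReal =>
        Complex.exp (t * ((0 : ℝ) : ℂ) * Complex.I - ((y : ℝ) : ℂ) * t ^ 2 / 2) := by fun_prop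
    exact (hc.tendsto w).comp hv
  exact tendsto_nhds_unique h1 h2

lemma map_sum_whiteNoise (F : Finset SchauderIndex) (a : SchauderIndex → ℝ) :
    whiteNoise.map (fun ω => ∑ i ∈ F, a i * ω i)
      = gaussianReal 0 (∑ i ∈ F, Real.toNNReal (a i ^ 2)) := by
  have hind : iIndepFun (fun i (ω : SchauderIndex → ℝ) => a i * ω i) whiteNoise :=
    iIndepFun_infinitePi (P := fun _ : SchauderIndex => gaussianReal 0 1)
      (X := fun i x => a i * x) (fun i => by fun_prop)
  have hlaw : ∀ i, whiteNoise.map (fun ω => a i * ω i)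
      = gaussianReal 0 (Real.toNNReal (a i ^ 2)) := by
    intro i
    have hp : whiteNoise.map (fun ω => ω i) = gaussianReal 0 1 :=
      (measurePreserving_eval_infinitePi (fun _ : SchauderIndex => gaussianReal 0 1) i).map_eq
    have e : (fun ω : SchauderIndex → ℝ => a i * ω i) = (fun x => a i * x) ∘ fun ω => ω i := rfl
    rw [e, ← Measure.map_map (by fun_prop) (by fun_prop), hp, gaussianReal_map_const_mul]
    congr 1
    · simp
    · rw [mul_one]
      ext
      simp [Real.toNNReal, sq_nonneg]
  classical
  induction F using Finset.induction_on with
  | empty => simp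
  | insert i F hi ih =>
    simp only [Finset.sum_insert hi]
    have h1 : IndepFun (fun ω : SchauderIndex → ℝ => a i * ω i)
        (fun ω => ∑ j ∈ F, a j * ω j) whiteNoise := by
      have := (hind.indepFun_finsetSum_of_notMem (fun j => by fun_prop) hi).symm
      convert this using 1
      ext ω
      simp
    have h2 := gaussianReal_add_gaussianReal_of_indepFun h1 (hlaw i) ih
    simpa [Pi.add_def] using h2

lemma map_sum_levySeries {ι : Type*} (I : Finset ι) (c x : ι → ℝ)
    (hx : ∀ m ∈ I, x m ∈ Icc (0 : ℝ) 1) :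
    whiteNoise.map (fun ω => ∑ m ∈ I, c m * levySeries (x m) ω)
      = gaussianReal 0 (Real.toNNReal (∑ m ∈ I, ∑ l ∈ I, c m * c l * min (x m) (x l))) := by
  set a : SchauderIndex → ℝ := fun i => ∑ m ∈ I, c m * schauder i (x m) with ha
  refine map_eq_gaussianReal_of_tendsto
    (X := fun n ω => ∑ i ∈ schauderLevels n, a i * ω i)
    (v := fun n => ∑ i ∈ schauderLevels n, Real.toNNReal (a i ^ 2))
    (fun n => by fun_prop) ?_ (fun n => map_sum_whiteNoise _ _) ?_ ?_
  · exact Finset.measurable_sum _ fun m _ => (measurable_levySeries _).const_mul _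
  · filter_upwards [ae_mem_tameCoefficients] with ω hω
    have h := tendsto_finsetSum I fun m _ => (tendsto_levySeries hω (x m)).const_mul (c m)
    refine h.congr fun n => ?_
    simp only [ha, Finset.sum_mul, Finset.mul_sum]
    rw [Finset.sum_comm]
    exact Finset.sum_congr rfl fun i _ => Finset.sum_congr rfl fun m _ => by ring
  · have h : Tendsto (fun n => ∑ m ∈ I, ∑ l ∈ I,
        c m * c l * ∑ i ∈ schauderLevels n, schauder i (x m) * schauder i (x l)) atTop
        (𝓝 (∑ m ∈ I, ∑ l ∈ I, c m * c l * min (x m) (x l))) :=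
      tendsto_finsetSum _ fun m hm => tendsto_finsetSum _ fun l hl =>
        (tendsto_sum_schauder (hx m hm) (hx l hl)).const_mul _
    refine ((continuous_real_toNNReal.tendsto _).comp h).congr fun n => ?_
    rw [Function.comp_apply, ← Real.toNNReal_sum_of_nonneg fun i _ => sq_nonneg _]
    congr 1
    have hsq : ∀ i, a i ^ 2
        = ∑ m ∈ I, ∑ l ∈ I, c m * c l * (schauder i (x m) * schauder i (x l)) := fun i => by
      rw [sq, ha, Finset.sum_mul_sum]
      exact Finset.sum_congr rfl fun m _ => Finset.sum_congr rfl fun l _ => by ring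
    simp only [hsq, Finset.mul_sum]
    symm
    rw [Finset.sum_comm]
    refine Finset.sum_congr rfl fun m _ => ?_
    rw [Finset.sum_comm]

/-! ### Brownian motion and the inputs -/

/-- Brownian motion on `[0, T]` over white noise, by Brownian scaling from `[0, 1]`. -/
def brownianPath (T : ℝ) (t : TimeInterval T) (ω : SchauderIndex → ℝ) : ℝ :=
  √T * levySeries (t / T) ω

lemma continuous_brownianPath (ω : SchauderIndex → ℝ) :
    Continuous fun t : TimeInterval T => brownianPath T t ω :=
  continuous_const.mul ((continuous_levySeries ω).comp
    (continuous_subtype_val.div_const T))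

lemma measurable_brownianPath (t : TimeInterval T) : Measurable (brownianPath T t) :=
  (measurable_levySeries _).const_mul _

/-- All finite linear combinations are centered Gaussian, with covariance kernel `min s t`. -/
lemma map_sum_brownianPath (hT : 0 < T) {ι : Type*} (I : Finset ι) (c : ι → ℝ)
    (t : ι → TimeInterval T) :
    whiteNoise.map (fun ω => ∑ m ∈ I, c m * brownianPath T (t m) ω)
      = gaussianReal 0 (Real.toNNReal
        (∑ m ∈ I, ∑ l ∈ I, c m * c l * min (t m : ℝ) (t l))) := by
  have h := map_sum_levySeries I (fun m => c m * √T) (fun m => (t m : ℝ) / T)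
    fun m _ => ⟨div_nonneg (t m).2.1 hT.le, (div_le_one hT).2 (t m).2.2⟩
  simp only [brownianPath, ← mul_assoc]
  rw [h]
  congr 2
  refine Finset.sum_congr rfl fun m _ => Finset.sum_congr rfl fun l _ => ?_
  rw [min_div_div_right hT.le]
  have : √T * √T = T := Real.mul_self_sqrt hT.le
  calc c m * √T * (c l * √T) * (min (t m : ℝ) (t l) / T)
      = c m * c l * min (t m : ℝ) (t l) * ((√T * √T) / T) := by ring
    _ = c m * c l * min (t m : ℝ) (t l) := by rw [this, div_self hT.ne', mul_one]

lemma isGaussianProcess_brownianPath (hT : 0 < T) :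
    IsGaussianProcess (brownianPath T) whiteNoise where
  hasGaussianLaw I := by
    refine ⟨isGaussian_of_map_eq_gaussianReal fun L => ?_⟩
    have hm : Measurable fun ω => I.restrict (fun t => brownianPath T t ω) :=
      measurable_pi_lambda _ fun t => measurable_brownianPath _
    classical
    have h := map_sum_brownianPath hT Finset.univ (fun i : I => L (Pi.single i 1))
      (fun i : I => (i : TimeInterval T))
    refine ⟨0, _, Eq.trans ?_ h⟩
    rw [Measure.map_map (by fun_prop) hm]
    congr 1
    funext ω
    rw [Function.comp_apply]
    conv_lhs => rw [← Finset.univ_sum_single (I.restrict fun t => brownianPath T t ω), map_sum]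
    refine Finset.sum_congr rfl fun i _ => ?_
    rw [mul_comm, ← smul_eq_mul, ← map_smul, ← Pi.single_smul]
    simp

lemma hasLaw_brownianPath_sub (hT : 0 < T) {s t : TimeInterval T} (hst : s ≤ t) :
    HasLaw (fun ω => brownianPath T t ω - brownianPath T s ω)
      (gaussianReal 0 (Real.toNNReal ((t : ℝ) - s))) whiteNoise where
  aemeasurable := ((measurable_brownianPath t).sub (measurable_brownianPath s)).aemeasurable
  map_eq := by
    have h := map_sum_brownianPath hT Finset.univ ![1, -1] ![t, s]
    have hst' : (s : ℝ) ≤ t := hst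
    simp only [Fin.sum_univ_two, Matrix.cons_val_zero, Matrix.cons_val_one, min_self,
      min_eq_left hst', min_eq_right hst'] at h
    convert h using 2
    · funext ω; ring
    · congr 1; ring

lemma hasLaw_brownianPath (hT : 0 < T) (t : TimeInterval T) :
    HasLaw (brownianPath T t) (gaussianReal 0 (Real.toNNReal t)) whiteNoise where
  aemeasurable := (measurable_brownianPath t).aemeasurable
  map_eq := by
    simpa using map_sum_brownianPath hT {()} (fun _ => 1) (fun _ => t)

lemma covariance_brownianPath (hT : 0 < T) {s t : TimeInterval T} (hst : s ≤ t) :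
    cov[brownianPath T s, brownianPath T t; whiteNoise] = s := by
  have hL : ∀ r, MemLp (brownianPath T r) 2 whiteNoise := fun r =>
    ((isGaussianProcess_brownianPath hT).hasGaussianLaw_eval r).memLp_two
  have hv : ∀ r : TimeInterval T, Var[brownianPath T r; whiteNoise] = r := fun r => by
    rw [(hasLaw_brownianPath hT r).variance_eq, variance_id_gaussianReal,
      Real.coe_toNNReal _ r.2.1]
  have h := variance_fun_sub (hL t) (hL s)
  have hst' : (s : ℝ) ≤ t := hst
  rw [(hasLaw_brownianPath_sub hT hst).variance_eq, variance_id_gaussianReal, hv, hv,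
    Real.coe_toNNReal _ (sub_nonneg.2 hst'), covariance_comm] at h
  linarith

/-- Jointly Gaussian and uncorrelated, hence independent. -/
lemma indepFun_brownianPath_sub (hT : 0 < T) {s t : TimeInterval T} (hst : s ≤ t) :
    IndepFun (fun ω => brownianPath T t ω - brownianPath T s ω)
      (fun ω (r : Iic s) => brownianPath T r ω) whiteNoise := by
  have hB := isGaussianProcess_brownianPath hT
  have hL : ∀ r, MemLp (brownianPath T r) 2 whiteNoise := fun r =>
    (hB.hasGaussianLaw_eval r).memLp_two
  have h : IndepFun (fun ω (_ : Unit) => brownianPath T t ω - brownianPath T s ω)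
      (fun ω (r : Iic s) => brownianPath T r ω) whiteNoise := by
    refine IsGaussianProcess.indepFun_of_covariance_eq_zero
      (X := fun (_ : Unit) ω => brownianPath T t ω - brownianPath T s ω)
      (Y := fun (r : Iic s) => brownianPath T r) ?_
      (fun _ => ((measurable_brownianPath t).sub (measurable_brownianPath s)).aemeasurable)
      (fun r => (measurable_brownianPath _).aemeasurable) ?_
    · classical
      refine hB.of_isGaussianProcess ?_
      rintro (_ | r)
      · exact ⟨{s, t},
          { toFun x := x ⟨t, by simp⟩ - x ⟨s, by simp⟩
            map_add' x y := by simp; abel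
            map_smul' c x := by simp; ring }, by simp⟩
      · exact ⟨{(r : TimeInterval T)},
          { toFun x := x ⟨r, by simp⟩
            map_add' x y := by simp
            map_smul' c x := by simp }, by simp⟩
    · rintro - ⟨r, hr : r ≤ s⟩
      rw [covariance_fun_sub_left (hL t) (hL s) (hL r), covariance_comm,
        covariance_brownianPath hT (hr.trans hst), covariance_comm,
        covariance_brownianPath hT hr, sub_self]
  exact h.comp (measurable_pi_apply ()) measurable_id

/-- Independence is not affected by enlarging the probability space to a product. -/
lemma indepFun_comp_fst {Ω Ω' β γ : Type*} {mΩ : MeasurableSpace Ω} {mΩ' : MeasurableSpace Ω'}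
    {mβ : MeasurableSpace β} {mγ : MeasurableSpace γ} {μ : Measure Ω} {ν : Measure Ω'}
    [SFinite μ] [IsProbabilityMeasure ν] {f : Ω → β} {g : Ω → γ} (h : IndepFun f g μ)
    (hf : Measurable f) (hg : Measurable g) :
    IndepFun (fun ω : Ω × Ω' => f ω.1) (fun ω => g ω.1) (μ.prod ν) := by
  have hp : MeasurePreserving Prod.fst (μ.prod ν) μ := measurePreserving_fst
  rw [indepFun_iff_measure_inter_preimage_eq_mul] at h ⊢
  intro s t hs ht
  have := h s t hs ht
  rw [← hp.measure_preimage ((hf hs).inter (hg ht)).nullMeasurableSet,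
    ← hp.measure_preimage (hf hs).nullMeasurableSet,
    ← hp.measure_preimage (hg ht).nullMeasurableSet] at this
  exact this

/-- The product of white noise, the initial law and an exponential clock carries inputs. -/
theorem exists_isInput (hT : 0 < T) {ρ₀ : ℝ → ℝ} (hρ₀ : IsInitialDensity ρ₀) :
    ∃ (Ω : Type) (mΩ : MeasurableSpace Ω) (P : Measure Ω) (_ : IsProbabilityMeasure P)
      (𝓕 : Filtration (TimeInterval T) mΩ) (W : TimeInterval T → Ω → ℝ) (X₀ Z : Ω → ℝ),
      IsInput ρ₀ P 𝓕 W X₀ Z := by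
  have := hρ₀.isProbabilityMeasure
  have : IsProbabilityMeasure (expMeasure 1) := isProbabilityMeasure_expMeasure one_pos
  set N := (SchauderIndex → ℝ)
  set W : TimeInterval T → (N × ℝ) × ℝ → ℝ := fun t ω => brownianPath T t ω.1.1 with hW
  set X₀ : (N × ℝ) × ℝ → ℝ := fun ω => ω.1.2 with hX₀
  set P : Measure ((N × ℝ) × ℝ) := (whiteNoise.prod (initialLaw ρ₀)).prod (expMeasure 1) with hP
  have hWm : ∀ t, Measurable (W t) := fun t =>
    (measurable_brownianPath t).comp (measurable_fst.comp measurable_fst)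
  have hXm : Measurable X₀ := measurable_snd.comp measurable_fst
  have hp1 : MeasurePreserving Prod.fst P (whiteNoise.prod (initialLaw ρ₀)) :=
    measurePreserving_fst
  have hpN : MeasurePreserving (fun ω : (N × ℝ) × ℝ => ω.1.1) P whiteNoise :=
    MeasurePreserving.comp measurePreserving_fst hp1
  let 𝓕 : Filtration (TimeInterval T) (inferInstance : MeasurableSpace ((N × ℝ) × ℝ)) :=
    { seq := fun t => (⨆ r ≤ t, MeasurableSpace.comap (W r) inferInstance) ⊔
        MeasurableSpace.comap X₀ inferInstance
      mono' := fun s t hst => sup_le_sup_right (iSup₂_le fun r hr =>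
        le_iSup₂_of_le (f := fun r (_ : r ≤ t) => MeasurableSpace.comap (W r) inferInstance)
          r (hr.trans hst) le_rfl) _
      le' := fun t => sup_le (iSup₂_le fun r _ => (hWm r).comap_le) hXm.comap_le }
  refine ⟨(N × ℝ) × ℝ, inferInstance, P, inferInstance, 𝓕, W, X₀, Prod.snd, ?_⟩
  refine
    { brownian :=
        { adapted := fun t => measurable_iff_comap_le.2 (le_sup_of_le_left
            (le_iSup₂_of_le (f := fun r (_ : r ≤ t) => MeasurableSpace.comap (W r) inferInstance)
              t le_rfl le_rfl))
          start := fun t ht => ?_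
          increment_law := fun s t hst => (hasLaw_brownianPath_sub hT hst).comp hpN.hasLaw
          increment_indep := fun s t hst => ?_
          continuous_paths := Eventually.of_forall fun ω => continuous_brownianPath ω.1.1 }
      initial_measurable := fun t _ => measurable_iff_comap_le.2 le_sup_right
      initial_law := (MeasurePreserving.comp measurePreserving_snd hp1).hasLaw
      clock_measurable := measurable_snd
      clock_law := measurePreserving_snd.hasLaw
      clock_indep := ?_ }
  · have h := (hasLaw_brownianPath hT t).comp hpN.hasLaw
    rw [ht, Real.toNNReal_zero, gaussianReal_zero_var] at h
    exact h.ae_eq_of_dirac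
  · set d := MeasurableSpace.comap (fun ω => W t ω - W s ω) inferInstance with hd
    set h := ⨆ r ≤ s, MeasurableSpace.comap (W r) inferInstance with hh
    have hdW : Measurable fun ω : N => brownianPath T t ω - brownianPath T s ω :=
      (measurable_brownianPath t).sub (measurable_brownianPath s)
    have hpast : Measurable fun (ω : N) (r : Iic s) => brownianPath T r ω :=
      measurable_pi_lambda _ fun r => measurable_brownianPath _
    have h1 : Indep d h P := by
      have := indepFun_comp_fst (ν := expMeasure 1) (indepFun_comp_fst (ν := initialLaw ρ₀)
        (indepFun_brownianPath_sub hT hst) hdW hpast)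
        (hdW.comp measurable_fst) (hpast.comp measurable_fst)
      rw [IndepFun_iff_Indep] at this
      refine indep_of_indep_of_le_right this (iSup₂_le fun r hr => ?_)
      have mpast : Measurable[MeasurableSpace.comap (fun (ω : (N × ℝ) × ℝ) (r : Iic s) =>
          brownianPath T r ω.1.1) inferInstance]
        (fun (ω : (N × ℝ) × ℝ) (r : Iic s) => brownianPath T r ω.1.1) := comap_measurable _
      exact measurable_iff_comap_le.1 ((measurable_pi_apply (⟨r, hr⟩ : Iic s)).comp mpast)
    have h2 : Indep (d ⊔ h) (MeasurableSpace.comap X₀ inferInstance) P := by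
      have := indepFun_comp_fst (ν := expMeasure 1) (indepFun_prod (μ := whiteNoise)
        (ν := initialLaw ρ₀) (X := id) (Y := id) measurable_id measurable_id)
        measurable_fst measurable_snd
      rw [IndepFun_iff_Indep] at this
      have mN : Measurable[MeasurableSpace.comap (fun ω : (N × ℝ) × ℝ => ω.1.1) inferInstance]
        (fun ω : (N × ℝ) × ℝ => ω.1.1) := comap_measurable _
      refine indep_of_indep_of_le_left this (sup_le ?_ (iSup₂_le fun r _ => ?_))
      · exact measurable_iff_comap_le.1 (hdW.comp mN)
      · exact measurable_iff_comap_le.1 ((measurable_brownianPath r).comp mN)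
    exact indep_sup_right ((hWm t).sub (hWm s)).comap_le
      (iSup₂_le fun r _ => (hWm r).comap_le) hXm.comap_le h1 h2
  · have hm : Measurable fun ω : N × ℝ => (ω.2, fun t => brownianPath T t ω.1) :=
      measurable_snd.prodMk (measurable_pi_lambda _ fun t =>
        (measurable_brownianPath t).comp measurable_fst)
    exact (indepFun_prod (μ := whiteNoise.prod (initialLaw ρ₀)) (ν := expMeasure 1)
      hm measurable_id).symm

/-! ### Uniqueness -/

section Uniqueness

variable {Ω : Type*} {mΩ : MeasurableSpace Ω} {P : Measure Ω} [IsProbabilityMeasure P]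
  {ρ₀ : ℝ → ℝ} {𝔐 : Model} {𝓕 𝓕' : Filtration (TimeInterval T) mΩ} {W : TimeInterval T → Ω → ℝ}
  {X₀ Z : Ω → ℝ} {X X' : TimeInterval T → Ω → State} {τ τ' : Ω → WithTop (TimeInterval T)}

/-- Pathwise uniqueness: both solutions are the image of the same driving path and clock. -/
theorem IsSolution.ae_eq (hT : 0 ≤ T) (h𝔐 : 𝔐.Admissible)
    (hsol : IsSolution 𝔐 ρ₀ P 𝓕 W X₀ Z X τ) (hsol' : IsSolution 𝔐 ρ₀ P 𝓕' W X₀ Z X' τ') :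
    ∀ᵐ ω ∂P, τ ω = τ' ω ∧ ∀ t, X t ω = X' t ω := by
  obtain ⟨G, hG, -⟩ := hsol.input.exists_isDrivingPath hT
  have := Measure.isProbabilityMeasure_map (μ := P) hG.measurable.aemeasurable
  obtain ⟨V, hV, -⟩ := existsUnique_isMcKeanFlow h𝔐 hT (P.map G)
  filter_upwards [hsol.eq_flowState hT h𝔐 hG hV, hsol'.eq_flowState hT h𝔐 hG hV] with ω h h'
  refine ⟨?_, fun t => (h t).2.trans (h' t).2.symm⟩
  have hlt : ∀ t : TimeInterval T, (t : WithTop (TimeInterval T)) < τ ω ↔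
      (t : WithTop (TimeInterval T)) < τ' ω := fun t => (h t).1.trans (h' t).1.symm
  refine le_antisymm (le_of_not_gt fun hgt => ?_) (le_of_not_gt fun hgt => ?_)
  · obtain ⟨a, ha⟩ := WithTop.ne_top_iff_exists.1 hgt.ne_top
    rw [← ha] at hgt
    exact absurd ((hlt a).1 hgt) (by rw [← ha]; exact lt_irrefl _)
  · obtain ⟨a, ha⟩ := WithTop.ne_top_iff_exists.1 hgt.ne_top
    rw [← ha] at hgt
    exact absurd ((hlt a).2 hgt) (by rw [← ha]; exact lt_irrefl _)

/-- The law of a solution is the image of the law of the driving path and an independent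
exponential clock under a map determined by the law of the driving path. -/
lemma IsSolution.pathLaw_eq (hT : 0 ≤ T) (h𝔐 : 𝔐.Admissible)
    (hsol : IsSolution 𝔐 ρ₀ P 𝓕 W X₀ Z X τ) {G : Ω → Path T} (hG : IsDrivingPath P W X₀ G)
    {V : (Path T × TimeInterval T) →ᵇ ℝ × ℝ}
    (hV : IsMcKeanFlow 𝔐 (P.map G) V) :
    pathLaw P X = ((P.map G).prod (expMeasure 1)).map (fun z t => flowState V z.1 z.2 t) := by
  have hZ := hsol.input.clock_measurable
  have hm : Measurable fun (z : Path T × ℝ) t => flowState V z.1 z.2 t := by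
    refine measurable_pi_lambda _ fun t => measurable_flowState (G := Prod.fst) ?_ measurable_snd
    exact ((measurable_path_eval t).comp measurable_fst).prodMk
      ((V.continuous.comp (by fun_prop : Continuous fun g : Path T => (g, t))).measurable.comp
        measurable_fst)
  have hlaw : P.map (fun ω => (G ω, Z ω)) = (P.map G).prod (expMeasure 1) := by
    rw [(indepFun_iff_map_prod_eq_prod_map_map hG.measurable.aemeasurable hZ.aemeasurable).1
      (hG.indepFun hsol.input), hsol.input.clock_law.map_eq]
  rw [← hlaw, Measure.map_map hm (hG.measurable.prodMk hZ), pathLaw]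
  refine Measure.map_congr ?_
  filter_upwards [hsol.eq_flowState hT h𝔐 hG hV] with ω h
  exact funext fun t => (h t).2

end Uniqueness

end

end KilledMcKeanVlasov

theorem theorem2p5 (T : ℝ) (hT : 0 < T) (𝔐 : Model) (h𝔐 : 𝔐.Admissible)
    (ρ₀ : ℝ → ℝ) (hρ₀ : IsInitialDensity ρ₀) :
    -- existence of a strong solution, on every probability space carrying the inputs
    (∀ (Ω : Type u) (mΩ : MeasurableSpace Ω) (P : Measure Ω) (_ : IsProbabilityMeasure P)
      (𝓕 : Filtration (TimeInterval T) mΩ) (W : TimeInterval T → Ω → ℝ) (X₀ Z : Ω → ℝ),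
      IsInput ρ₀ P 𝓕 W X₀ Z →
      ∃ (X : TimeInterval T → Ω → State) (τ : Ω → WithTop (TimeInterval T)),
        IsStrongSolution 𝔐 ρ₀ P W X₀ Z X τ) ∧
    -- pathwise uniqueness
    (∀ (Ω : Type u) (mΩ : MeasurableSpace Ω) (P : Measure Ω) (_ : IsProbabilityMeasure P)
      (𝓕 𝓕' : Filtration (TimeInterval T) mΩ) (W : TimeInterval T → Ω → ℝ) (X₀ Z : Ω → ℝ)
      (X X' : TimeInterval T → Ω → State) (τ τ' : Ω → WithTop (TimeInterval T)),
      IsSolution 𝔐 ρ₀ P 𝓕 W X₀ Z X τ → IsSolution 𝔐 ρ₀ P 𝓕' W X₀ Z X' τ' →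
      ∀ᵐ ω ∂P, τ ω = τ' ω ∧ ∀ t, X t ω = X' t ω) ∧
    -- existence of a weak solution
    (∃ (Ω : Type) (mΩ : MeasurableSpace Ω) (P : Measure Ω) (_ : IsProbabilityMeasure P)
      (𝓕 : Filtration (TimeInterval T) mΩ) (W : TimeInterval T → Ω → ℝ) (X₀ Z : Ω → ℝ)
      (X : TimeInterval T → Ω → State) (τ : Ω → WithTop (TimeInterval T)),
      IsSolution 𝔐 ρ₀ P 𝓕 W X₀ Z X τ) ∧
    -- uniqueness in law
    (∀ (Ω : Type u) (mΩ : MeasurableSpace Ω) (P : Measure Ω) (_ : IsProbabilityMeasure P)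
      (𝓕 : Filtration (TimeInterval T) mΩ) (W : TimeInterval T → Ω → ℝ) (X₀ Z : Ω → ℝ)
      (X : TimeInterval T → Ω → State) (τ : Ω → WithTop (TimeInterval T))
      (Ω' : Type v) (mΩ' : MeasurableSpace Ω') (P' : Measure Ω') (_ : IsProbabilityMeasure P')
      (𝓕' : Filtration (TimeInterval T) mΩ') (W' : TimeInterval T → Ω' → ℝ) (X₀' Z' : Ω' → ℝ)
      (X' : TimeInterval T → Ω' → State) (τ' : Ω' → WithTop (TimeInterval T)),
      IsSolution 𝔐 ρ₀ P 𝓕 W X₀ Z X τ → IsSolution 𝔐 ρ₀ P' 𝓕' W' X₀' Z' X' τ' →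
      pathLaw P X = pathLaw P' X') := by
  refine ⟨fun Ω mΩ P _ 𝓕 W X₀ Z hin => exists_isStrongSolution hT.le h𝔐 hin,
    fun Ω mΩ P _ 𝓕 𝓕' W X₀ Z X X' τ τ' hsol hsol' => hsol.ae_eq hT.le h𝔐 hsol', ?_, ?_⟩
  · obtain ⟨Ω, mΩ, P, hP, 𝓕, W, X₀, Z, hin⟩ := exists_isInput hT hρ₀
    obtain ⟨X, τ, 𝓖, -, hsol⟩ := exists_isStrongSolution hT.le h𝔐 hin
    exact ⟨Ω, mΩ, P, hP, 𝓖, W, X₀, Z, X, τ, hsol⟩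
  · intro Ω mΩ P _ 𝓕 W X₀ Z X τ Ω' mΩ' P' _ 𝓕' W' X₀' Z' X' τ' hsol hsol'
    obtain ⟨G, hG, -⟩ := hsol.input.exists_isDrivingPath hT.le
    obtain ⟨G', hG', -⟩ := hsol'.input.exists_isDrivingPath hT.le
    have := Measure.isProbabilityMeasure_map (μ := P) hG.measurable.aemeasurable
    obtain ⟨V, hV, -⟩ := existsUnique_isMcKeanFlow h𝔐 hT.le (P.map G)
    have hlaw := IsDrivingPath.map_eq hT.le hsol.input hG hsol'.input hG'
    rw [hsol.pathLaw_eq hT.le h𝔐 hG hV, hsol'.pathLaw_eq hT.le h𝔐 hG' (hlaw ▸ hV), hlaw]
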